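/- Let $\mathcal G$ be a profinite topological group and let $P$ be a nonempty finite set of primes. Suppose that for each $\ell\in P$ we are given: - a $\mathbb Q_\ell$-vector space $V_\ell$ of finite positive dimension $d_\ell$ with a $\mathbb Z_\ell$-lattice $T_\ell\subset V_\ell$ of rank $d_\ell$; - a connected reductive linear algebraic subgroup $\mathbb G_\ell\subset \mathrm{GL}(V_\ell)$ over $\mathbb Q_\ell$ of positive dimension; - an element $\bar u_\ell\in\mathbb G_\ell(\mathbb Q_\ell)\subset\mathrm{Aut}_{\mathbb Q_\ell}(V_\ell)$ whose characteristic polynomial $\det(t\,\mathrm{Id}-\bar u_\ell, V_\ell)\in\mathbb Q_\ell[t]$ has no multiple roots; - a continuous group homomorphism (for the $\ell$-adic topology on the target) $\rho_\ell:\mathcal G\to \mathrm{Aut}_{\mathbb Z_\ell}(T_\ell)\subset\mathrm{Aut}_{\mathbb Q_\ell}(V_\ell)$ whose image $G_\ell:=\rho_\ell(\mathcal G)$ is an open subgroup of $\mathbb G_\ell(\mathbb Q_\ell)$. For $u\in\mathrm{End}_{\mathbb Q_\ell}(V_\ell)$ let $Z(u)_0=\{f\in\mathrm{End}_{\mathbb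 Q_\ell}(V_\ell) : f(T_\ell)\subset T_\ell,\ fu=uf\}$ be the centralizer of $u$ in $\mathrm{End}_{\mathbb Z_\ell}(T_\ell)$, a $\mathbb Z_\ell$-algebra. Let $Y_\ell\subset\mathcal G$ be the set of all $\sigma\in\mathcal G$ such that $Z(\rho_\ell(\sigma))_0$ is isomorphic to $Z(\bar u_\ell)_0$ as a $\mathbb Z_\ell$-algebra, and put $Y:=\bigcap_{\ell\in P}Y_\ell$. Let $$\rho:\mathcal G\to\prod_{\ell\in P}G_\ell,\qquad \sigma\mapsto(\rho_\ell(\sigma))_{\ell\in P}.$$ Then the image $\rho(\mathcal G)$ is an open subgroup of finite index in $\prod_{\ell\in P}G_\ell$, and $Y$ is an open nonempty subset of $\mathcal G$ that is stable under conjugation and whose closure contains the identity element of $\mathcal G$. -/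

import Mathlib

open scoped TensorProduct Topology

noncomputable section

/-! ### Linear algebraic groups -/

section AlgebraicGroups

variable (K : Type*) [Field K] (V : Type*) [AddCommGroup V] [Module K V]

/-- The group `GL(V)(K̄)` of automorphisms of `K̄ ⊗ V` over an algebraic closure `K̄` of `K`. -/
abbrev GeometricGL : Type _ :=
  LinearMap.GeneralLinearGroup (AlgebraicClosure K) (AlgebraicClosure K ⊗[K] V)

/-- The natural inclusion `GL(V)(K) → GL(V)(K̄)`. -/
def toGeometricGL : LinearMap.GeneralLinearGroup K V →* GeometricGL K V :=
  Units.map (Module.End.baseChangeHom K (AlgebraicClosure K) V).toMonoidHom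

variable [FiniteDimensional K V]

/-- The entries of the matrix of an element of `GL(V)(K̄)` in a `K`-basis of `V`. -/
def matrixEntry (g : GeometricGL K V)
    (ij : Fin (Module.finrank K V) × Fin (Module.finrank K V)) : AlgebraicClosure K :=
  LinearMap.toMatrix ((Module.finBasis K V).baseChange (AlgebraicClosure K))
    ((Module.finBasis K V).baseChange (AlgebraicClosure K))
    (g : Module.End (AlgebraicClosure K) (AlgebraicClosure K ⊗[K] V)) ij.1 ij.2

/-- The Zariski `F`-topology on `GL(V)(K̄)` (used for `F = K` and for `F = K̄`): the sets on which
some polynomial with coefficients in `F` in the matrix entries does not vanish form a base. The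
inverse of the determinant can be left out, since it can be cleared from an equation.
The topology does not depend on the choice of a `K`-basis of `V`. -/
@[reducible] def zariskiTopology (F : Type*) [Field F] [Algebra F (AlgebraicClosure K)] :
    TopologicalSpace (GeometricGL K V) :=
  TopologicalSpace.generateFrom
    {U | ∃ p : MvPolynomial (Fin (Module.finrank K V) × Fin (Module.finrank K V)) F,
      U = {g | MvPolynomial.aeval (matrixEntry K V g) p ≠ 0}}

/-- A linear algebraic subgroup of `GL(V)` over a field `K` of characteristic zero, given by its
group of `K̄`-points: a subgroup of `GL(V)(K̄)` that is closed in the Zariski `K`-topology, i.e.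
cut out by polynomial equations with coefficients in `K`. -/
structure LinearAlgebraicSubgroup [CharZero K] where
  /-- The group of points over an algebraic closure. -/
  points : Subgroup (GeometricGL K V)
  isClosed_points : IsClosed[zariskiTopology K V K] (points : Set (GeometricGL K V))

namespace LinearAlgebraicSubgroup

variable {K V} [CharZero K] (𝔾 : LinearAlgebraicSubgroup K V)

/-- The group `𝔾(K)` of `K`-points, as a subgroup of `GL(V)(K)`. -/
def rationalPoints : Subgroup (LinearMap.GeneralLinearGroup K V) :=
  𝔾.points.comap (toGeometricGL K V)

/-- The dimension of `𝔾`: the Krull dimension of `𝔾(K̄)` with its Zariski topology. -/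
def dim : WithBot ℕ∞ :=
  @topologicalKrullDim 𝔾.points
    (TopologicalSpace.induced Subtype.val (zariskiTopology K V (AlgebraicClosure K)))

/-- `𝔾` is connected: `𝔾(K̄)` is connected in the Zariski topology. -/
def IsConnected : Prop :=
  @_root_.IsConnected _ (zariskiTopology K V (AlgebraicClosure K))
    (𝔾.points : Set (GeometricGL K V))

/-- `𝔾` has trivial unipotent radical: every Zariski-closed connected normal subgroup of `𝔾(K̄)`
that consists of unipotent elements is trivial. -/
def HasTrivialUnipotentRadical : Prop :=
  ∀ U : Subgroup (GeometricGL K V), U ≤ 𝔾.points →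
    (U.subgroupOf 𝔾.points).Normal →
    IsClosed[zariskiTopology K V (AlgebraicClosure K)] (U : Set (GeometricGL K V)) →
    @_root_.IsConnected _ (zariskiTopology K V (AlgebraicClosure K))
      (U : Set (GeometricGL K V)) →
    (∀ g ∈ U, IsNilpotent
      ((g : Module.End (AlgebraicClosure K) (AlgebraicClosure K ⊗[K] V)) - 1)) →
    U = ⊥

/-- Connected reductive groups. -/
structure IsConnectedReductive : Prop where
  connected : 𝔾.IsConnected
  trivial_unipotentRadical : 𝔾.HasTrivialUnipotentRadical

end LinearAlgebraicSubgroup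

end AlgebraicGroups

/-! ### Lattices and centralizers over the `p`-adic numbers -/

section Padic

variable {p : ℕ} [Fact p.Prime] {V : Type*} [AddCommGroup V] [Module ℚ_[p] V]

/-- The `p`-adic topology on `End(V)`, the usual one when `V` is finite-dimensional; `GL(V)`, as
the group of units of `End(V)`, gets its topology from this one. -/
instance padicEndTopology : TopologicalSpace (Module.End ℚ_[p] V) :=
  moduleTopology ℚ_[p] (Module.End ℚ_[p] V)

variable [Module ℤ_[p] V] [IsScalarTower ℤ_[p] ℚ_[p] V]

/-- `End_{ℤ_p}(T)` inside `End_{ℚ_p}(V)`, for a lattice `T` in `V`: the endomorphisms of `V` that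
map `T` into itself. -/
def latticeEnd (T : Submodule ℤ_[p] V) : Subalgebra ℤ_[p] (Module.End ℚ_[p] V) where
  carrier := {f | ∀ x ∈ T, f x ∈ T}
  mul_mem' hf hg x hx := hf _ (hg x hx)
  add_mem' hf hg x hx := T.add_mem (hf x hx) (hg x hx)
  algebraMap_mem' c _ hx := T.smul_mem c hx

/-- `Aut_{ℤ_p}(T)` inside `GL(V)`: the units of `latticeEnd T`. -/
def latticeAut (T : Submodule ℤ_[p] V) : Subgroup (LinearMap.GeneralLinearGroup ℚ_[p] V) :=
  (latticeEnd T).toSubmonoid.units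

/-- The centralizer `Z(u)₀` of `u ∈ End_{ℚ_p}(V)` in `End_{ℤ_p}(T)`, a `ℤ_p`-algebra. -/
def centralizerOrder (T : Submodule ℤ_[p] V) (u : Module.End ℚ_[p] V) :
    Subalgebra ℤ_[p] (Module.End ℚ_[p] V) :=
  latticeEnd T ⊓ Subalgebra.centralizer ℤ_[p] {u}

end Padic

end

/-! Openness of the image comes from powers. If every `ρ q σ` is congruent to 1 modulo `q`, take
exponents `m j` congruent to 1 modulo `ℓ ^ j` and divisible by `q ^ j` for the other primes `q`. A
limit point of `σ ^ m j` has the image of `σ` at `ℓ` and trivial image elsewhere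
(`exists_eq_of_eq_and_eq_one`). Products of such limits fill a box around 1 (`isOpen_range_pi`), and
finite index follows by compactness.

Conjugation by an element of `Aut(T)` is an isomorphism of integral centralizers, so `Y` is
conjugation stable. Openness of `Y` is a form of Krasner's lemma: if the centralizer of `x` is
commutative and reduced, then `ad x` is semisimple, the map `(a, c) ↦ (1 + a)(x + c)(1 + a)⁻¹` with
`c` in the centralizer is a submersion at the origin, and every `y` near `x` is conjugate by some
`g` near 1, hence in `Aut(T)`, to an element with the centralizer of `x` (`eventually_exists_conj`).

For the closure of `Y`, openness of the image reduces the claim to a single `ℓ`: elements of the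
image of `ρ ℓ` near 1 with the centralizer of `u` are needed (`exists_mem_commute_iff`). They are
`exp (s • Y)` for small nonzero `s`, where `Y` lies in the Lie algebra, commutes with `u`, and has
no larger centralizer than `u` (`exists_rationalLie_commute_imp`).

Such a `Y` exists by the following argument. Diagonalize `u` over an algebraic closure, with
distinct entries `d`. If no `Y` works, then for some `i ≠ j` the entries `i` and `j` agree for all
Lie algebra elements commuting with `u`. Put `ζ = d i / d j ≠ 1`, and let `S` be the set of
conjugates of elements that have the centralizer of `u` and entries `i`, `j` with ratio `ζ`. Every
Lie algebra direction is tangent to `S`, so the polynomials of bounded degree vanishing on `S` are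
stable under the Lie algebra. A finite-dimensional stable space of polynomials vanishing at one
point of a connected group vanishes on the whole group (`le_groupIdeal_of_rightDeriv_stable`). But
the polynomial saying that two eigenvalues have ratio `ζ` vanishes on `S` and not at 1. -/

open scoped Kronecker

noncomputable section

/-! ### Left-invariant derivations and the Lie algebra of a matrix group. -/

section MatrixPolynomials

variable {n : Type*} [Fintype n] [DecidableEq n]

/-- Evaluation of a polynomial in matrix entries at a matrix with entries in an algebra. -/
def evalMatrix (F : Type*) {R : Type*} [CommRing F] [CommRing R] [Algebra F R]
    (g : Matrix n n R) : MvPolynomial (n × n) F →ₐ[F] R :=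
  MvPolynomial.aeval fun ij => g ij.1 ij.2

variable {k : Type*} [Field k]

/-- The polynomial `x ↦ f (g * x)`. -/
def leftTranslate (g : Matrix n n k) : MvPolynomial (n × n) k →ₐ[k] MvPolynomial (n × n) k :=
  MvPolynomial.aeval fun ij => ∑ l, MvPolynomial.C (g ij.1 l) * MvPolynomial.X (l, ij.2)

/-- The derivation of the polynomial ring in the entries of `x` given by `x ↦ x * X`. -/
def rightDeriv (X : Matrix n n k) :
    Derivation k (MvPolynomial (n × n) k) (MvPolynomial (n × n) k) :=
  MvPolynomial.mkDerivation k fun ij => ∑ l, MvPolynomial.C (X l ij.2) * MvPolynomial.X (ij.1, l)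

omit [DecidableEq n] in
theorem evalMatrix_leftTranslate (g h : Matrix n n k) (f : MvPolynomial (n × n) k) :
    evalMatrix k h (leftTranslate g f) = evalMatrix k (g * h) f := by
  have : (evalMatrix k h).comp (leftTranslate g) = evalMatrix k (g * h) := by
    ext ij
    simp [evalMatrix, leftTranslate, Matrix.mul_apply]
  exact DFunLike.congr_fun this f

/-- Two derivations of a polynomial ring with values in fields of constants agree at a point
when they agree on the variables at that point. -/
theorem eval_derivation_eq {σ A : Type*} [CommRing A] [Algebra k A]
    (φ : MvPolynomial σ k →ₐ[k] A)
    (D D' : Derivation k (MvPolynomial σ k) (MvPolynomial σ k))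
    (h : ∀ i, φ (D (MvPolynomial.X i)) = φ (D' (MvPolynomial.X i))) (f : MvPolynomial σ k) :
    φ (D f) = φ (D' f) := by
  induction f using MvPolynomial.induction_on with
  | C a => simp [← MvPolynomial.algebraMap_eq]
  | add p q hp hq => simp [hp, hq]
  | mul_X p i hp => simp [hp, h i]

omit [DecidableEq n] in
-- Left and right multiplication commute, so the vector field `x ↦ x * X` is left invariant; it
-- suffices to compare on the variables.
theorem rightDeriv_leftTranslate (g X : Matrix n n k) (f : MvPolynomial (n × n) k) :
    rightDeriv X (leftTranslate g f) = leftTranslate g (rightDeriv X f) := by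
  induction f using MvPolynomial.induction_on with
  | C a => simp [← MvPolynomial.algebraMap_eq]
  | add p q hp hq => simp [hp, hq]
  | mul_X p i hp =>
    have : rightDeriv X (leftTranslate g (MvPolynomial.X i)) =
        leftTranslate g (rightDeriv X (MvPolynomial.X i)) := by
      simp only [leftTranslate, MvPolynomial.aeval_X, rightDeriv, MvPolynomial.mkDerivation_X,
        map_sum, Derivation.leibniz, map_mul, ← MvPolynomial.algebraMap_eq, AlgHom.commutes,
        Derivation.map_algebraMap, smul_eq_mul, Finset.mul_sum]
      rw [Finset.sum_comm]
      refine Finset.sum_congr rfl fun _ _ => ?_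
      simp only [MvPolynomial.algebraMap_eq, mul_zero, add_zero]
      exact Finset.sum_congr rfl fun _ _ => mul_left_comm _ _ _
    simp [hp, this]

omit [DecidableEq n] in
theorem evalMatrix_rightDeriv_X (X g : Matrix n n k) (ij : n × n) :
    evalMatrix k g (rightDeriv X (MvPolynomial.X ij)) = (g * X) ij.1 ij.2 := by
  simp [rightDeriv, evalMatrix, Matrix.mul_apply, mul_comm]

omit [DecidableEq n] in
theorem rightDeriv_add (X Y : Matrix n n k) (f : MvPolynomial (n × n) k) :
    rightDeriv (X + Y) f = rightDeriv X f + rightDeriv Y f := by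
  rw [← Derivation.add_apply]
  congr 1
  ext i
  simp [rightDeriv, add_mul, Finset.sum_add_distrib]

omit [DecidableEq n] in
theorem rightDeriv_smul (c : k) (X : Matrix n n k) (f : MvPolynomial (n × n) k) :
    rightDeriv (c • X) f = c • rightDeriv X f := by
  rw [← Derivation.smul_apply]
  congr 1
  ext i
  simp [rightDeriv, Finset.smul_sum, MvPolynomial.smul_eq_C_mul, mul_assoc]

/-- The ideal of polynomials in the matrix entries that vanish on a set of matrices. -/
def matrixVanishingIdeal (S : Set (Matrix n n k)) : Ideal (MvPolynomial (n × n) k) where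
  carrier := {f | ∀ g ∈ S, evalMatrix k g f = 0}
  add_mem' hf hg x hx := by simp [hf x hx, hg x hx]
  zero_mem' x _ := by simp
  smul_mem' c f hf x hx := by simp [hf x hx]

omit [Fintype n] [DecidableEq n] in
theorem mem_matrixVanishingIdeal {S : Set (Matrix n n k)} {f : MvPolynomial (n × n) k} :
    f ∈ matrixVanishingIdeal S ↔ ∀ g ∈ S, evalMatrix k g f = 0 := Iff.rfl

/-- The set of matrices underlying a group of invertible matrices. -/
def matricesOf (Γ : Subgroup (Matrix n n k)ˣ) : Set (Matrix n n k) := Units.val '' (Γ : Set _)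

/-- The ideal of a matrix group. -/
abbrev groupIdeal (Γ : Subgroup (Matrix n n k)ˣ) : Ideal (MvPolynomial (n × n) k) :=
  matrixVanishingIdeal (matricesOf Γ)

theorem mem_groupIdeal {Γ : Subgroup (Matrix n n k)ˣ} {f : MvPolynomial (n × n) k} :
    f ∈ groupIdeal Γ ↔ ∀ g ∈ Γ, evalMatrix k (g : Matrix n n k) f = 0 := by
  simp [groupIdeal, mem_matrixVanishingIdeal, matricesOf]

/-- The Lie algebra of a matrix group: the tangent space at `1` to its Zariski closure. -/
def groupLie (Γ : Subgroup (Matrix n n k)ˣ) : Submodule k (Matrix n n k) where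
  carrier := {X | ∀ f ∈ groupIdeal Γ, evalMatrix k (1 : Matrix n n k) (rightDeriv X f) = 0}
  add_mem' hX hY f hf := by simp [rightDeriv_add, hX f hf, hY f hf]
  zero_mem' f _ := by
    have := rightDeriv_smul (0 : k) (0 : Matrix n n k) f
    simp only [smul_zero, zero_smul] at this
    simp [this]
  smul_mem' c X hX f hf := by simp [rightDeriv_smul, hX f hf]

variable {Γ : Subgroup (Matrix n n k)ˣ}

theorem leftTranslate_mem_groupIdeal {f : MvPolynomial (n × n) k} (hf : f ∈ groupIdeal Γ)
    {g : (Matrix n n k)ˣ} (hg : g ∈ Γ) : leftTranslate (g : Matrix n n k) f ∈ groupIdeal Γ := by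
  rw [mem_groupIdeal] at hf ⊢
  intro h hh
  rw [evalMatrix_leftTranslate, ← Units.val_mul]
  exact hf _ (mul_mem hg hh)

/-- By left invariance, the derivative at `g` is the derivative at 1 of a translate of `f`, and
translates by the group stay in the ideal. -/
theorem rightDeriv_mem_groupIdeal {X : Matrix n n k} (hX : X ∈ groupLie Γ)
    {f : MvPolynomial (n × n) k} (hf : f ∈ groupIdeal Γ) : rightDeriv X f ∈ groupIdeal Γ := by
  rw [mem_groupIdeal]
  intro g hg
  have := hX _ (leftTranslate_mem_groupIdeal hf hg)
  rwa [rightDeriv_leftTranslate, evalMatrix_leftTranslate, mul_one] at this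

/-- A derivation of the polynomial ring that preserves the ideal of a matrix group is, at each
point `g` of the group, of the form `rightDeriv X` with `X` in the Lie algebra. -/
theorem exists_groupLie_of_derivation
    (D : Derivation k (MvPolynomial (n × n) k) (MvPolynomial (n × n) k))
    (hD : ∀ f ∈ groupIdeal Γ, D f ∈ groupIdeal Γ) {g : (Matrix n n k)ˣ} (hg : g ∈ Γ) :
    ∃ X ∈ groupLie Γ, ∀ f, evalMatrix k (g : Matrix n n k) (D f) =
      evalMatrix k (g : Matrix n n k) (rightDeriv X f) := by
  -- `W` is the tangent vector of `D` at `g`. It equals `g * X` for `X = g⁻¹ * W`, and translating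
  -- by `g⁻¹` moves it to the tangent vector `X` at 1.
  let W : Matrix n n k := Matrix.of fun i j => evalMatrix k (g : Matrix n n k)
    (D (MvPolynomial.X (i, j)))
  have key : ∀ f, evalMatrix k (g : Matrix n n k) (D f) =
      evalMatrix k (g : Matrix n n k) (rightDeriv ((↑g⁻¹ : Matrix n n k) * W) f) := by
    refine eval_derivation_eq (evalMatrix k (g : Matrix n n k)) D _ fun ij => ?_
    rw [evalMatrix_rightDeriv_X, ← Matrix.mul_assoc, Units.mul_inv, Matrix.one_mul]
    rfl
  refine ⟨_, fun f hf => ?_, key⟩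
  have h1 := hD _ (leftTranslate_mem_groupIdeal hf (inv_mem hg))
  rw [mem_groupIdeal] at h1
  have h2 := h1 g hg
  rwa [key, rightDeriv_leftTranslate, evalMatrix_leftTranslate, Units.inv_mul] at h2

end MatrixPolynomials

/-! ### Derivations of function fields, and density of Lie-stable conditions. -/

/-- A transcendental element of a field extension of characteristic zero is not killed by all
derivations. -/
theorem exists_derivation_ne_zero {k F : Type*} [Field k] [CharZero k] [Field F] [Algebra k F]
    {z : F} (hz : Transcendental k z) :
    ∃ D : Derivation k F F, D z ≠ 0 := by
  classical
  have : CharZero F := charZero_of_injective_algebraMap (algebraMap k F).injective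
  have hind : AlgebraicIndepOn k id ({z} : Set F) := by
    rw [AlgebraicIndepOn, algebraicIndependent_unique_type_iff]; simpa using hz
  obtain ⟨B, hzB, hB⟩ := exists_isTranscendenceBasis_superset hind
  let φ : MvPolynomial B k →ₐ[k] F := MvPolynomial.aeval (fun b : B => (b : F))
  have hφ : Function.Injective φ := hB.1
  let _ : Algebra (MvPolynomial B k) F := φ.toAlgebra
  have : IsScalarTower k (MvPolynomial B k) F := IsScalarTower.of_algebraMap_eq' φ.comp_algebraMap.symm
  have : FaithfulSMul (MvPolynomial B k) F := (faithfulSMul_iff_algebraMap_injective _ _).2 hφ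
  let _ : Algebra (FractionRing (MvPolynomial B k)) F := FractionRing.liftAlgebra _ _
  have : Algebra.IsAlgebraic (MvPolynomial B k) F := by
    have := hB.isAlgebraic
    refine ⟨fun x => ?_⟩
    exact (this.isAlgebraic x).of_ringHom_of_comp_eq hB.1.aevalEquiv.toRingEquiv.toRingHom (RingHom.id F)
      hB.1.aevalEquiv.surjective Function.injective_id (by
        ext a
        · simp [RingHom.algebraMap_toAlgebra, φ]
        · simp [RingHom.algebraMap_toAlgebra, φ])
  have : Algebra.IsAlgebraic (FractionRing (MvPolynomial B k)) F :=
    (IsFractionRing.comap_isAlgebraic_iff (A := MvPolynomial B k)).1 this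
  have : CharZero (FractionRing (MvPolynomial B k)) :=
    charZero_of_injective_algebraMap (algebraMap k _).injective
  -- `F` is algebraic, hence separable, over the fraction field of the polynomial ring on a
  -- transcendence basis through `z`. Formal étaleness then extends the partial derivative along `z`
  -- to `F`.
  have : Algebra.FormallyEtale (FractionRing (MvPolynomial B k)) F :=
    Algebra.FormallyEtale.of_isSeparable _ F
  have : Algebra.FormallyEtale (MvPolynomial B k) (FractionRing (MvPolynomial B k)) :=
    Algebra.FormallyEtale.of_isLocalization (nonZeroDivisors _)
  have : Algebra.FormallyEtale (MvPolynomial B k) F :=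
    Algebra.FormallyEtale.comp _ (FractionRing (MvPolynomial B k)) _
  let d : Derivation k (MvPolynomial B k) F := MvPolynomial.mkDerivation k (Pi.single ⟨z, hzB rfl⟩ 1)
  let e := KaehlerDifferential.tensorKaehlerEquivOfFormallyEtale k (MvPolynomial B k) F
  let ℓ : Ω[F⁄k] →ₗ[F] F := (LinearMap.liftBaseChange F d.liftKaehlerDifferential) ∘ₗ e.symm.toLinearMap
  refine ⟨ℓ.compDer (KaehlerDifferential.D k F), ?_⟩
  have hz' : z = algebraMap (MvPolynomial B k) F (MvPolynomial.X ⟨z, hzB rfl⟩) := by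
    change z = φ _
    simp [φ]
  have : ℓ.compDer (KaehlerDifferential.D k F) z = 1 := by
    conv_lhs => rw [hz']
    change LinearMap.liftBaseChange F d.liftKaehlerDifferential (e.symm _) = 1
    erw [KaehlerDifferential.tensorKaehlerEquivOfFormallyEtale_symm_D_algebraMap]
    simp [d]
  rw [this]; exact one_ne_zero

section Density

variable {n : Type*} [Fintype n] [DecidableEq n] {k : Type*} [Field k]

omit [Fintype n] [DecidableEq n] in
/-- A finite-dimensional space of polynomials has a basis of evaluations. -/
theorem exists_det_evalMatrix_ne_zero [Infinite k] (M : Submodule k (MvPolynomial (n × n) k))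
    [FiniteDimensional k M] {r : ℕ} (b : Module.Basis (Fin r) k M) :
    ∃ p : Fin r → Matrix n n k,
      (Matrix.of fun i j => evalMatrix k (p i) (b j : MvPolynomial (n × n) k)).det ≠ 0 := by
  let ev : Matrix n n k → Module.Dual k M := fun g =>
    (evalMatrix k g).toLinearMap ∘ₗ M.subtype
  -- Over an infinite field a polynomial with all values zero is zero, so evaluations span the dual
  -- of `M` and a dual basis of evaluations can be extracted.
  have hspan : Submodule.span k (Set.range ev) = ⊤ := by
    rw [← Subspace.dualCoannihilator_dualAnnihilator_eq (W := Submodule.span k (Set.range ev))]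
    suffices h : (Submodule.span k (Set.range ev)).dualCoannihilator = ⊥ by
      rw [h, Submodule.dualAnnihilator_bot]
    rw [eq_bot_iff]
    intro f hf
    rw [Submodule.mem_dualCoannihilator] at hf
    have : (f : MvPolynomial (n × n) k) = 0 := by
      refine MvPolynomial.funext fun x => ?_
      have := hf _ (Submodule.subset_span ⟨Matrix.of fun i j => x (i, j), rfl⟩)
      simpa [ev, evalMatrix, MvPolynomial.aeval_eq_eval] using this
    simpa using this
  obtain ⟨φ, hφ, -, hli⟩ := Submodule.exists_fun_fin_finrank_span_eq k (Set.range ev)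
  have hr : Module.finrank k (Submodule.span k (Set.range ev)) = r := by
    rw [hspan, finrank_top, Subspace.dual_finrank_eq, Module.finrank_eq_card_basis b,
      Fintype.card_fin]
  choose p hp using fun i => hφ (Fin.cast hr.symm i)
  replace hli := hli.comp (Fin.cast hr.symm) (Fin.cast_injective _)
  refine ⟨p, ?_⟩
  let Φ : Module.Dual k M →ₗ[k] (Fin r → k) := LinearMap.pi fun j => Module.Dual.eval k M (b j)
  have hΦ : LinearMap.ker Φ = ⊥ := by
    rw [LinearMap.ker_eq_bot']
    intro ψ hψ
    exact b.ext fun j => by simpa [Φ] using congrFun hψ j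
  have := (hli.map' Φ hΦ)
  have h2 : Φ ∘ φ ∘ Fin.cast hr.symm = (Matrix.of fun i j =>
      evalMatrix k (p i) (b j : MvPolynomial (n × n) k)).row := by
    ext i j
    simp [Φ, ← hp, ev]
  rw [h2] at this
  exact ((Matrix.isUnit_iff_isUnit_det _).1 (Matrix.linearIndependent_rows_iff_isUnit.1 this)).ne_zero

omit [Fintype n] [DecidableEq n] in
theorem evalMatrix_vecMul_adjugate {r : ℕ} (v : Fin r → MvPolynomial (n × n) k)
    (a : Matrix (Fin r) (Fin r) (MvPolynomial (n × n) k)) (g : Matrix n n k) (i : Fin r) :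
    evalMatrix k g (Matrix.vecMul v a.adjugate i) =
      Matrix.vecMul (fun j => evalMatrix k g (v j)) (a.map (evalMatrix k g)).adjugate i := by
  have : (a.map (evalMatrix k g)).adjugate = a.adjugate.map (evalMatrix k g) :=
    (AlgHom.map_adjugate (evalMatrix k g) a).symm
  rw [this]
  simp [Matrix.vecMul, dotProduct]

/-- Up to a denominator, a derivation of the field of fractions of a quotient of a polynomial ring
comes from the polynomial ring. -/
theorem exists_polynomial_derivation {σ A F : Type*} [Finite σ] [CommRing A] [IsDomain A] [Field F]
    [Algebra k A] [Algebra A F] [Algebra k F] [IsScalarTower k A F] [IsFractionRing A F]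
    (π : MvPolynomial σ k →ₐ[k] A) (hπ : Function.Surjective π) (D : Derivation k F F) :
    ∃ q : F, q ≠ 0 ∧ ∃ D' : Derivation k (MvPolynomial σ k) (MvPolynomial σ k),
      ∀ f, algebraMap A F (π (D' f)) = q * D (algebraMap A F (π f)) := by
  -- `q` is a common denominator for the values of `D` on the finitely many variables.
  obtain ⟨q, hq⟩ := IsLocalization.exist_integer_multiples_of_finite (nonZeroDivisors A)
    (fun l : σ => D (algebraMap A F (π (MvPolynomial.X l))))
  choose w' hw' using hq
  choose w hw using fun l => hπ (w' l)
  refine ⟨algebraMap A F q, by simp, MvPolynomial.mkDerivation k w, fun f => ?_⟩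
  induction f using MvPolynomial.induction_on with
  | C x =>
    have : algebraMap A F (π (MvPolynomial.C x)) = algebraMap k F x := by
      rw [← MvPolynomial.algebraMap_eq, AlgHom.commutes, ← IsScalarTower.algebraMap_apply]
    rw [this, Derivation.map_algebraMap, ← MvPolynomial.algebraMap_eq, Derivation.map_algebraMap]
    simp
  | add f g hf hg => simp only [map_add, hf, hg, mul_add]
  | mul_X f l hf =>
    have : algebraMap A F (π (MvPolynomial.mkDerivation k w (MvPolynomial.X l))) =
        algebraMap A F q * D (algebraMap A F (π (MvPolynomial.X l))) := by
      rw [MvPolynomial.mkDerivation_X, hw, hw' l, Algebra.smul_def]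
    simp only [Derivation.leibniz, map_add, map_mul, smul_eq_mul, hf, this]
    ring

/-- A derivation of the polynomial ring that preserves the ideal of a matrix group satisfies
Cramer's rule modulo that ideal on the translates of a stable space of polynomials. -/
theorem cramer_derivation_mem_groupIdeal {Γ : Subgroup (Matrix n n k)ˣ}
    (M : Submodule k (MvPolynomial (n × n) k)) {r : ℕ} (b : Module.Basis (Fin r) k M)
    (hM : ∀ X ∈ groupLie Γ, ∀ f ∈ M, rightDeriv X f ∈ M)
    {D' : Derivation k (MvPolynomial (n × n) k) (MvPolynomial (n × n) k)}
    (hD'I : ∀ f ∈ groupIdeal Γ, D' f ∈ groupIdeal Γ) (h : Fin r → Matrix n n k)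
    {v : Fin r → MvPolynomial (n × n) k} (hv : v = fun j => (b j : MvPolynomial (n × n) k))
    {a : Matrix (Fin r) (Fin r) (MvPolynomial (n × n) k)}
    (ha : a = Matrix.of fun i j => leftTranslate (h i) (v j)) (j : Fin r) :
    a.det * D' (v j) - ∑ i, Matrix.vecMul v a.adjugate i * D' (a i j) ∈ groupIdeal Γ := by
  rw [mem_groupIdeal]
  intro g hg
  obtain ⟨X, hX, hXD⟩ := exists_groupLie_of_derivation D' hD'I hg
  -- `α` is the matrix of `rightDeriv X` on `M`. As left translation commutes with `rightDeriv X`,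
  -- the vector `v` and all rows of `a` are multiplied by the same `α`; the claim becomes `v * adj a
  -- * a * α = det a • (v * α)`.
  let α : Matrix (Fin r) (Fin r) k :=
    Matrix.of fun l j => b.repr ⟨rightDeriv X (b j), hM X hX _ (b j).2⟩ l
  have hα : ∀ j, rightDeriv X (v j) = ∑ l, α l j • v l := by
    intro j
    have := congrArg (M.subtype) (b.sum_repr ⟨rightDeriv X (b j), hM X hX _ (b j).2⟩)
    rw [map_sum] at this
    rw [hv]
    exact this.symm
  have e1 : evalMatrix k (g : Matrix n n k) (D' (v j)) =
      Matrix.vecMul (fun j => evalMatrix k (g : Matrix n n k) (v j)) α j := by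
    rw [hXD, hα]
    simp [Matrix.vecMul, dotProduct, mul_comm]
  have e2 : ∀ i, evalMatrix k (g : Matrix n n k) (D' (a i j)) =
      ((a.map (evalMatrix k (g : Matrix n n k))) * α) i j := by
    intro i
    have : a i j = leftTranslate (h i) (v j) := by rw [ha]; rfl
    rw [hXD, this, rightDeriv_leftTranslate, hα]
    simp [Matrix.mul_apply, mul_comm, ha]
  have e3 : evalMatrix k (g : Matrix n n k) a.det = (a.map (evalMatrix k (g : Matrix n n k))).det :=
    AlgHom.map_det _ _
  have e4 := evalMatrix_vecMul_adjugate v a (g : Matrix n n k)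
  rw [map_sub, map_sum, sub_eq_zero, map_mul, e1]
  simp only [map_mul, e2, e3, e4]
  generalize (a.map (evalMatrix k (g : Matrix n n k))) = aG
  generalize (fun j => evalMatrix k (g : Matrix n n k) (v j)) = vG
  change _ = Matrix.vecMul (Matrix.vecMul vG aG.adjugate) (aG * α) j
  rw [Matrix.vecMul_vecMul, ← Matrix.mul_assoc, Matrix.adjugate_mul, Matrix.smul_mul,
    Matrix.one_mul, Matrix.vecMul_smul]
  rfl

/-- A finite-dimensional space of polynomials that is stable under the Lie algebra of a connected
matrix group and vanishes at one point of the group vanishes on the group. -/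
theorem le_groupIdeal_of_rightDeriv_stable [IsAlgClosed k] [CharZero k]
    {Γ : Subgroup (Matrix n n k)ˣ} (hI : (groupIdeal Γ).IsPrime)
    (M : Submodule k (MvPolynomial (n × n) k)) [FiniteDimensional k M]
    (hM : ∀ X ∈ groupLie Γ, ∀ f ∈ M, rightDeriv X f ∈ M)
    {u : (Matrix n n k)ˣ} (hu : u ∈ Γ) (hMu : ∀ f ∈ M, evalMatrix k (u : Matrix n n k) f = 0)
    {f : MvPolynomial (n × n) k} (hf : f ∈ M) : f ∈ groupIdeal Γ := by
  obtain ⟨r, ⟨b⟩⟩ : ∃ r, Nonempty (Module.Basis (Fin r) k M) := ⟨_, ⟨Module.finBasis k M⟩⟩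
  obtain ⟨p, hp⟩ := exists_det_evalMatrix_ne_zero M b
  let v : Fin r → MvPolynomial (n × n) k := fun j => b j
  -- The factor `u⁻¹` is chosen so that row `i` of `a` takes the value `v (p i)` at `u`, which makes
  -- `Δ` nonzero there.
  let a : Matrix (Fin r) (Fin r) (MvPolynomial (n × n) k) :=
    Matrix.of fun i j => leftTranslate (p i * (↑u⁻¹ : Matrix n n k)) (v j)
  let Δ := a.det
  let c := Matrix.vecMul v a.adjugate
  have hca : Matrix.vecMul c a = Δ • v := by
    simp [c, Matrix.vecMul_vecMul, Matrix.adjugate_mul, Δ, Matrix.vecMul_smul]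
  have evΔ : ∀ g : Matrix n n k, evalMatrix k g Δ = (a.map (evalMatrix k g)).det := fun g => by
    rw [AlgHom.map_det]; rfl
  have evc := evalMatrix_vecMul_adjugate v a
  have hΔu : evalMatrix k (u : Matrix n n k) Δ ≠ 0 := by
    rw [evΔ]
    convert hp using 2
    ext i j
    simp [a, evalMatrix_leftTranslate, v, Matrix.mul_assoc]
  let A := MvPolynomial (n × n) k ⧸ groupIdeal Γ
  let F := FractionRing A
  have : CharZero F := charZero_of_injective_algebraMap (algebraMap k F).injective
  let ι : MvPolynomial (n × n) k →ₐ[k] F := (IsScalarTower.toAlgHom k A F).comp (Ideal.Quotient.mkₐ k _)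
  have hι : ∀ f, ι f = 0 ↔ f ∈ groupIdeal Γ := by
    intro f
    rw [← Ideal.Quotient.eq_zero_iff_mem]
    exact map_eq_zero_iff (algebraMap A F) (IsFractionRing.injective A F)
  have hΔ : ι Δ ≠ 0 := fun h => hΔu (mem_groupIdeal.1 ((hι _).1 h) u hu)
  let z : Fin r → F := fun i => ι (c i) / ι Δ
  have hza : ∀ j, ι (v j) = ∑ i, z i * ι (a i j) := by
    intro j
    have := congrArg ι (congrFun hca j)
    simp only [Matrix.vecMul, dotProduct, map_sum, map_mul, Pi.smul_apply, smul_eq_mul] at this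
    simp only [z, div_mul_eq_mul_div, ← Finset.sum_div]
    rw [this, mul_div_cancel_left₀ _ hΔ]
  have hdet : IsUnit (a.map ι) := by
    rw [Matrix.isUnit_iff_isUnit_det]
    have : (a.map ι).det = ι Δ := by rw [AlgHom.map_det]; rfl
    rw [this]; exact hΔ.isUnit
  -- Over `F` one has `v = z * a` by Cramer's rule. Since `v` and the rows of `a` solve the same
  -- linear differential equation, `D v = z * D a`, so `(D z) * a = 0` with `a` invertible.
  have hz : ∀ D : Derivation k F F, ∀ i, D (z i) = 0 := by
    intro D
    obtain ⟨q, hq0, D', hD'⟩ := exists_polynomial_derivation (Ideal.Quotient.mkₐ k (groupIdeal Γ))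
      (Ideal.Quotient.mkₐ_surjective k _) D
    replace hD' : ∀ f, ι (D' f) = q * D (ι f) := hD'
    have hD'I : ∀ f ∈ groupIdeal Γ, D' f ∈ groupIdeal Γ := by
      intro f hf
      rw [← hι] at hf ⊢
      rw [hD', hf, map_zero, mul_zero]
    have key := cramer_derivation_mem_groupIdeal M b hM hD'I _ rfl (a := a) rfl
    have key2 : ∀ j, D (ι (v j)) = ∑ i, z i * D (ι (a i j)) := by
      intro j
      have := (hι _).2 (key j)
      simp only [map_sub, map_mul, map_sum, hD', sub_eq_zero] at this
      change ι Δ * _ = ∑ i, ι (c i) * _ at this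
      have h3 : ι Δ * D (ι (v j)) = ∑ i, ι (c i) * D (ι (a i j)) := by
        apply mul_left_cancel₀ hq0
        rw [Finset.mul_sum]
        calc _ = ι Δ * (q * D (ι (v j))) := by ring
          _ = _ := this.trans (Finset.sum_congr rfl fun i _ => by ring)
      simp only [z, div_mul_eq_mul_div, ← Finset.sum_div]
      rw [← h3, mul_div_cancel_left₀ _ hΔ]
    have key3 : Matrix.vecMul (fun i => D (z i)) (a.map ι) = 0 := by
      ext j
      have h4 : D (∑ i, z i * ι (a i j)) = ∑ i, z i * D (ι (a i j)) + ∑ i, D (z i) * ι (a i j) := by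
        rw [map_sum, ← Finset.sum_add_distrib]
        refine Finset.sum_congr rfl fun i _ => ?_
        rw [Derivation.leibniz, smul_eq_mul, smul_eq_mul, mul_comm (ι (a i j))]
      rw [← hza, key2] at h4
      exact left_eq_add.1 h4
    have h0 := Matrix.vecMul_injective_of_isUnit hdet (key3.trans (Matrix.zero_vecMul _).symm)
    exact congrFun h0
  -- A function killed by all derivations is algebraic over `k`, hence a constant `t`. At `u` the
  -- numerator `c i` vanishes with `v` while `Δ` does not, so `t = 0`.
  have hc : ∀ i, ι (c i) = 0 := by
    intro i
    have halg : IsAlgebraic k (z i) := by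
      by_contra h
      obtain ⟨D, hD⟩ := exists_derivation_ne_zero (k := k) h
      exact hD (hz D i)
    obtain ⟨t, ht⟩ : ∃ t, algebraMap k F t = z i :=
      minpoly.mem_range_of_degree_eq_one k _ (IsAlgClosed.degree_eq_one_of_irreducible k
        (minpoly.irreducible halg.isIntegral))
    have h1 : ι (c i - MvPolynomial.C t * Δ) = 0 := by
      have h2 : ι (MvPolynomial.C t) = algebraMap k F t := ι.commutes t
      rw [map_sub, map_mul, h2, ht, div_mul_cancel₀ _ hΔ, sub_self]
    have h3 := mem_groupIdeal.1 ((hι _).1 h1) u hu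
    have h4 : evalMatrix k (u : Matrix n n k) (c i) = 0 := by
      rw [evc]
      have : (fun j => evalMatrix k (u : Matrix n n k) (v j)) = 0 := by
        ext j
        exact hMu _ (b j).2
      rw [this, Matrix.zero_vecMul]; rfl
    rw [map_sub, map_mul, h4, zero_sub, neg_eq_zero, mul_eq_zero, or_iff_left hΔu] at h3
    have h5 : t = 0 := by simpa [evalMatrix] using h3
    have : z i = 0 := by rw [← ht, h5, map_zero]
    simpa [z, hΔ] using this
  have hv : ∀ j, v j ∈ groupIdeal Γ := by
    intro j
    rw [← hι, hza]
    exact Finset.sum_eq_zero fun i _ => by simp [z, hc i]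
  have := congrArg (M.subtype) (b.sum_repr ⟨f, hf⟩)
  rw [map_sum] at this
  rw [show f = _ from this.symm]
  refine Ideal.sum_mem _ fun j _ => ?_
  rw [map_smul, MvPolynomial.smul_eq_C_mul]
  exact Ideal.mul_mem_left _ _ (hv j)

end Density

/-! ### Galois descent for the ideal and the Lie algebra. -/

section Descent

variable {K k : Type*} [Field K] [Field k] [Algebra K k]

/-- Elements of a Galois extension that are linearly independent over the base field have
linearly independent families of conjugates. -/
theorem eq_zero_of_sum_galois_eq_zero [IsGalois K k] {ι : Type*} {b : ι → k}
    (hb : LinearIndependent K b) (s : Finset ι) (y : ι → k)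
    (h : ∀ σ : k ≃ₐ[K] k, ∑ a ∈ s, σ (b a) * y a = 0) : ∀ a ∈ s, y a = 0 := by
  classical
  -- The subfield fixed by the Galois group is the image of `K`, so independence over `K` is
  -- independence over the fixed field.
  have h1 : LinearIndepOn (FixedPoints.subfield (k ≃ₐ[K] k) k) id ((s.image b : Finset k) : Set k) := by
    rw [linearIndepOn_finset_iff]
    intro c hc
    have hfix : ∀ x, ∃ d : K, algebraMap K k d = c x := fun x =>
      (InfiniteGalois.mem_range_algebraMap_iff_fixed (c x : k)).2 fun f => (c x).2 f
    choose d hd using hfix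
    have hli : LinearIndepOn K id ((s.image b : Finset k) : Set k) :=
      (hb.linearIndepOn_id).mono (by intro x; simp; rintro a - rfl; exact ⟨a, rfl⟩)
    rw [linearIndepOn_finset_iff] at hli
    have := hli d (by
      rw [← hc]
      refine Finset.sum_congr rfl fun x _ => ?_
      rw [Algebra.smul_def, hd]; rfl)
    intro x hx
    ext
    rw [← hd, this x hx, map_zero]; rfl
  -- Artin's argument: vectors independent over the fixed field have conjugate families `(σ (b
  -- a))_σ` independent over `k`.
  have h2 := FixedPoints.linearIndependent_smul_of_linearIndependent (k ≃ₐ[K] k) k h1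
  rw [linearIndepOn_finset_iff] at h2
  have hinj := hb.injective
  intro a ha
  have : Nonempty ι := ⟨a⟩
  have := h2 (fun x => y (Function.invFun b x)) (by
    ext σ
    rw [Finset.sum_image (fun _ _ _ _ h => hinj h)]
    simp only [Finset.sum_apply, Pi.smul_apply, smul_eq_mul, Pi.zero_apply,
      Function.leftInverse_invFun hinj _]
    rw [← h σ]
    exact Finset.sum_congr rfl fun _ _ => mul_comm _ _) (b a) (Finset.mem_image_of_mem _ ha)
  rwa [Function.leftInverse_invFun hinj] at this

/-- A polynomial over an extension field is a combination of polynomials over the base field. -/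
theorem exists_sum_basis_mul_map {σ ι : Type*} (b : Module.Basis ι K k) (f : MvPolynomial σ k) :
    ∃ F : ι →₀ MvPolynomial σ K,
      f = F.sum fun a q => MvPolynomial.C (b a) * MvPolynomial.map (algebraMap K k) q := by
  classical
  induction f using MvPolynomial.induction_on with
  | C x =>
    refine ⟨(b.repr x).mapRange MvPolynomial.C (map_zero _), ?_⟩
    rw [Finsupp.sum_mapRange_index (by simp)]
    conv_lhs => rw [← b.linearCombination_repr x, Finsupp.linearCombination_apply, Finsupp.sum]
    simp only [map_sum, Finsupp.sum, MvPolynomial.map_C, ← MvPolynomial.C_mul, Algebra.smul_def,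
      mul_comm]
  | add f g hf hg =>
    obtain ⟨F, hF⟩ := hf
    obtain ⟨G, hG⟩ := hg
    refine ⟨F + G, ?_⟩
    rw [Finsupp.sum_add_index' (by simp) (by intros; simp [mul_add]), ← hF, ← hG]
  | mul_X f i hf =>
    obtain ⟨F, hF⟩ := hf
    refine ⟨F.mapRange (· * MvPolynomial.X i) (by simp), ?_⟩
    rw [Finsupp.sum_mapRange_index (by simp), hF, Finsupp.sum_mul]
    simp [mul_assoc]

variable {n : Type*} [Fintype n] [DecidableEq n]

omit [Fintype n] [DecidableEq n] in
theorem evalMatrix_map_left (F : MvPolynomial (n × n) K) (g : Matrix n n k) :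
    evalMatrix k g (MvPolynomial.map (algebraMap K k) F) = evalMatrix K g F := by
  simp [evalMatrix, MvPolynomial.aeval_map_algebraMap]

omit [Fintype n] [DecidableEq n] in
theorem evalMatrix_map_right {R S : Type*} [CommRing R] [CommRing S] [Algebra K R] [Algebra K S]
    (φ : R →ₐ[K] S) (F : MvPolynomial (n × n) K) (g : Matrix n n R) :
    evalMatrix K (g.map φ) F = φ (evalMatrix K g F) := by
  have : evalMatrix K (g.map φ) = φ.comp (evalMatrix K g) := by
    ext ij; simp [evalMatrix]
  rw [this]; rfl

omit [Fintype n] [DecidableEq n] in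
theorem evalMatrix_map_algebraMap (F : MvPolynomial (n × n) K) (g : Matrix n n K) :
    evalMatrix K (g.map (algebraMap K k)) F = algebraMap K k (evalMatrix K g F) :=
  evalMatrix_map_right (Algebra.ofId K k) F g

omit [DecidableEq n] in
theorem rightDeriv_map (X : Matrix n n K) (F : MvPolynomial (n × n) K) :
    rightDeriv (X.map (algebraMap K k)) (MvPolynomial.map (algebraMap K k) F) =
      MvPolynomial.map (algebraMap K k) (rightDeriv X F) := by
  induction F using MvPolynomial.induction_on with
  | C a => simp [rightDeriv]
  | add p q hp hq => simp [hp, hq]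
  | mul_X p i hp =>
    have : rightDeriv (X.map (algebraMap K k)) (MvPolynomial.X i) =
        MvPolynomial.map (algebraMap K k) (rightDeriv X (MvPolynomial.X i)) := by
      simp [rightDeriv]
    simp [hp, this]

/-- A matrix group over `k` is closed over `K` when it is cut out by equations over `K`. -/
def IsClosedOver (K : Type*) [Field K] [Algebra K k] (Γ : Subgroup (Matrix n n k)ˣ) : Prop :=
  ∀ g : (Matrix n n k)ˣ, (∀ F : MvPolynomial (n × n) K,
    (∀ h ∈ Γ, evalMatrix K (h : Matrix n n k) F = 0) → evalMatrix K (g : Matrix n n k) F = 0) →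
    g ∈ Γ

variable {Γ : Subgroup (Matrix n n k)ˣ}

/-- A Galois conjugate of a point of `Γ` satisfies the same equations over `K`, so it lies in `Γ`.
Evaluating at all conjugates of one point separates the components `F a`. Thus polynomials over `K`
span the ideal. -/
theorem map_mem_groupIdeal_of_sum_mem [IsGalois K k] (hΓ : IsClosedOver K Γ) {ι : Type*}
    (b : Module.Basis ι K k) (F : ι →₀ MvPolynomial (n × n) K)
    (hF : (F.sum fun a q => MvPolynomial.C (b a) * MvPolynomial.map (algebraMap K k) q) ∈
      groupIdeal Γ) (a : ι) : MvPolynomial.map (algebraMap K k) (F a) ∈ groupIdeal Γ := by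
  classical
  by_cases ha : a ∈ F.support
  swap
  · rw [Finsupp.notMem_support_iff.1 ha, map_zero]; exact Ideal.zero_mem _
  rw [mem_groupIdeal]
  intro g hg
  rw [evalMatrix_map_left]
  refine eq_zero_of_sum_galois_eq_zero b.linearIndependent F.support
    (fun a => evalMatrix K (g : Matrix n n k) (F a)) (fun σ => ?_) a ha
  let gσ : (Matrix n n k)ˣ := Units.map (σ.symm.toAlgHom.mapMatrix : Matrix n n k →ₐ[K] Matrix n n k) g
  have hgσ : (gσ : Matrix n n k) = (g : Matrix n n k).map σ.symm.toAlgHom := rfl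
  have hmem : gσ ∈ Γ := hΓ _ fun G hG => by
    rw [hgσ, evalMatrix_map_right, hG g hg, map_zero]
  have h1 := mem_groupIdeal.1 hF gσ hmem
  rw [Finsupp.sum, map_sum] at h1
  have h2 := congrArg σ h1
  rw [map_zero, map_sum] at h2
  rw [← h2]
  refine Finset.sum_congr rfl fun a _ => ?_
  rw [map_mul, map_mul, evalMatrix_map_left, hgσ, evalMatrix_map_right]
  simp [evalMatrix]

/-- The Lie algebra of a matrix group that is closed over `K` is spanned by matrices over `K`. -/
theorem groupLie_le_span [IsGalois K k] (hΓ : IsClosedOver K Γ) :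
    groupLie Γ ≤ Submodule.span k
      ((fun Y : Matrix n n K => Y.map (algebraMap K k)) ''
        {Y | Y.map (algebraMap K k) ∈ groupLie Γ}) := by
  classical
  intro X hX
  let b := Module.Basis.ofVectorSpace K k
  let s := Finset.univ.biUnion fun ij : n × n => (b.repr (X ij.1 ij.2)).support
  let Y : Module.Basis.ofVectorSpaceIndex K k → Matrix n n K :=
    fun a => Matrix.of fun i j => b.repr (X i j) a
  have hXY : X = ∑ a ∈ s, b a • (Y a).map (algebraMap K k) := by
    ext i j
    conv_lhs => rw [← b.linearCombination_repr (X i j), Finsupp.linearCombination_apply]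
    rw [Finsupp.sum_of_support_subset (s := s) _
      (Finset.subset_biUnion_of_mem (fun ij : n × n => (b.repr (X ij.1 ij.2)).support)
        (Finset.mem_univ (i, j))) _ (by simp)]
    rw [Matrix.sum_apply]
    refine Finset.sum_congr rfl fun a _ => ?_
    rw [Algebra.smul_def, mul_comm]
    rfl
  -- For `F` over `K`, the derivative of `F` along `X` at 1 is a `K`-combination of the independent
  -- elements `b a`, so each component `Y a` kills `F` separately. Such `F` span the ideal, which
  -- puts `Y a` in the Lie algebra.
  have hK : ∀ a ∈ s, ∀ F : MvPolynomial (n × n) K, MvPolynomial.map (algebraMap K k) F ∈ groupIdeal Γ →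
      evalMatrix K (1 : Matrix n n K) (rightDeriv (Y a) F) = 0 := by
    intro a ha F hF
    have h1 := hX _ hF
    have h2 : rightDeriv X (MvPolynomial.map (algebraMap K k) F) =
        ∑ a ∈ s, b a • MvPolynomial.map (algebraMap K k) (rightDeriv (Y a) F) := by
      let ψ : Matrix n n k →ₗ[k] MvPolynomial (n × n) k :=
        { toFun := fun Z => rightDeriv Z (MvPolynomial.map (algebraMap K k) F)
          map_add' := fun _ _ => rightDeriv_add _ _ _
          map_smul' := fun _ _ => rightDeriv_smul _ _ _ }
      change ψ X = _
      conv_lhs => rw [hXY, map_sum]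
      refine Finset.sum_congr rfl fun a _ => ?_
      rw [map_smul]
      congr 1
      exact rightDeriv_map _ _
    rw [h2, map_sum] at h1
    have h3 : ∑ a ∈ s, evalMatrix K (1 : Matrix n n K) (rightDeriv (Y a) F) • b a = 0 := by
      rw [← h1]
      refine Finset.sum_congr rfl fun a _ => ?_
      rw [map_smul, evalMatrix_map_left, ← Matrix.map_one (algebraMap K k) (map_zero _) (map_one _),
        evalMatrix_map_algebraMap, Algebra.smul_def, smul_eq_mul, mul_comm]
    exact linearIndependent_iff'.1 b.linearIndependent s _ h3 a ha
  rw [hXY]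
  refine Submodule.sum_mem _ fun a ha => Submodule.smul_mem _ _ (Submodule.subset_span ⟨Y a, ?_, rfl⟩)
  intro f hf
  obtain ⟨F, rfl⟩ := exists_sum_basis_mul_map b f
  have hF := map_mem_groupIdeal_of_sum_mem hΓ b F hf
  rw [Finsupp.sum, map_sum, map_sum]
  refine Finset.sum_eq_zero fun c _ => ?_
  rw [← MvPolynomial.smul_eq_C_mul, Derivation.map_smul, map_smul, rightDeriv_map, evalMatrix_map_left,
    ← Matrix.map_one (algebraMap K k) (map_zero _) (map_one _), evalMatrix_map_algebraMap,
    hK a ha _ (hF c), map_zero, smul_zero]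

end Descent

/-! ### One-parameter subgroups over a complete field. -/

section Exponential

variable {K : Type*} [NontriviallyNormedField K] [CompleteSpace K] {n : Type*} [Fintype n]
  {E : Type*} [NormedRing E] [NormedAlgebra K E] [FiniteDimensional K E]

/-- An entry of a matrix, as a continuous linear form. -/
def entryCLM [DecidableEq n] (e : E ≃ₐ[K] Matrix n n K) (i j : n) : E →L[K] K :=
  LinearMap.toContinuousLinearMap (Matrix.entryLinearMap K K i j ∘ₗ e.toLinearMap)

variable [DecidableEq n] (e : E ≃ₐ[K] Matrix n n K)

/-- The chain rule for a polynomial in the entries of a matrix, along a curve of matrices. -/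
theorem hasDerivAt_evalMatrix {c : K → E} {W : E} {s : K}
    (hc : HasDerivAt c W s)
    (D : Derivation K (MvPolynomial (n × n) K) (MvPolynomial (n × n) K))
    (hD : ∀ ij, evalMatrix K (e (c s)) (D (MvPolynomial.X ij)) = e W ij.1 ij.2)
    (f : MvPolynomial (n × n) K) :
    HasDerivAt (fun t => evalMatrix K (e (c t)) f) (evalMatrix K (e (c s)) (D f)) s := by
  induction f using MvPolynomial.induction_on with
  | C a => simpa [evalMatrix, ← MvPolynomial.algebraMap_eq] using hasDerivAt_const s a
  | add p q hp hq =>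
    simp only [map_add]
    exact hp.add hq
  | mul_X p i hp =>
    have h1 : HasDerivAt (fun t => evalMatrix K (e (c t)) (MvPolynomial.X i)) (e W i.1 i.2) s := by
      simp only [evalMatrix, MvPolynomial.aeval_X]
      exact (entryCLM e i.1 i.2).hasFDerivAt.comp_hasDerivAt s hc
    have := hp.mul h1
    rw [← hD] at this
    simp only [Derivation.leibniz, map_add, smul_eq_mul, map_mul]
    rw [add_comm, mul_comm (evalMatrix K (e (c s)) (MvPolynomial.X i))]
    exact this

variable [CharZero K] [CompleteSpace E]

theorem analyticAt_exp_entry (hr : 0 < (NormedSpace.expSeries K E).radius)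
    (X : E) (i j : n) : AnalyticAt K (fun s : K => e (NormedSpace.exp (s • X)) i j) 0 := by
  have h1 : AnalyticAt K (fun s : K => s • X) 0 := analyticAt_id.smul analyticAt_const
  have h2 : AnalyticAt K (NormedSpace.exp : E → E) ((0 : K) • X) :=
    NormedSpace.analyticAt_exp_of_mem_ball _ (by simpa using hr)
  have h3 := h2.comp_of_eq (f := fun s : K => s • X) h1 rfl
  exact ((entryCLM e i j).analyticAt _).comp h3

theorem analyticAt_evalMatrix_exp (hr : 0 < (NormedSpace.expSeries K E).radius)
    (X : E) (F : MvPolynomial (n × n) K) :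
    AnalyticAt K (fun s : K => evalMatrix K (e (NormedSpace.exp (s • X))) F) 0 := by
  induction F using MvPolynomial.induction_on with
  | C a =>
    simp only [← MvPolynomial.algebraMap_eq, AlgHom.commutes]
    exact analyticAt_const
  | add p q hp hq =>
    simp only [map_add]
    exact hp.add hq
  | mul_X p i hp =>
    simp only [map_mul]
    refine hp.mul ?_
    simp only [evalMatrix, MvPolynomial.aeval_X]
    exact analyticAt_exp_entry e hr X i.1 i.2

omit [CompleteSpace K] [FiniteDimensional K E] [CharZero K] [CompleteSpace E] in
theorem eventually_smul_mem_eball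
    (hr : 0 < (NormedSpace.expSeries K E).radius) (X : E) :
    ∀ᶠ s : K in 𝓝 0, s • X ∈ Metric.eball (0 : E) (NormedSpace.expSeries K E).radius := by
  have : Filter.Tendsto (fun s : K => s • X) (𝓝 0) (𝓝 0) := by
    have : Continuous fun s : K => s • X := by fun_prop
    simpa using this.tendsto 0
  exact this.eventually (Metric.eball_mem_nhds _ hr)

omit [CompleteSpace E] [FiniteDimensional K E] [NormedAlgebra K E] [NormedRing E] [Fintype n]
  [DecidableEq n] in
/-- A family of analytic functions vanishing at a point and closed under derivation vanishes. -/
theorem eventually_eq_zero_of_deriv_family {ι : Type*} {h : ι → K → K} {D : ι → ι} {x : K}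
    (han : ∀ i, AnalyticAt K (h i) x) (hD : ∀ i, deriv (h i) =ᶠ[𝓝 x] h (D i))
    (h0 : ∀ i, h i x = 0) (i : ι) : ∀ᶠ s in 𝓝 x, h i s = 0 := by
  -- The order of vanishing of `h i` is one more than that of its derivative `h (D i)`, so by
  -- induction, for all `i` at once, it exceeds every integer.
  have hord : ∀ m : ℕ, ∀ i, (m : ℕ∞) ≤ analyticOrderAt (h i) x := by
    intro m
    induction m with
    | zero => simp
    | succ m ih =>
      intro i
      have := (han i).analyticOrderAt_deriv_add_one
      simp only [h0, sub_zero] at this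
      rw [← this, analyticOrderAt_congr (hD i)]
      push_cast
      gcongr
      exact ih _
  rw [← analyticOrderAt_eq_top]
  exact ENat.eq_top_iff_forall_ge.2 fun m => hord m i

/-- A polynomial all of whose derivatives in the direction `X` vanish at `1` vanishes on the
one-parameter group of `X`. -/
theorem eventually_evalMatrix_exp_eq_zero
    (hr : 0 < (NormedSpace.expSeries K E).radius) {X : E}
    {I : Ideal (MvPolynomial (n × n) K)} (hI : ∀ F ∈ I, rightDeriv (e X) F ∈ I)
    (hI1 : ∀ F ∈ I, evalMatrix K (1 : Matrix n n K) F = 0) {F : MvPolynomial (n × n) K}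
    (hF : F ∈ I) : ∀ᶠ s : K in 𝓝 0, evalMatrix K (e (NormedSpace.exp (s • X))) F = 0 := by
  refine eventually_eq_zero_of_deriv_family (ι := I)
    (h := fun F s => evalMatrix K (e (NormedSpace.exp (s • X))) F)
    (D := fun F => ⟨rightDeriv (e X) F, hI F F.2⟩) (fun F => ?_) (fun F => ?_) (fun F => ?_) ⟨F, hF⟩
  · exact analyticAt_evalMatrix_exp e hr X _
  · filter_upwards [eventually_smul_mem_eball hr X] with s hs
    exact HasDerivAt.deriv (hasDerivAt_evalMatrix e
      (hasDerivAt_exp_smul_const_of_mem_ball X s hs) (rightDeriv (e X))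
      (fun ij => by rw [evalMatrix_rightDeriv_X, ← map_mul]) _)
  · simp only [zero_smul, NormedSpace.exp_zero, map_one]
    exact hI1 F F.2

/-- One-parameter subgroups in the direction of the Lie algebra stay in the group. -/
theorem eventually_exp_smul_mem {k : Type*} [Field k] [Algebra K k]
    (hr : 0 < (NormedSpace.expSeries K E).radius)
    {Γ : Subgroup (Matrix n n k)ˣ} (hΓ : IsClosedOver K Γ) {X : E}
    (hX : (e X).map (algebraMap K k) ∈ groupLie Γ) :
    ∀ᶠ s : K in 𝓝 0, (e (NormedSpace.exp (s • X))).map (algebraMap K k) ∈ matricesOf Γ := by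
  have hball := eventually_smul_mem_eball hr X
  let I : Ideal (MvPolynomial (n × n) K) := (groupIdeal Γ).comap (MvPolynomial.map (algebraMap K k))
  have hI : ∀ F ∈ I, rightDeriv (e X) F ∈ I := fun F hF => by
    rw [Ideal.mem_comap, ← rightDeriv_map]
    exact rightDeriv_mem_groupIdeal hX hF
  have hI1 : ∀ F ∈ I, evalMatrix K (1 : Matrix n n K) F = 0 := fun F hF => by
    have := mem_groupIdeal.1 hF 1 (one_mem _)
    rw [evalMatrix_map_left, Units.val_one, ← Matrix.map_one (algebraMap K k) (map_zero _) (map_one _),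
      evalMatrix_map_algebraMap] at this
    simpa using this
  -- The range of `s` on which `F` vanishes depends on `F`; finitely many generators of the ideal
  -- give a common one.
  obtain ⟨S, hS⟩ := (isNoetherianRing_iff_ideal_fg _).1
    (inferInstance : IsNoetherianRing (MvPolynomial (n × n) K)) I
  have hall : ∀ᶠ s in 𝓝 (0 : K), ∀ F ∈ S, evalMatrix K (e (NormedSpace.exp (s • X))) F = 0 :=
    (Finset.eventually_all S).2 fun F hF =>
      eventually_evalMatrix_exp_eq_zero e hr hI hI1 (hS ▸ Ideal.subset_span hF)
  filter_upwards [hall, hball] with s hs hsb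
  have hu := NormedSpace.isUnit_exp_of_mem_ball hsb
  have hu' : IsUnit ((e (NormedSpace.exp (s • X))).map (algebraMap K k)) := by
    exact (hu.map e).map (algebraMap K k).mapMatrix
  refine ⟨hu'.unit, hΓ _ fun F hF => ?_, rfl⟩
  have hFI : F ∈ I := mem_groupIdeal.2 fun g hg => by rw [evalMatrix_map_left]; exact hF g hg
  rw [IsUnit.unit_spec, evalMatrix_map_algebraMap]
  have : I ≤ RingHom.ker (evalMatrix K (e (NormedSpace.exp (s • X)))) := by
    rw [← hS, Ideal.span_le]
    exact hs
  rw [show evalMatrix K (e (NormedSpace.exp (s • X))) F = 0 from this hFI, map_zero]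

end Exponential

/-! ### Convergence of the `p`-adic exponential near zero. -/

section Radius

/-- Legendre's formula gives `(p - 1) * v_p(m!) ≤ m`. Dropping the factor `p - 1` is harmless, as
only positivity of the radius is needed. -/
theorem Padic.norm_inv_factorial_le (p : ℕ) [Fact p.Prime] (m : ℕ) :
    ‖((m.factorial : ℚ_[p])⁻¹)‖ ≤ (p : ℝ) ^ m := by
  have hp : 1 < (p : ℝ) := by exact_mod_cast (Fact.out : p.Prime).one_lt
  have hm : (m.factorial : ℚ_[p]) ≠ 0 := by exact_mod_cast m.factorial_ne_zero
  rw [norm_inv, Padic.norm_eq_zpow_neg_valuation hm, ← zpow_neg, neg_neg, Padic.valuation_natCast,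
    zpow_natCast]
  refine pow_le_pow_right₀ hp.le ?_
  have h := sub_one_mul_padicValNat_factorial (p := p) m
  have h1 : 1 ≤ p - 1 := by have := (Fact.out : p.Prime).two_le; omega
  calc _ ≤ (p - 1) * padicValNat p m.factorial := Nat.le_mul_of_pos_left _ h1
    _ ≤ m := h ▸ Nat.sub_le _ _

/-- The `p`-adic exponential series has a positive radius of convergence. -/
theorem Padic.expSeries_radius_pos (p : ℕ) [Fact p.Prime] (E : Type*) [NormedRing E]
    [NormedAlgebra ℚ_[p] E] : 0 < (NormedSpace.expSeries ℚ_[p] E).radius := by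
  have hp : 0 < (p : ℝ) := by exact_mod_cast (Fact.out : p.Prime).pos
  let r : NNReal := ⟨(p : ℝ)⁻¹, by positivity⟩
  have hr : 0 < r := by change 0 < (p : ℝ)⁻¹; positivity
  refine lt_of_lt_of_le (ENNReal.coe_pos.2 hr)
    (FormalMultilinearSeries.le_radius_of_bound _ (max 1 ‖(1 : E)‖) fun m => ?_)
  have h1 : ‖NormedSpace.expSeries ℚ_[p] E m‖ ≤ (p : ℝ) ^ m * max 1 ‖(1 : E)‖ := by
    refine ContinuousMultilinearMap.opNorm_le_bound (by positivity) fun x => ?_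
    have h2 : ‖(List.ofFn x).prod‖ ≤ max 1 ‖(1 : E)‖ * ∏ i, ‖x i‖ := by
      have h3 := (ContinuousMultilinearMap.mkPiAlgebraFin ℚ_[p] m E).le_opNorm x
      rw [ContinuousMultilinearMap.mkPiAlgebraFin_apply] at h3
      refine h3.trans (mul_le_mul_of_nonneg_right ?_ (by positivity))
      -- In degree zero the empty product is `1`, whose norm is not assumed to be 1; this is why the
      -- bound contains `max 1 ‖1‖`.
      cases m with
      | zero => exact (ContinuousMultilinearMap.norm_mkPiAlgebraFin_zero).le.trans (le_max_right _ _)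
      | succ m =>
        exact (ContinuousMultilinearMap.norm_mkPiAlgebraFin_succ_le).trans (le_max_left _ _)
    change ‖((m.factorial : ℚ_[p])⁻¹) • (List.ofFn x).prod‖ ≤ _
    rw [norm_smul, mul_assoc]
    exact mul_le_mul (Padic.norm_inv_factorial_le p m) h2 (norm_nonneg _) (by positivity)
  calc _ ≤ (p : ℝ) ^ m * max 1 ‖(1 : E)‖ * ((p : ℝ)⁻¹) ^ m := by
        change _ * (p : ℝ)⁻¹ ^ m ≤ _
        gcongr
    _ = _ := by
        rw [mul_right_comm, ← mul_pow, mul_inv_cancel₀ hp.ne', one_pow, one_mul]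

end Radius

/-! ### Semicontinuity of centralizers. -/

section Semicontinuity

/-- If the centralizer of `x` is commutative, then the elements of the centralizer that are close
to `x` have the same centralizer as `x`. -/
theorem eventually_commute_of_commute (K : Type*) [NontriviallyNormedField K] [CompleteSpace K]
    {E : Type*} [NormedRing E] [NormedAlgebra K E] [FiniteDimensional K E] {x : E}
    (hx : ∀ a b : E, Commute a x → Commute b x → Commute a b) :
    ∀ᶠ y in 𝓝 x, Commute y x → ∀ a, Commute a y → Commute a x := by
  let L : E →L[K] E →L[K] E := ContinuousLinearMap.mul K E - (ContinuousLinearMap.mul K E).flip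
  have hL : ∀ y a, a ∈ LinearMap.ker (L y : E →ₗ[K] E) ↔ Commute a y := fun y a => by
    simp [L, sub_eq_zero, Commute, SemiconjBy, eq_comm]
  -- The kernel of `L y` is the centralizer of `y`. The rank of `L y` cannot drop near `x`, so the
  -- centralizer does not grow in dimension; it contains the commutative centralizer of `x`, to
  -- which `y` belongs, and the two coincide.
  have hopen := (isOpen_setOfPred_nat_le_rank (𝕜 := K) (E := E) (F := E)
    (Module.finrank K (LinearMap.range (L x : E →ₗ[K] E)))).preimage L.continuous
  have hmem : x ∈ L ⁻¹' {f | (Module.finrank K (LinearMap.range (L x : E →ₗ[K] E)) : Cardinal) ≤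
      LinearMap.rank (f : E →ₗ[K] E)} := by
    simp [LinearMap.rank]
  filter_upwards [hopen.mem_nhds hmem] with y hy hyx a ha
  have h1 : Module.finrank K (LinearMap.range (L x : E →ₗ[K] E)) ≤
      Module.finrank K (LinearMap.range (L y : E →ₗ[K] E)) := by
    have : (Module.finrank K (LinearMap.range (L x : E →ₗ[K] E)) : Cardinal) ≤
      LinearMap.rank (L y : E →ₗ[K] E) := hy
    rw [LinearMap.rank, ← Module.finrank_eq_rank] at this
    exact_mod_cast this
  have h2 := LinearMap.finrank_range_add_finrank_ker (L x : E →ₗ[K] E)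
  have h3 := LinearMap.finrank_range_add_finrank_ker (L y : E →ₗ[K] E)
  have h4 : LinearMap.ker (L x : E →ₗ[K] E) ≤ LinearMap.ker (L y : E →ₗ[K] E) := fun b hb => by
    rw [hL] at hb ⊢
    exact hx b y hb hyx
  have h5 := Submodule.eq_of_le_of_finrank_le h4 (by omega)
  rw [← hL] at ha ⊢
  rwa [h5]

end Semicontinuity

/-! ### Diagonalization of regular matrices. -/

section Diagonalization

variable {n : Type*} [Fintype n] [DecidableEq n] {k : Type*} [Field k]

/-- A matrix with separable characteristic polynomial over an algebraically closed field is
conjugate to a diagonal matrix with distinct entries. -/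
theorem Matrix.exists_conj_eq_diagonal [IsAlgClosed k] (A : Matrix n n k)
    (hA : A.charpoly.Separable) :
    ∃ (Q : (Matrix n n k)ˣ) (d : n → k), Function.Injective d ∧
      (↑Q⁻¹ : Matrix n n k) * A * Q = Matrix.diagonal d := by
  classical
  have hnodup := Polynomial.nodup_roots hA
  have hcard : A.charpoly.roots.toFinset.card = Fintype.card n := by
    rw [Multiset.toFinset_card_of_nodup hnodup,
      Polynomial.splits_iff_card_roots.1 (IsAlgClosed.splits _), Matrix.charpoly_natDegree_eq_dim]
  have ε : n ≃ A.charpoly.roots.toFinset := Fintype.equivOfCardEq (by simp [hcard])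
  let d : n → k := fun i => ε i
  have hd : Function.Injective d := Subtype.val_injective.comp ε.injective
  have hev : ∀ i, Module.End.HasEigenvalue (Matrix.toLin' A) (d i) := fun i => by
    rw [Module.End.hasEigenvalue_iff_isRoot_charpoly, Matrix.charpoly_toLin']
    exact Polynomial.isRoot_of_mem_roots (Multiset.mem_toFinset.1 (ε i).2)
  choose v hv using fun i => (hev i).exists_hasEigenvector
  have hli := Module.End.eigenvectors_linearIndependent' (Matrix.toLin' A) d hd v hv
  let Q0 : Matrix n n k := Matrix.of fun i j => v j i
  have hQ : IsUnit Q0 := by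
    rw [← Matrix.linearIndependent_cols_iff_isUnit]
    exact hli
  refine ⟨hQ.unit, d, hd, ?_⟩
  rw [Matrix.mul_assoc, Units.inv_mul_eq_iff_eq_mul, IsUnit.unit_spec]
  ext i j
  have := congrFun ((hv j).apply_eq_smul) i
  rw [Matrix.mul_diagonal, Matrix.mul_apply]
  simpa [Matrix.toLin'_apply, Matrix.mulVec, dotProduct, mul_comm, Q0] using this

theorem Matrix.apply_eq_zero_of_commute_diagonal {d : n → k} (hd : Function.Injective d)
    {M : Matrix n n k} (hM : Commute M (Matrix.diagonal d)) {i j : n} (hij : i ≠ j) : M i j = 0 := by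
  have h := congrFun (congrFun hM.eq i) j
  rw [Matrix.mul_diagonal, Matrix.diagonal_mul] at h
  have h1 : (d i - d j) * M i j = 0 := by linear_combination -h
  exact (mul_eq_zero.1 h1).resolve_left (sub_ne_zero.2 (hd.ne hij))

end Diagonalization

/-! ### The adjoint action, degree bounds and the eigenvalue-ratio polynomial. -/

section Conjugation

variable {n : Type*} [Fintype n] [DecidableEq n] {k : Type*} [Field k]

/-- The polynomial `x ↦ f (g * x * h)`. -/
def biTranslate (g h : Matrix n n k) : MvPolynomial (n × n) k →ₐ[k] MvPolynomial (n × n) k :=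
  MvPolynomial.aeval fun ij => ∑ l, ∑ m,
    MvPolynomial.C (g ij.1 l * h m ij.2) * MvPolynomial.X (l, m)

omit [DecidableEq n] in
theorem evalMatrix_biTranslate (g h x : Matrix n n k) (f : MvPolynomial (n × n) k) :
    evalMatrix k x (biTranslate g h f) = evalMatrix k (g * x * h) f := by
  have : (evalMatrix k x).comp (biTranslate g h) = evalMatrix k (g * x * h) := by
    ext ij
    simp only [evalMatrix, biTranslate, AlgHom.comp_apply, MvPolynomial.aeval_X, map_sum, map_mul,
      MvPolynomial.aeval_C, Matrix.mul_apply, Finset.sum_mul, Algebra.algebraMap_self_apply]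
    rw [Finset.sum_comm]
    exact Finset.sum_congr rfl fun _ _ => Finset.sum_congr rfl fun _ _ => by ring
  exact DFunLike.congr_fun this f

/-- The substitution `x ↦ g⁻¹ * x * g` preserves the ideal, and its differential at 1 is conjugation
of tangent vectors. -/
theorem conj_mem_groupLie {Γ : Subgroup (Matrix n n k)ˣ} {X : Matrix n n k}
    (hX : X ∈ groupLie Γ) {g : (Matrix n n k)ˣ} (hg : g ∈ Γ) :
    (↑g⁻¹ : Matrix n n k) * X * g ∈ groupLie Γ := by
  intro f hf
  have h1 : biTranslate (↑g⁻¹ : Matrix n n k) g f ∈ groupIdeal Γ := by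
    rw [mem_groupIdeal]
    intro h hh
    rw [evalMatrix_biTranslate, ← Units.val_mul, ← Units.val_mul]
    exact mem_groupIdeal.1 hf _ (mul_mem (mul_mem (inv_mem hg) hh) hg)
  have h2 : ∀ f : MvPolynomial (n × n) k,
      evalMatrix k (1 : Matrix n n k) (rightDeriv X (biTranslate (↑g⁻¹ : Matrix n n k) g f)) =
      evalMatrix k (1 : Matrix n n k)
        (rightDeriv ((↑g⁻¹ : Matrix n n k) * X * (g : Matrix n n k)) f) := by
    intro f
    induction f using MvPolynomial.induction_on with
    | C a => simp [← MvPolynomial.algebraMap_eq]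
    | add p q hp hq => simp only [map_add, hp, hq]
    | mul_X p i hp =>
      have e1 : evalMatrix k (1 : Matrix n n k) (rightDeriv X (biTranslate (↑g⁻¹ : Matrix n n k) g
          (MvPolynomial.X i))) = evalMatrix k (1 : Matrix n n k)
            (rightDeriv ((↑g⁻¹ : Matrix n n k) * X * (g : Matrix n n k)) (MvPolynomial.X i)) := by
        rw [evalMatrix_rightDeriv_X, one_mul]
        have : ∀ l m, evalMatrix k (1 : Matrix n n k) (rightDeriv X (MvPolynomial.X (l, m))) = X l m := by
          intro l m
          rw [evalMatrix_rightDeriv_X, one_mul]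
        simp only [biTranslate, MvPolynomial.aeval_X, map_sum, ← MvPolynomial.smul_eq_C_mul,
          Derivation.map_smul, map_smul, this, Matrix.mul_apply, Finset.sum_mul, smul_eq_mul]
        rw [Finset.sum_comm]
        exact Finset.sum_congr rfl fun _ _ => Finset.sum_congr rfl fun _ _ => by ring
      simp only [map_mul, Derivation.leibniz, map_add, smul_eq_mul, hp, e1, evalMatrix_biTranslate,
        mul_one, Units.inv_mul]
  rw [← h2]
  exact hX _ h1

omit [DecidableEq n] in
-- Each variable is sent to a linear form. Hence bounding the degree yields finite-dimensional
-- spaces stable under the Lie algebra, as `le_groupIdeal_of_rightDeriv_stable` requires.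
theorem totalDegree_rightDeriv_le (X : Matrix n n k) (f : MvPolynomial (n × n) k) :
    (rightDeriv X f).totalDegree ≤ f.totalDegree := by
  classical
  conv_lhs => rw [f.as_sum, map_sum]
  refine MvPolynomial.totalDegree_finsetSum_le fun s hs => ?_
  refine le_trans ?_ (MvPolynomial.le_totalDegree hs)
  rw [rightDeriv, MvPolynomial.mkDerivation_monomial, Finsupp.sum]
  refine (MvPolynomial.totalDegree_smul_le _ _).trans ?_
  refine MvPolynomial.totalDegree_finsetSum_le fun i hi => ?_
  rw [smul_eq_mul]
  refine (MvPolynomial.totalDegree_mul _ _).trans ?_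
  have h1 : (∑ l, MvPolynomial.C (X l i.2) * MvPolynomial.X (i.1, l) :
      MvPolynomial (n × n) k).totalDegree ≤ 1 := by
    refine MvPolynomial.totalDegree_finsetSum_le fun l _ => ?_
    refine (MvPolynomial.totalDegree_mul _ _).trans ?_
    simp
  have h2 := MvPolynomial.totalDegree_monomial_le (s - Finsupp.single i 1) (s i : k)
  have h3 : (s - Finsupp.single i 1).degree + 1 = s.degree := by
    have hle : Finsupp.single i 1 ≤ s := by
      rw [Finsupp.single_le_iff]
      exact Nat.one_le_iff_ne_zero.2 (Finsupp.mem_support_iff.1 hi)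
    conv_rhs => rw [← tsub_add_cancel_of_le hle, map_add, Finsupp.degree_single]
  have h4 : (s.sum fun _ e => e) = s.degree := rfl
  have h5 : ((s - Finsupp.single i 1).sum fun _ => id) = (s - Finsupp.single i 1).degree := rfl
  rw [h4, ← h3]
  rw [h5] at h2
  omega

/-- The polynomial whose vanishing at `g` says that `g` has eigenvalues `a`, `b` with `a = ζ b`. -/
def eigenvalueRatioPoly (n : Type*) [Fintype n] [DecidableEq n] (ζ : k) : MvPolynomial (n × n) k :=
  (Matrix.mvPolynomialX n n k ⊗ₖ (1 : Matrix n n (MvPolynomial (n × n) k)) -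
    (MvPolynomial.C ζ : MvPolynomial (n × n) k) • ((1 : Matrix n n (MvPolynomial (n × n) k)) ⊗ₖ
      (Matrix.mvPolynomialX n n k).transpose)).det

theorem evalMatrix_eigenvalueRatioPoly (ζ : k) (g : Matrix n n k) :
    evalMatrix k g (eigenvalueRatioPoly n ζ) =
      (g ⊗ₖ (1 : Matrix n n k) - ζ • ((1 : Matrix n n k) ⊗ₖ g.transpose)).det := by
  rw [eigenvalueRatioPoly, AlgHom.map_det]
  congr 1
  ext ⟨i, j⟩ ⟨i', j'⟩
  simp [evalMatrix, Matrix.kroneckerMap_apply, Matrix.one_apply, Matrix.mvPolynomialX]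
  split_ifs <;> simp

theorem evalMatrix_eigenvalueRatioPoly_one {ζ : k} (hζ : ζ ≠ 1) :
    evalMatrix k (1 : Matrix n n k) (eigenvalueRatioPoly n ζ) ≠ 0 := by
  rw [evalMatrix_eigenvalueRatioPoly, Matrix.transpose_one, Matrix.one_kronecker_one]
  have : (1 : Matrix (n × n) (n × n) k) - ζ • 1 = (1 - ζ) • 1 := by rw [sub_smul, one_smul]
  rw [this, Matrix.det_smul, Matrix.det_one, mul_one]
  exact pow_ne_zero _ (sub_ne_zero.2 hζ.symm)

/-- The matrix unit `Z = Q * E_ij * Q⁻¹` satisfies `g * Z = d i • Z` and `Z * g = d j • Z`, so it is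
a nonzero solution of `g * Z = ζ • (Z * g)`. The Kronecker determinant is that of this linear
system. -/
theorem evalMatrix_eigenvalueRatioPoly_eq_zero {ζ : k} {g : Matrix n n k} {Q : (Matrix n n k)ˣ}
    {d : n → k} (h : (↑Q⁻¹ : Matrix n n k) * g * Q = Matrix.diagonal d) {i j : n}
    (hij : d i = ζ * d j) : evalMatrix k g (eigenvalueRatioPoly n ζ) = 0 := by
  rw [evalMatrix_eigenvalueRatioPoly]
  have h1 : g * Q = Q * Matrix.diagonal d := by
    rw [← h, ← Matrix.mul_assoc, ← Matrix.mul_assoc, Units.mul_inv, Matrix.one_mul]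
  have h2 : (↑Q⁻¹ : Matrix n n k) * g = Matrix.diagonal d * (↑Q⁻¹ : Matrix n n k) := by
    rw [← h, Matrix.mul_assoc, Units.mul_inv, Matrix.mul_one]
  let Z : Matrix n n k := (Q : Matrix n n k) * Matrix.single i j 1 * (↑Q⁻¹ : Matrix n n k)
  have e1 : g * Z = d i • Z := by
    have : Matrix.diagonal d * Matrix.single i j 1 = d i • Matrix.single i j (1 : k) := by
      ext a b
      simp only [Matrix.diagonal_mul, Matrix.single_apply, Matrix.smul_apply, smul_eq_mul]
      split_ifs with h
      · rw [h.1]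
      · simp
    rw [← Matrix.mul_assoc, ← Matrix.mul_assoc, h1, Matrix.mul_assoc (Q : Matrix n n k), this,
      Matrix.mul_smul, Matrix.smul_mul]
  have e2 : Z * g = d j • Z := by
    have : Matrix.single i j 1 * Matrix.diagonal d = d j • Matrix.single i j (1 : k) := by
      ext a b
      simp only [Matrix.mul_diagonal, Matrix.single_apply, Matrix.smul_apply, smul_eq_mul]
      split_ifs with h
      · rw [h.2, one_mul, mul_one]
      · simp
    rw [Matrix.mul_assoc, h2, ← Matrix.mul_assoc, Matrix.mul_assoc (Q : Matrix n n k), this,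
      Matrix.mul_smul, Matrix.smul_mul]
  have hZ : Z ≠ 0 := by
    intro hZ
    have : (↑Q⁻¹ : Matrix n n k) * Z * (Q : Matrix n n k) = Matrix.single i j 1 := by
      simp only [Z, ← Matrix.mul_assoc, Units.inv_mul, Matrix.one_mul]
      rw [Matrix.mul_assoc, Units.inv_mul, Matrix.mul_one]
    rw [hZ, Matrix.mul_zero, Matrix.zero_mul] at this
    have := congrFun (congrFun this i) j
    simp at this
  rw [← Matrix.exists_mulVec_eq_zero_iff]
  refine ⟨Matrix.vec Z.transpose, by simpa using hZ, ?_⟩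
  rw [Matrix.sub_mulVec, Matrix.smul_mulVec, Matrix.kronecker_mulVec_vec,
    Matrix.kronecker_mulVec_vec, Matrix.one_mul, Matrix.transpose_one, Matrix.mul_one,
    ← Matrix.transpose_mul, ← Matrix.transpose_mul, e1, e2, hij]
  ext x
  simp [Matrix.vec, mul_assoc]

end Conjugation

/-! ### Centralizers in diagonal coordinates. -/

section RegularElements

variable {K : Type*} [NontriviallyNormedField K] [CompleteSpace K] {n : Type*} [Fintype n]
  [DecidableEq n] {E : Type*} [NormedRing E] [NormedAlgebra K E] [FiniteDimensional K E]
  [CharZero K] [CompleteSpace E]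
  {k : Type*} [Field k] [Algebra K k] (e : E ≃ₐ[K] Matrix n n K)

/-- The matrix over an extension field attached to an element of a matrix algebra. -/
def geometricMatrix (k : Type*) [Field k] [Algebra K k] (e : E ≃ₐ[K] Matrix n n K) :
    E →ₐ[K] Matrix n n k :=
  (Algebra.ofId K k).mapMatrix.comp e.toAlgHom

omit [CompleteSpace K] [FiniteDimensional K E] [CharZero K] [CompleteSpace E] in
theorem geometricMatrix_apply (x : E) : geometricMatrix k e x = (e x).map (algebraMap K k) := rfl

omit [CompleteSpace K] [FiniteDimensional K E] [CharZero K] [CompleteSpace E] in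
theorem geometricMatrix_injective : Function.Injective (geometricMatrix k e) := fun x y h => by
  rw [geometricMatrix_apply, geometricMatrix_apply] at h
  exact e.injective (Matrix.map_injective (algebraMap K k).injective h)

omit [CompleteSpace K] [FiniteDimensional K E] [CharZero K] [CompleteSpace E] in
theorem isUnit_of_isUnit_geometricMatrix {x : E} (h : IsUnit (geometricMatrix k e x)) :
    IsUnit x := by
  rw [geometricMatrix_apply, Matrix.isUnit_iff_isUnit_det] at h
  have h1 : ((e x).map (algebraMap K k)).det = algebraMap K k (e x).det := by
    rw [RingHom.map_det]; rfl
  rw [h1, isUnit_iff_ne_zero, map_ne_zero, ← isUnit_iff_ne_zero, ← Matrix.isUnit_iff_isUnit_det]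
    at h
  simpa using h.map e.symm

theorem mul_mem_matricesOf {Γ : Subgroup (Matrix n n k)ˣ} {x y : Matrix n n k}
    (hx : x ∈ matricesOf Γ) (hy : y ∈ matricesOf Γ) : x * y ∈ matricesOf Γ := by
  obtain ⟨g, hg, rfl⟩ := hx
  obtain ⟨h, hh, rfl⟩ := hy
  exact ⟨g * h, mul_mem hg hh, rfl⟩

theorem isUnit_of_mem_matricesOf {Γ : Subgroup (Matrix n n k)ˣ} {x : Matrix n n k}
    (hx : x ∈ matricesOf Γ) : IsUnit x := by
  obtain ⟨g, -, rfl⟩ := hx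
  exact g.isUnit

theorem mem_of_val_mem_matricesOf {Γ : Subgroup (Matrix n n k)ˣ} {x : (Matrix n n k)ˣ}
    (hx : (x : Matrix n n k) ∈ matricesOf Γ) : x ∈ Γ := by
  obtain ⟨g, hg, h⟩ := hx
  rwa [← Units.ext h]

/-- Conjugation by an invertible matrix. -/
def conjAlgHom (Q : (Matrix n n k)ˣ) : Matrix n n k →ₐ[K] Matrix n n k where
  toFun A := (↑Q⁻¹ : Matrix n n k) * A * Q
  map_one' := by simp
  map_zero' := by simp
  map_mul' A B := by
    simp only [Matrix.mul_assoc]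
    rw [← Matrix.mul_assoc (Q : Matrix n n k) (↑Q⁻¹ : Matrix n n k), Units.mul_inv, Matrix.one_mul]
  map_add' A B := by simp [Matrix.mul_add, Matrix.add_mul]
  commutes' c := by
    rw [Matrix.mul_assoc, Algebra.commutes, ← Matrix.mul_assoc, Units.inv_mul, Matrix.one_mul]

omit [CompleteSpace K] [CharZero K] in
theorem conjAlgHom_apply (Q : (Matrix n n k)ˣ) (A : Matrix n n k) :
    conjAlgHom (K := K) Q A = (↑Q⁻¹ : Matrix n n k) * A * Q := rfl

omit [CompleteSpace K] [CharZero K] in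
theorem conjAlgHom_injective (Q : (Matrix n n k)ˣ) : Function.Injective (conjAlgHom (K := K) Q) :=
  fun A B h => by
    rw [conjAlgHom_apply, conjAlgHom_apply] at h
    have := congrArg (fun M => (Q : Matrix n n k) * M) h
    simpa [← Matrix.mul_assoc] using this

section Diagonal

variable {ψ : E →ₐ[K] Matrix n n k} (hψ : Function.Injective ψ) {d : n → k}
  (hd : Function.Injective d) {u : E} (hu : ψ u = Matrix.diagonal d)

include hd hu in
omit [CompleteSpace K] [FiniteDimensional K E] [CharZero K] [CompleteSpace E] in
theorem eq_diagonal_of_commute {a : E} (ha : Commute a u) :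
    ψ a = Matrix.diagonal fun i => ψ a i i := by
  have h1 : Commute (ψ a) (Matrix.diagonal d) := by rw [← hu]; exact ha.map ψ
  ext i j
  by_cases hij : i = j
  · subst hij; simp
  · rw [Matrix.diagonal_apply_ne _ hij, Matrix.apply_eq_zero_of_commute_diagonal hd h1 hij]

include hψ hd hu in
omit [CompleteSpace K] [FiniteDimensional K E] [CharZero K] [CompleteSpace E] in
theorem commute_of_commute_of_commute {a b : E} (ha : Commute a u) (hb : Commute b u) :
    Commute a b := by
  apply hψ
  rw [map_mul, map_mul, eq_diagonal_of_commute hd hu ha, eq_diagonal_of_commute hd hu hb]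
  simp [Matrix.diagonal_mul_diagonal, mul_comm]

include hψ hd hu in
omit [CompleteSpace K] [FiniteDimensional K E] [CharZero K] [CompleteSpace E] in
theorem eq_zero_of_commute_of_sq_eq_zero {a : E} (ha : Commute a u) (h : a * a = 0) : a = 0 := by
  apply hψ
  have h1 := congrArg ψ h
  rw [map_mul, eq_diagonal_of_commute hd hu ha, Matrix.diagonal_mul_diagonal, map_zero] at h1
  rw [eq_diagonal_of_commute hd hu ha, map_zero]
  ext i j
  by_cases hij : i = j
  · subst hij
    have := congrFun (congrFun h1 i) i
    simpa using this
  · simp [hij]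

include hψ hd hu in
omit [CompleteSpace K] [FiniteDimensional K E] [CharZero K] [CompleteSpace E] in
theorem commute_of_commute_of_injective {Y a : E} (hY : Commute Y u)
    (hinj : Function.Injective fun i => ψ Y i i) (ha : Commute a Y) : Commute a u := by
  have h1 := eq_diagonal_of_commute hd hu hY
  have h2 := eq_diagonal_of_commute hinj h1 ha
  apply hψ
  rw [map_mul, map_mul, h2, hu]
  simp [Matrix.diagonal_mul_diagonal, mul_comm]

/-- The subalgebra of the elements commuting with `u` with equal eigenvalues at two places. -/
def equalEntrySubalgebra (hd : Function.Injective d) (hu : ψ u = Matrix.diagonal d) (i j : n) :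
    Subalgebra K E where
  carrier := {a | Commute a u ∧ ψ a i i = ψ a j j}
  mul_mem' := by
    rintro a b ⟨ha, ha'⟩ ⟨hb, hb'⟩
    refine ⟨ha.mul_left hb, ?_⟩
    rw [map_mul, eq_diagonal_of_commute hd hu ha, eq_diagonal_of_commute hd hu hb]
    simp [ha', hb']
  add_mem' := by
    rintro a b ⟨ha, ha'⟩ ⟨hb, hb'⟩
    exact ⟨ha.add_left hb, by simp [ha', hb']⟩
  algebraMap_mem' c := ⟨Algebra.commutes c u, by simp [Matrix.algebraMap_matrix_apply]⟩

/-- A finite-dimensional subalgebra is closed, so it contains the sum of the exponential series of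
each of its elements. -/
theorem exp_mem_equalEntrySubalgebra {i j : n} {a : E}
    (ha : a ∈ equalEntrySubalgebra hd hu i j) :
    NormedSpace.exp a ∈ equalEntrySubalgebra hd hu i j := by
  have hc : IsClosed (equalEntrySubalgebra hd hu i j : Set E) :=
    Submodule.closed_of_finiteDimensional (Subalgebra.toSubmodule (equalEntrySubalgebra hd hu i j))
  rw [NormedSpace.exp_eq_tsum K]
  exact tsum_mem hc fun m => Subalgebra.smul_mem _ (Subalgebra.pow_mem _ ha _) _

end Diagonal

end RegularElements

/-! ### Curves in the set of elements with a prescribed eigenvalue ratio. -/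

section RegularLie

variable {K : Type*} [NontriviallyNormedField K] [CompleteSpace K] {n : Type*} [Fintype n]
  [DecidableEq n] {E : Type*} [NormedRing E] [NormedAlgebra K E] [FiniteDimensional K E]
  [CharZero K] [CompleteSpace E]
  {k : Type*} [Field k] [Algebra K k] (e : E ≃ₐ[K] Matrix n n K)
  (Γ : Subgroup (Matrix n n k)ˣ)

/-- The rational elements of the Lie algebra of a matrix group. -/
def rationalLie : Submodule K E :=
  ((groupLie Γ).restrictScalars K).comap (geometricMatrix k e).toLinearMap

variable {e Γ}

omit [CompleteSpace K] [FiniteDimensional K E] [CharZero K] [CompleteSpace E] in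
theorem mem_rationalLie {X : E} : X ∈ rationalLie e Γ ↔ geometricMatrix k e X ∈ groupLie Γ :=
  Iff.rfl

omit [CompleteSpace K] [FiniteDimensional K E] [CharZero K] [CompleteSpace E] in
theorem conj_mem_rationalLie {X : E} (hX : X ∈ rationalLie e Γ) {h : Eˣ}
    (hh : geometricMatrix k e h ∈ matricesOf Γ) : ↑h⁻¹ * X * h ∈ rationalLie e Γ := by
  have h1 : Units.map (geometricMatrix k e : E →* Matrix n n k) h ∈ Γ :=
    mem_of_val_mem_matricesOf hh
  have := conj_mem_groupLie (mem_rationalLie.1 hX) h1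
  rw [mem_rationalLie, map_mul, map_mul]
  exact this

section Diagonal

variable {Q : (Matrix n n k)ˣ} {d : n → k} (hd : Function.Injective d) {u : E}
  (hu : (conjAlgHom (K := K) Q).comp (geometricMatrix k e) u = Matrix.diagonal d)

omit [CompleteSpace K] [FiniteDimensional K E] [CharZero K] [CompleteSpace E] in
theorem conj_geometricMatrix_injective :
    Function.Injective ((conjAlgHom (K := K) Q).comp (geometricMatrix k e)) :=
  (conjAlgHom_injective (K := K) Q).comp (geometricMatrix_injective e)

local notation "Ψ" => AlgHom.comp (conjAlgHom (K := K) Q) (geometricMatrix k e)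

include hd hu in
omit [CompleteSpace K] [CharZero K] [CompleteSpace E] in
/-- Modulo commutators with `b`, every element of the Lie algebra commutes with `u`. -/
theorem exists_commutator_add {b : Eˣ} (hb : geometricMatrix k e b ∈ matricesOf Γ)
    (hbu : Commute (b : E) u) (hZ : ∀ a : E, Commute a b → Commute a u) {X : E}
    (hX : X ∈ rationalLie e Γ) :
    ∃ A ∈ rationalLie e Γ, ∃ Y ∈ rationalLie e Γ, Commute Y u ∧
      (b : E) * X = A * b - b * A + b * Y := by
  let L : rationalLie e Γ →ₗ[K] rationalLie e Γ :=
    { toFun := fun A => ⟨(↑b⁻¹ : E) * A * b - A,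
        Submodule.sub_mem _ (conj_mem_rationalLie A.2 hb) A.2⟩
      map_add' := fun A B => Subtype.ext (by simp [mul_add, add_mul]; abel)
      map_smul' := fun c A => Subtype.ext (by simp [smul_sub]) }
  have hL : ∀ A : rationalLie e Γ, (b : E) * (L A : E) = A * b - b * A := fun A => by
    simp [L, mul_sub, ← mul_assoc]
  have hker : ∀ A, A ∈ LinearMap.ker L → Commute (A : E) u := fun A hA => by
    have h1 := hL A
    rw [LinearMap.mem_ker.1 hA] at h1
    apply hZ
    exact (sub_eq_zero.1 (by simpa using h1.symm) : (A : E) * b = b * A)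
  -- In the coordinates where `u` is diagonal, `b * L A = A * b - b * A` has zero diagonal because
  -- `b` is diagonal, whereas an element of the kernel is diagonal. Rank-nullity then makes kernel
  -- and range complementary.
  have hdisj : Disjoint (LinearMap.ker L) (LinearMap.range L) := by
    rw [Submodule.disjoint_def]
    rintro Y hY ⟨A, rfl⟩
    have hYu := hker _ hY
    have h1 : Commute ((b : E) * (L A : E)) u := hbu.mul_left hYu
    have h2 : (b : E) * (L A : E) = 0 := by
      apply conj_geometricMatrix_injective (e := e) (Q := Q)
      rw [eq_diagonal_of_commute hd hu h1, map_zero, hL]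
      ext i j
      by_cases hij : i = j
      · subst hij
        rw [map_sub, map_mul, map_mul, eq_diagonal_of_commute hd hu hbu]
        simp [Matrix.mul_diagonal, Matrix.diagonal_mul, mul_comm]
      · simp [hij]
    rw [b.isUnit.mul_right_eq_zero] at h2
    exact Subtype.ext h2
  have htop : LinearMap.ker L ⊔ LinearMap.range L = ⊤ := by
    refine Submodule.eq_top_of_disjoint _ _ ?_ hdisj
    rw [add_comm, LinearMap.finrank_range_add_finrank_ker]
  obtain ⟨Y, hY, Z, ⟨A, rfl⟩, hYA⟩ := Submodule.mem_sup.1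
    (htop ▸ Submodule.mem_top : (⟨X, hX⟩ : rationalLie e Γ) ∈ _)
  refine ⟨A, A.2, Y, Y.2, hker Y hY, ?_⟩
  have := congrArg (Subtype.val) hYA
  rw [← hL, ← mul_add, add_comm]
  simp only [Submodule.coe_add] at this
  rw [this]

variable (e Γ Q u) in
/-- The conjugates of the elements of the centralizer of `u` that have the centralizer of `u` and
two given eigenvalues with quotient `ζ`. -/
def eigenvalueRatioSet (ζ : k) (i j : n) : Set E :=
  {x | ∃ h b : Eˣ, geometricMatrix k e h ∈ matricesOf Γ ∧ geometricMatrix k e b ∈ matricesOf Γ ∧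
    Commute (b : E) u ∧ (∀ a : E, Commute a b → Commute a u) ∧
    Ψ b i i = ζ * Ψ b j j ∧ x = h * b * ↑h⁻¹}

omit [CompleteSpace K] [FiniteDimensional K E] [CharZero K] [CompleteSpace E] in
include hd hu in
theorem evalMatrix_eigenvalueRatioPoly_of_mem {ζ : k} {i j : n} {x : E}
    (hx : x ∈ eigenvalueRatioSet e Γ Q u ζ i j) :
    evalMatrix k (geometricMatrix k e x) (eigenvalueRatioPoly n ζ) = 0 := by
  obtain ⟨h, b, -, -, hbu, -, hij, rfl⟩ := hx
  have h1 := eq_diagonal_of_commute hd hu hbu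
  refine evalMatrix_eigenvalueRatioPoly_eq_zero
    (Q := Units.map (geometricMatrix k e : E →* Matrix n n k) h * Q) (d := fun i => Ψ b i i) ?_ hij
  rw [← h1, AlgHom.comp_apply, conjAlgHom_apply, mul_inv_rev, Units.val_mul, Units.val_mul,
    map_mul, map_mul]
  have h2 : (↑(Units.map (geometricMatrix k e : E →* Matrix n n k) h)⁻¹ : Matrix n n k)
    = geometricMatrix k e ↑h⁻¹ := rfl
  have h3 : (↑(Units.map (geometricMatrix k e : E →* Matrix n n k) h) : Matrix n n k)
    = geometricMatrix k e ↑h := rfl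
  rw [h2, h3]
  have h4 : geometricMatrix k e ↑h⁻¹ * geometricMatrix k e ↑h = 1 := by
    rw [← map_mul, Units.inv_mul, map_one]
  calc _ = (↑Q⁻¹ : Matrix n n k) * (geometricMatrix k e ↑h⁻¹ * geometricMatrix k e ↑h) *
        geometricMatrix k e b * (geometricMatrix k e ↑h⁻¹ * geometricMatrix k e ↑h) * Q := by
        simp only [Matrix.mul_assoc]
    _ = _ := by rw [h4, Matrix.mul_one, Matrix.mul_one]

include hd hu in
/-- Tangent vectors in the Lie algebra are tangent to `eigenvalueRatioSet`, provided that the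
elements of the Lie algebra that commute with `u` have equal entries. -/
theorem exists_curve_mem_eigenvalueRatioSet (hr : 0 < (NormedSpace.expSeries K E).radius)
    (hΓ : IsClosedOver K Γ) {i j : n}
    (heq : ∀ Y ∈ rationalLie e Γ, Commute Y u → Ψ Y i i = Ψ Y j j)
    {ζ : k} {x : E} (hx : x ∈ eigenvalueRatioSet e Γ Q u ζ i j) {X : E}
    (hX : X ∈ rationalLie e Γ) :
    ∃ c : K → E, c 0 = x ∧ HasDerivAt c (x * X) 0 ∧
      ∀ᶠ s in 𝓝 0, c s ∈ eigenvalueRatioSet e Γ Q u ζ i j := by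
  obtain ⟨h, b, hh, hb, hbu, hZ, hij, rfl⟩ := hx
  obtain ⟨A, hA, Y, hY, hYu, hAY⟩ :=
    exists_commutator_add hd hu hb hbu hZ (conj_mem_rationalLie hX hh)
  have h0 : ∀ A : E, (0 : K) • A ∈ Metric.eball (0 : E) (NormedSpace.expSeries K E).radius :=
    fun A => by simpa using hr
  have hexp : ∀ A : E, HasDerivAt (fun s : K => NormedSpace.exp (s • A)) A 0 := fun A => by
    simpa using hasDerivAt_exp_smul_const_of_mem_ball A (0 : K) (h0 A)
  -- Moving the conjugating element by `exp (s • A)` contributes `A * b - b * A` to the velocity,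
  -- and moving `b` by `exp (s • Y)` contributes `b * Y`. By `heq` the entries `i` and `j` of `exp
  -- (s • Y)` agree, so the ratio `ζ` is preserved.
  refine ⟨fun s => h * NormedSpace.exp (s • A) * (b * NormedSpace.exp (s • Y)) *
    NormedSpace.exp (s • (-A)) * ↑h⁻¹, by simp, ?_, ?_⟩
  · have h1 := (((((hexp A).const_mul (h : E)).mul ((hexp Y).const_mul (b : E))).mul
      (hexp (-A))).mul_const (↑h⁻¹ : E))
    simp only [Pi.mul_apply, zero_smul, NormedSpace.exp_zero, mul_one] at h1
    convert! h1 using 1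
    have h2 : (h : E) * b * ↑h⁻¹ * X = h * (b * (↑h⁻¹ * X * h)) * ↑h⁻¹ := by
      simp [mul_assoc]
    rw [h2, hAY]
    noncomm_ring
  · have hcont : ∀ A : E, Filter.Tendsto (fun s : K => NormedSpace.exp (s • A)) (𝓝 0) (𝓝 1) :=
      fun A => by simpa using (hexp A).continuousAt.tendsto
    have hbt : Filter.Tendsto (fun s : K => (b : E) * NormedSpace.exp (s • Y)) (𝓝 0) (𝓝 (b : E)) := by
      simpa using (hcont Y).const_mul (b : E)
    -- The centralizer of `b` is commutative, so semicontinuity applies at `b`: the nearby elements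
    -- `b * exp (s • Y)`, which commute with `b`, keep the centralizer condition.
    have hbcomm : ∀ a c : E, Commute a b → Commute c b → Commute a c := fun a c ha hc =>
      commute_of_commute_of_commute (conj_geometricMatrix_injective (e := e) (Q := Q)) hd hu
        (hZ a ha) (hZ c hc)
    filter_upwards [eventually_exp_smul_mem e hr hΓ hA, eventually_exp_smul_mem e hr hΓ hY,
      eventually_smul_mem_eball hr A, eventually_smul_mem_eball hr Y,
      hbt.eventually (eventually_commute_of_commute K hbcomm)] with s h1 h2 h3 h4 h5
    let εA := (NormedSpace.isUnit_exp_of_mem_ball h3).unit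
    let εY := (NormedSpace.isUnit_exp_of_mem_ball h4).unit
    have hεA : (↑εA⁻¹ : E) = NormedSpace.exp (s • (-A)) := by
      refine Units.inv_eq_of_mul_eq_one_right ?_
      change NormedSpace.exp (s • A) * _ = 1
      rw [← NormedSpace.exp_add_of_commute_of_mem_ball (𝕂 := K) _ h3 (by simpa using h3), smul_neg,
        add_neg_cancel, NormedSpace.exp_zero]
      exact ((Commute.refl A).neg_right.smul_left s).smul_right s
    have hYs : NormedSpace.exp (s • Y) ∈ equalEntrySubalgebra (ψ := Ψ) hd hu i j :=
      exp_mem_equalEntrySubalgebra hd hu (Subalgebra.smul_mem _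
        (show Y ∈ equalEntrySubalgebra (ψ := Ψ) hd hu i j from ⟨hYu, heq Y hY hYu⟩) s)
    refine ⟨h * εA, b * εY, ?_, ?_, ?_, ?_, ?_, ?_⟩
    · rw [Units.val_mul, map_mul]
      exact mul_mem_matricesOf hh h1
    · rw [Units.val_mul, map_mul]
      exact mul_mem_matricesOf hb h2
    · exact hbu.mul_left hYs.1
    · intro a ha
      refine hZ a (h5 ?_ a ha)
      exact commute_of_commute_of_commute (conj_geometricMatrix_injective (e := e) (Q := Q)) hd hu
        (hbu.mul_left hYs.1) hbu
    · rw [Units.val_mul, map_mul, eq_diagonal_of_commute hd hu hbu, Matrix.diagonal_mul,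
        Matrix.diagonal_mul, hij, show Ψ (εY : E) i i = Ψ (εY : E) j j from hYs.2, mul_assoc]
    · rw [mul_inv_rev, Units.val_mul, Units.val_mul, Units.val_mul, hεA]
      simp [mul_assoc, εA, εY]

end Diagonal

end RegularLie

/-! ### Existence of regular elements in the Lie algebra and near the identity. -/

section RegularLie

variable {K : Type*} [NontriviallyNormedField K] [CompleteSpace K] {n : Type*} [Fintype n]
  [DecidableEq n] {E : Type*} [NormedRing E] [NormedAlgebra K E] [FiniteDimensional K E]
  [CharZero K] [CompleteSpace E]
  {k : Type*} [Field k] [Algebra K k] {e : E ≃ₐ[K] Matrix n n K}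
  {Γ : Subgroup (Matrix n n k)ˣ}

/-- The polynomials of bounded degree that vanish on a set of rational matrices. -/
def boundedVanishing (k : Type*) [Field k] [Algebra K k] (e : E ≃ₐ[K] Matrix n n K) (S : Set E)
    (m : ℕ) : Submodule k (MvPolynomial (n × n) k) :=
  MvPolynomial.restrictTotalDegree (n × n) k m ⊓
    (matrixVanishingIdeal (geometricMatrix k e '' S)).restrictScalars k

omit [CompleteSpace K] [FiniteDimensional K E] [CharZero K] [CompleteSpace E] in
theorem mem_boundedVanishing {S : Set E} {m : ℕ} {f : MvPolynomial (n × n) k} :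
    f ∈ boundedVanishing k e S m ↔
      f.totalDegree ≤ m ∧ ∀ x ∈ S, evalMatrix k (geometricMatrix k e x) f = 0 := by
  rw [boundedVanishing, Submodule.mem_inf, MvPolynomial.mem_restrictTotalDegree]
  simp [mem_matrixVanishingIdeal]

instance (S : Set E) (m : ℕ) : FiniteDimensional k (boundedVanishing k e S m) :=
  Submodule.finiteDimensional_inf_left _ _

/-- If a set of rational matrices has tangent vectors in all directions of the Lie algebra, then
the polynomials of bounded degree vanishing on it are stable under the Lie algebra. -/
theorem rightDeriv_mem_boundedVanishing [CharZero k] [IsGalois K k] (hΓ : IsClosedOver K Γ)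
    {S : Set E} (hS : ∀ x ∈ S, ∀ X ∈ rationalLie e Γ, ∃ c : K → E, c 0 = x ∧
      HasDerivAt c (x * X) 0 ∧ ∀ᶠ s in 𝓝 0, c s ∈ S) {m : ℕ} {X : Matrix n n k}
    (hX : X ∈ groupLie Γ) {f : MvPolynomial (n × n) k} (hf : f ∈ boundedVanishing k e S m) :
    rightDeriv X f ∈ boundedVanishing k e S m := by
  have hX' := groupLie_le_span hΓ hX
  clear hX
  induction hX' using Submodule.span_induction with
  | zero =>
    have := rightDeriv_smul (0 : k) (0 : Matrix n n k) f
    rw [zero_smul, zero_smul] at this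
    rw [this]
    exact zero_mem _
  | add X Y _ _ hX hY =>
    rw [rightDeriv_add]
    exact add_mem hX hY
  | smul a X _ hX =>
    rw [rightDeriv_smul]
    exact Submodule.smul_mem _ _ hX
  | mem X hX =>
    obtain ⟨X₀, hX₀, rfl⟩ := hX
    obtain ⟨X, rfl⟩ := e.surjective X₀
    rw [mem_boundedVanishing] at hf ⊢
    refine ⟨(totalDegree_rightDeriv_le _ _).trans hf.1, fun x hx => ?_⟩
    -- The curve lives over `K` but `f` has coefficients in `k`. Since the points of `S` have
    -- entries in `K`, the components of `f` along a `K`-basis vanish on `S` separately, and each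
    -- can be differentiated along the curve.
    let b := Module.Free.chooseBasis K k
    obtain ⟨F, hF⟩ := exists_sum_basis_mul_map b f
    have hsum : ∀ (G : MvPolynomial (n × n) K → MvPolynomial (n × n) K) (y : E),
        evalMatrix k (geometricMatrix k e y)
          (F.sum fun a q => MvPolynomial.C (b a) * MvPolynomial.map (algebraMap K k) (G q)) =
        ∑ a ∈ F.support, evalMatrix K (e y) (G (F a)) • b a := fun G y => by
      rw [Finsupp.sum, map_sum]
      refine Finset.sum_congr rfl fun a _ => ?_
      rw [map_mul, ← MvPolynomial.algebraMap_eq, AlgHom.commutes, evalMatrix_map_left,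
        geometricMatrix_apply, evalMatrix_map_algebraMap, Algebra.smul_def, mul_comm]
      rfl
    have hvan : ∀ y ∈ S, ∀ a, evalMatrix K (e y) (F a) = 0 := fun y hy a => by
      by_cases ha : a ∈ F.support
      · have h1 := hf.2 y hy
        rw [hF] at h1
        replace h1 := (hsum id y).symm.trans h1
        exact (linearIndependent_iff'.1 b.linearIndependent) _ _ h1 a ha
      · rw [Finsupp.notMem_support_iff.1 ha, map_zero]
    obtain ⟨c, hc0, hc, hcS⟩ := hS x hx X hX₀
    have hder : ∀ a, evalMatrix K (e x) (rightDeriv (e X) (F a)) = 0 := fun a => by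
      have h1 := hasDerivAt_evalMatrix e hc (rightDeriv (e X))
        (fun ij => by rw [evalMatrix_rightDeriv_X, hc0, ← map_mul]) (F a)
      have h2 : (fun s => evalMatrix K (e (c s)) (F a)) =ᶠ[𝓝 0] fun _ => 0 := by
        filter_upwards [hcS] with s hs using hvan _ hs a
      have h3 := h1.unique ((hasDerivAt_const (0 : K) (0 : K)).congr_of_eventuallyEq h2)
      rwa [hc0] at h3
    have h4 : rightDeriv ((e X).map (algebraMap K k)) f =
        F.sum fun a q => MvPolynomial.C (b a) *
          MvPolynomial.map (algebraMap K k) (rightDeriv (e X) q) := by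
      rw [hF, Finsupp.sum, map_sum]
      refine Finset.sum_congr rfl fun a _ => ?_
      rw [← MvPolynomial.smul_eq_C_mul, Derivation.map_smul, rightDeriv_map,
        MvPolynomial.smul_eq_C_mul]
    rw [h4, hsum]
    exact Finset.sum_eq_zero fun a _ => by rw [hder, zero_smul]

/-- The Lie algebra of a connected group contains an element with the same centralizer as a given
regular element of the group. -/
theorem exists_rationalLie_commute_imp [IsAlgClosed k] [CharZero k] [IsGalois K k]
    (hr : 0 < (NormedSpace.expSeries K E).radius) (hI : (groupIdeal Γ).IsPrime)
    (hΓ : IsClosedOver K Γ) {Q : (Matrix n n k)ˣ} {d : n → k} (hd : Function.Injective d) {u : E}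
    (hu : (conjAlgHom (K := K) Q).comp (geometricMatrix k e) u = Matrix.diagonal d)
    (huΓ : geometricMatrix k e u ∈ matricesOf Γ) :
    ∃ Y ∈ rationalLie e Γ, Commute Y u ∧ ∀ a, Commute a Y → Commute a u := by
  by_contra! hcon
  let Ψ : E →ₐ[K] Matrix n n k := (conjAlgHom (K := K) Q).comp (geometricMatrix k e)
  have hΨ : Function.Injective Ψ := conj_geometricMatrix_injective
  let 𝔱 : Submodule K E := rationalLie e Γ ⊓ Subalgebra.toSubmodule (Subalgebra.centralizer K {u})
  have h𝔱 : ∀ Y, Y ∈ 𝔱 ↔ Y ∈ rationalLie e Γ ∧ Commute Y u := fun Y => by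
    simp only [𝔱, Submodule.mem_inf, Subalgebra.mem_toSubmodule, Subalgebra.mem_centralizer_iff,
      Set.mem_singleton_iff, forall_eq]
    rw [eq_comm]; rfl
  let φ : n → n → (E →ₗ[K] k) := fun i j =>
    (Matrix.entryLinearMap K k i j) ∘ₗ Ψ.toLinearMap
  let p : {ij : n × n // ij.1 ≠ ij.2} → Submodule K 𝔱 := fun ij =>
    LinearMap.ker ((φ ij.1.1 ij.1.1 - φ ij.1.2 ij.1.2) ∘ₗ 𝔱.subtype)
  -- If the diagonal entries of `Y` were distinct, its centralizer would be that of `u`; so by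
  -- `hcon` two of them coincide. A vector space over an infinite field is not a finite union of
  -- proper subspaces, whence one pair `(i, j)` serves all of `𝔱`.
  have hcov : ⋃ ij, (p ij : Set 𝔱) = Set.univ := by
    refine Set.eq_univ_of_forall fun Y => ?_
    obtain ⟨hY, hYu⟩ := (h𝔱 Y).1 Y.2
    obtain ⟨a, haY, hau⟩ := hcon Y hY hYu
    have hninj : ¬ Function.Injective fun i => Ψ Y i i := fun hinj =>
      hau (commute_of_commute_of_injective hΨ hd hu hYu hinj haY)
    rw [Function.Injective] at hninj
    push Not at hninj
    obtain ⟨i, j, hij, hne⟩ := hninj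
    refine Set.mem_iUnion.2 ⟨⟨(i, j), hne⟩, ?_⟩
    simpa [p, φ, sub_eq_zero] using hij
  obtain ⟨⟨⟨i, j⟩, hne⟩, hp⟩ := Subspace.exists_eq_top_of_iUnion_eq_univ hcov
  simp only at hne
  have heq : ∀ Y ∈ rationalLie e Γ, Commute Y u → Ψ Y i i = Ψ Y j j := fun Y hY hYu => by
    have : (⟨Y, (h𝔱 Y).2 ⟨hY, hYu⟩⟩ : 𝔱) ∈ p ⟨(i, j), hne⟩ := hp ▸ Submodule.mem_top
    simpa [p, φ, sub_eq_zero] using this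
  have huU : IsUnit u := isUnit_of_isUnit_geometricMatrix e (isUnit_of_mem_matricesOf huΓ)
  have hdj : d j ≠ 0 := by
    have h1 : IsUnit (Matrix.diagonal d) := hu ▸ huU.map Ψ
    rw [Matrix.isUnit_diagonal] at h1
    exact (Pi.isUnit_iff.1 h1 j).ne_zero
  have hζ : d i / d j ≠ 1 := fun h => hne (hd ((div_eq_one_iff_eq hdj).1 h))
  obtain ⟨w, hw⟩ := huΓ
  let S := eigenvalueRatioSet e Γ Q u (d i / d j) i j
  have huS : u ∈ S := by
    refine ⟨1, huU.unit, ?_, ⟨w, hw⟩, Commute.refl _, fun a ha => ha, ?_, by simp⟩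
    · rw [Units.val_one, map_one]
      exact ⟨1, one_mem _, rfl⟩
    · change Ψ u i i = _ * Ψ u j j
      rw [show Ψ u = _ from hu]
      simp [div_mul_cancel₀ _ hdj]
  -- The stable space vanishes at the point `u` of `S`, so the ratio polynomial vanishes on all of
  -- `Γ`, in particular at 1, contrary to `ζ ≠ 1`.
  have hmem := le_groupIdeal_of_rightDeriv_stable hI
    (boundedVanishing k e S (eigenvalueRatioPoly n (d i / d j)).totalDegree)
    (fun X hX f hf => rightDeriv_mem_boundedVanishing hΓ
      (fun x hx X hX => exists_curve_mem_eigenvalueRatioSet hd hu hr hΓ heq hx hX) hX hf)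
    hw.1 (fun f hf => by rw [hw.2]; exact (mem_boundedVanishing.1 hf).2 u huS)
    (mem_boundedVanishing.2 ⟨le_rfl, fun x hx => evalMatrix_eigenvalueRatioPoly_of_mem hd hu hx⟩)
  exact evalMatrix_eigenvalueRatioPoly_one hζ (by simpa using mem_groupIdeal.1 hmem 1 (one_mem _))

/-- A connected group contains elements close to the identity with the same centralizer as a
given regular element of the group. -/
theorem frequently_commute_iff [IsAlgClosed k] [CharZero k] [IsGalois K k]
    (hr : 0 < (NormedSpace.expSeries K E).radius) (hI : (groupIdeal Γ).IsPrime)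
    (hΓ : IsClosedOver K Γ) {Q : (Matrix n n k)ˣ} {d : n → k} (hd : Function.Injective d) {u : E}
    (hu : (conjAlgHom (K := K) Q).comp (geometricMatrix k e) u = Matrix.diagonal d)
    (huΓ : geometricMatrix k e u ∈ matricesOf Γ) :
    ∃ᶠ x in 𝓝 (1 : E), geometricMatrix k e x ∈ matricesOf Γ ∧
      ∀ a, Commute a x ↔ Commute a u := by
  obtain ⟨Y, hY, hYu, hZ⟩ := exists_rationalLie_commute_imp hr hI hΓ hd hu huΓ
  have hcomm : ∀ a b : E, Commute a u → Commute b u → Commute a b := fun a b =>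
    commute_of_commute_of_commute (conj_geometricMatrix_injective (e := e) (Q := Q)) hd hu
  have hexp : HasDerivAt (fun s : K => NormedSpace.exp (s • Y)) Y 0 := by
    simpa using hasDerivAt_exp_smul_const_of_mem_ball Y (0 : K) (by simpa using hr)
  have hslope := hexp.tendsto_slope_zero
  simp only [zero_add, zero_smul, NormedSpace.exp_zero] at hslope
  have hexp1 : Filter.Tendsto (fun s : K => NormedSpace.exp (s • Y)) (𝓝[≠] 0) (𝓝 1) := by
    simpa using hexp.continuousAt.tendsto.mono_left nhdsWithin_le_nhds
  refine hexp1.frequently (Filter.Eventually.frequently ?_)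
  -- The quotient `s⁻¹ • (exp (s • Y) - 1)` tends to `Y` and commutes with it, so for small nonzero
  -- `s` it has the centralizer of `Y`. Anything commuting with `exp (s • Y)` commutes with this
  -- quotient.
  filter_upwards [hslope.eventually (eventually_commute_of_commute K
      fun a b ha hb => hcomm a b (hZ a ha) (hZ b hb)), self_mem_nhdsWithin,
    nhdsWithin_le_nhds (eventually_exp_smul_mem e hr hΓ hY)] with s h1 hs h2
  refine ⟨h2, fun a => ⟨fun ha => ?_, fun ha => ?_⟩⟩
  · refine hZ a (h1 ?_ a ?_)
    · refine Commute.smul_left (Commute.sub_left ?_ (Commute.one_left _)) _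
      exact ((Commute.refl Y).smul_left s).exp_left
    · exact Commute.smul_right (Commute.sub_right ha (Commute.one_right _)) _
  · exact ((hcomm a Y ha hYu).smul_right s).exp_right

end RegularLie

/-! ### Semisimplicity of `ad x` for a reduced centralizer. -/

section Krasner

/-- The commutator with `y` is a derivation; when its value at `x` commutes with `x`, the ordinary
chain rule holds for polynomials in `x`. -/
theorem mul_aeval_sub_aeval_mul {K E : Type*} [CommRing K] [Ring E] [Algebra K E] {x y : E}
    (h : Commute x (y * x - x * y)) (p : Polynomial K) :
    y * Polynomial.aeval x p - Polynomial.aeval x p * y =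
      Polynomial.aeval x (Polynomial.derivative p) * (y * x - x * y) := by
  induction p using Polynomial.induction_on with
  | C a =>
    simp [Algebra.commutes]
  | add p q hp hq =>
    simp only [map_add, mul_add, add_mul, ← hp, ← hq]
    abel
  | monomial m a hm =>
    rw [pow_succ, ← mul_assoc]
    generalize Polynomial.C a * Polynomial.X ^ m = q at hm
    rw [Polynomial.derivative_mul, Polynomial.derivative_X, mul_one, map_mul, Polynomial.aeval_X,
      map_add, map_mul, Polynomial.aeval_X, add_mul, mul_assoc (_ : E) x (y * x - x * y), h.eq,
      ← mul_assoc (_ : E) (y * x - x * y) x, ← hm]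
    noncomm_ring

variable (K : Type*) [Field K] [CharZero K] {E : Type*} [Ring E] [Algebra K E]
  [FiniteDimensional K E]

include K in
/-- If the centralizer of `x` is reduced, then a commutator with `x` that commutes with `x`
vanishes. -/
theorem commute_of_commute_commutator {x : E}
    (hred : ∀ a : E, Commute a x → a * a = 0 → a = 0) {y : E} (h : Commute x (y * x - x * y)) :
    Commute y x := by
  have hint : IsIntegral K x := Algebra.IsIntegral.isIntegral x
  have hm := minpoly.ne_zero hint
  -- If `minpoly = q * q * r`, then `(q * r)(x)` commutes with `x` and has square zero, so it
  -- vanishes; minimality makes `q` a unit.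
  have hsq : Squarefree (minpoly K x) := by
    rintro q ⟨r, hr⟩
    have h1 : Polynomial.aeval x (q * r) = 0 := by
      refine hred _ ?_ ?_
      · have := Commute.map (Commute.all (q * r) Polynomial.X) (Polynomial.aeval x)
        rwa [Polynomial.aeval_X] at this
      · rw [← map_mul, show q * r * (q * r) = minpoly K x * r by rw [hr]; ring, map_mul,
          minpoly.aeval, zero_mul]
    have h2 := minpoly.dvd K x h1
    have hqr : q * r ≠ 0 := by
      rintro h0
      apply hm
      rw [hr, mul_assoc, h0, mul_zero]
    have h3 : q * (q * r) ∣ 1 * (q * r) := by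
      rw [one_mul, ← mul_assoc, ← hr]; exact h2
    exact isUnit_of_dvd_one ((mul_dvd_mul_iff_right hqr).1 h3)
  have hsep : (minpoly K x).Separable := PerfectField.separable_iff_squarefree.2 hsq
  obtain ⟨a, b, hab⟩ := hsep
  -- The chain rule gives `m'(x) * (y * x - x * y) = 0` for the minimal polynomial `m`, and
  -- separability makes `m'(x)` invertible.
  have h1 := mul_aeval_sub_aeval_mul h (minpoly K x)
  rw [minpoly.aeval, mul_zero, zero_mul, sub_zero] at h1
  have h2 := congrArg (Polynomial.aeval x) hab
  rw [map_add, map_mul, map_mul, minpoly.aeval, mul_zero, zero_add, map_one] at h2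
  have h3 : y * x - x * y = 0 := by
    rw [← one_mul (y * x - x * y), ← h2, mul_assoc, ← h1, mul_zero]
  exact sub_eq_zero.1 h3

include K in
-- Kernel and range of `ad x` meet trivially, so they span `E` by rank-nullity. This is the
-- surjectivity of the differential in `eventually_exists_conj`.
theorem exists_commutator_add_commute {x : E}
    (hred : ∀ a : E, Commute a x → a * a = 0 → a = 0) (z : E) :
    ∃ a c : E, Commute c x ∧ a * x - x * a + c = z := by
  let L : E →ₗ[K] E := LinearMap.mulRight K x - LinearMap.mulLeft K x
  have hL : ∀ a, L a = a * x - x * a := fun a => by simp [L]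
  have hker : ∀ a, a ∈ LinearMap.ker L ↔ Commute a x := fun a => by
    rw [LinearMap.mem_ker, hL, sub_eq_zero]; rfl
  have hdisj : Disjoint (LinearMap.ker L) (LinearMap.range L) := by
    rw [Submodule.disjoint_def]
    rintro w hw ⟨y, rfl⟩
    rw [hker] at hw
    rw [hL] at hw ⊢
    rw [sub_eq_zero]
    exact commute_of_commute_commutator K hred hw.symm
  have htop : LinearMap.ker L ⊔ LinearMap.range L = ⊤ := by
    refine Submodule.eq_top_of_disjoint _ _ ?_ hdisj
    rw [add_comm, LinearMap.finrank_range_add_finrank_ker]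
  obtain ⟨c, hc, w, ⟨a, rfl⟩, h⟩ := Submodule.mem_sup.1 (htop ▸ Submodule.mem_top : z ∈ _)
  exact ⟨a, c, (hker c).1 hc, by rw [← hL, add_comm, h]⟩

end Krasner

/-! ### Krasner's lemma for conjugacy classes. -/

section KrasnerTopology

variable (K : Type*) [NontriviallyNormedField K] [CompleteSpace K] [CharZero K]
  {E : Type*} [NormedRing E] [NormedAlgebra K E] [FiniteDimensional K E] [CompleteSpace E]

include K in
/-- If the centralizer of `x` is commutative and reduced, then every element close to `x` is
conjugate, by an element close to the identity, to an element with the same centralizer as `x`. -/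
theorem eventually_exists_conj {x : E}
    (hcomm : ∀ a b : E, Commute a x → Commute b x → Commute a b)
    (hred : ∀ a : E, Commute a x → a * a = 0 → a = 0) {U : Set E} (hU : U ∈ 𝓝 (1 : E)) :
    ∀ᶠ y in 𝓝 x, ∃ g : Eˣ, (g : E) ∈ U ∧ (↑g⁻¹ : E) ∈ U ∧ ∃ b : E, y = g * b * ↑g⁻¹ ∧
      ∀ a, Commute a b ↔ Commute a x := by
  let C : Submodule K E := Subalgebra.toSubmodule (Subalgebra.centralizer K {x})
  have hC : ∀ c, c ∈ C ↔ Commute c x := fun c => by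
    simp only [C, Subalgebra.mem_toSubmodule, Subalgebra.mem_centralizer_iff,
      Set.mem_singleton_iff, forall_eq]
    rw [eq_comm]; rfl
  have : CompleteSpace C := FiniteDimensional.complete K C
  -- The differential of `Φ` at the origin is `(a, c) ↦ a * x - x * a + c`. `Ring.inverse` is zero
  -- off the units, but `1 + a` is a unit for small `a`.
  let Φ : E × C → E := fun ac => (1 + ac.1) * (x + ac.2) * Ring.inverse (1 + ac.1)
  have h1 : HasStrictFDerivAt (fun ac : E × C => 1 + ac.1) (ContinuousLinearMap.fst K E C) (0, 0) :=
    hasStrictFDerivAt_fst.const_add 1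
  have h2 : HasStrictFDerivAt (fun ac : E × C => x + (ac.2 : E))
      (C.subtypeL ∘L ContinuousLinearMap.snd K E C) (0, 0) :=
    ((C.subtypeL.hasStrictFDerivAt).comp _ hasStrictFDerivAt_snd).const_add x
  have h3 : HasStrictFDerivAt (fun ac : E × C => Ring.inverse (1 + ac.1))
      (-ContinuousLinearMap.fst K E C) (0, 0) := by
    have := (hasStrictFDerivAt_ringInverse (𝕜 := K) (1 : Eˣ))
    have h4 : HasStrictFDerivAt Ring.inverse
        (-ContinuousLinearMap.mulLeftRight K E ↑(1 : Eˣ)⁻¹ ↑(1 : Eˣ)⁻¹)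
        ((fun ac : E × C => 1 + ac.1) (0, 0)) := by simpa using this
    convert! h4.comp (0, 0) h1 using 1
    ext <;> simp
  have hΦ := (h1.mul' h2).mul' h3
  have hsurj := hΦ.map_nhds_eq_of_surj (by
    rw [LinearMap.range_eq_top]
    intro z
    obtain ⟨a, c, hc, h⟩ := exists_commutator_add_commute K hred z
    refine ⟨(a, ⟨c, (hC c).2 hc⟩), ?_⟩
    simp
    rw [← h]
    abel)
  have hx : Φ (0, 0) = x := by simp [Φ]
  change Filter.map Φ (𝓝 (0, 0)) = 𝓝 (Φ (0, 0)) at hsurj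
  rw [hx] at hsurj
  rw [← hsurj, Filter.eventually_map]
  have ht1 : Filter.Tendsto (fun ac : E × C => 1 + ac.1) (𝓝 (0, 0)) (𝓝 1) := by
    simpa using h1.continuousAt.tendsto
  have ht2 : Filter.Tendsto (fun ac : E × C => x + (ac.2 : E)) (𝓝 (0, 0)) (𝓝 x) := by
    simpa using h2.continuousAt.tendsto
  have ht3 : Filter.Tendsto (fun ac : E × C => Ring.inverse (1 + ac.1)) (𝓝 (0, 0)) (𝓝 1) := by
    simpa using h3.continuousAt.tendsto
  filter_upwards [ht1.eventually hU, ht3.eventually hU,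
    ht1.eventually (Units.isOpen.mem_nhds (x := (1 : E)) isUnit_one),
    ht2.eventually (eventually_commute_of_commute K hcomm)] with ac hU1 hU2 hu hZ
  have hcx : Commute (ac.2 : E) x := (hC _).1 ac.2.2
  have hb : Commute (x + (ac.2 : E)) x := (Commute.refl x).add_left hcx
  have hinv : (↑hu.unit⁻¹ : E) = Ring.inverse (1 + ac.1) := by
    conv_rhs => rw [← hu.unit_spec, Ring.inverse_unit]
  refine ⟨hu.unit, hU1, by rw [hinv]; exact hU2, x + ac.2, by rw [hinv]; rfl,
    fun a => ⟨hZ hb a, fun ha => ?_⟩⟩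
  exact hcomm a _ ha hb

end KrasnerTopology

/-! ### Connected Noetherian groups are irreducible. -/

section Irreducibility

open TopologicalSpace

/-- A connected Noetherian group with continuous left translations is irreducible. -/
theorem irreducibleSpace_of_connectedSpace {G : Type*} [Group G] [TopologicalSpace G]
    [NoetherianSpace G] [ConnectedSpace G] (hG : ∀ g : G, Continuous fun x => g * x) :
    IrreducibleSpace G := by
  let Z := irreducibleComponent (1 : G)
  have hZ : Z ∈ irreducibleComponents G := irreducibleComponent_mem_irreducibleComponents 1
  obtain ⟨o, ho, ⟨x, hx⟩, hoZ⟩ :=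
    NoetherianSpace.exists_isOpen_nonempty_subset_irreducibleComponent Z hZ
  have hZc : IsClosed Z := isClosed_of_mem_irreducibleComponents Z hZ
  have hZo : IsOpen Z := by
    rw [isOpen_iff_mem_nhds]
    intro z hz
    let h := fun y => (z * x⁻¹)⁻¹ * y
    have hop : IsOpen (h ⁻¹' o) := ho.preimage (hG _)
    have hzo : z ∈ h ⁻¹' o := by simpa [h] using hx
    have hcl : IsClosed (h ⁻¹' Z) := hZc.preimage (hG _)
    -- The nonempty open part `h ⁻¹' o` of `Z` is dense in `Z`, so `Z` lies in the closed translate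
    -- `h ⁻¹' Z`. The translate is irreducible, so maximality gives equality and `Z` contains a
    -- neighbourhood of `z`.
    have hsub : Z ⊆ h ⁻¹' Z :=
      (subset_closure_inter_of_isPreirreducible_of_isOpen hZ.1.2 hop ⟨z, hz, hzo⟩).trans
        (closure_minimal (fun y hy => hoZ hy.2) hcl)
    have him : h ⁻¹' Z = (fun y => (z * x⁻¹) * y) '' Z := by
      ext y
      refine ⟨fun hy => ⟨h y, hy, by simp [h, mul_assoc]⟩, ?_⟩
      rintro ⟨w, hw, rfl⟩
      simpa [h, mul_assoc] using hw
    have hirr : IsIrreducible (h ⁻¹' Z) := by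
      rw [him]
      exact hZ.1.image _ (hG _).continuousOn
    have heq := hZ.2 hirr hsub
    exact Filter.mem_of_superset (hop.mem_nhds hzo) fun y hy => heq (hoZ hy)
  have huniv : Z = Set.univ := IsClopen.eq_univ ⟨hZc, hZo⟩ hZ.1.1
  have := isIrreducible_iff_irreducibleSpace.1 hZ.1
  exact { isPreirreducible_univ := huniv ▸ hZ.1.2, toNonempty := ⟨1⟩ }

end Irreducibility

/-! ### From the Zariski topology to vanishing ideals of matrix groups. -/

section Zariski

open TopologicalSpace

variable (K : Type*) [Field K] (V : Type*) [AddCommGroup V] [Module K V] [FiniteDimensional K V]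

/-- The prime ideal of the polynomials that vanish at a point. -/
def vanishingPrime (F : Type*) [Field F] [Algebra F (AlgebraicClosure K)] (g : GeometricGL K V) :
    PrimeSpectrum (MvPolynomial (Fin (Module.finrank K V) × Fin (Module.finrank K V)) F) :=
  ⟨RingHom.ker (MvPolynomial.aeval (R := F) (matrixEntry K V g)), RingHom.ker_isPrime _⟩

/-- Basic opens of the spectrum pull back to the defining open sets. Through this map the Zariski
topology inherits Noetherianity and a basis of principal open sets. -/
theorem isInducing_vanishingPrime (F : Type*) [Field F] [Algebra F (AlgebraicClosure K)] :
    @Topology.IsInducing _ _ (zariskiTopology K V F) _ (vanishingPrime K V F) := by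
  let _ := zariskiTopology K V F
  refine ⟨?_⟩
  rw [PrimeSpectrum.isTopologicalBasis_basic_opens.eq_generateFrom, induced_generateFrom_eq]
  change zariskiTopology K V F = _
  unfold zariskiTopology
  congr 1
  ext U
  simp only [Set.mem_ofPred_eq, Set.mem_image, Set.mem_range, exists_exists_eq_and]
  refine exists_congr fun p => ?_
  rw [eq_comm]
  rfl

variable {K V}

theorem exists_polynomial_of_isClosed {F : Type*} [Field F] [Algebra F (AlgebraicClosure K)]
    {S : Set (GeometricGL K V)} (hS : IsClosed[zariskiTopology K V F] S) {g : GeometricGL K V}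
    (hg : g ∉ S) :
    ∃ p : MvPolynomial (Fin (Module.finrank K V) × Fin (Module.finrank K V)) F,
      MvPolynomial.aeval (matrixEntry K V g) p ≠ 0 ∧
      ∀ h ∈ S, MvPolynomial.aeval (matrixEntry K V h) p = 0 := by
  let _ := zariskiTopology K V F
  have hb := PrimeSpectrum.isTopologicalBasis_basic_opens.isInducing
    (isInducing_vanishingPrime K V F)
  obtain ⟨_, ⟨_, ⟨p, rfl⟩, rfl⟩, hgp, hp⟩ :=
    hb.exists_subset_of_mem_open (show g ∈ Sᶜ from hg) hS.isOpen_compl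
  refine ⟨p, hgp, fun h hh => ?_⟩
  by_contra hne
  exact hp (show h ∈ _ from hne) hh

variable (K V) in
/-- The matrix group of `GL(V)(K̄)`. -/
def geometricGLEquiv : GeometricGL K V ≃*
    (Matrix (Fin (Module.finrank K V)) (Fin (Module.finrank K V)) (AlgebraicClosure K))ˣ :=
  Units.mapEquiv (LinearMap.toMatrixAlgEquiv
    ((Module.finBasis K V).baseChange (AlgebraicClosure K))).toMulEquiv

theorem evalMatrix_geometricGLEquiv (F : Type*) [Field F] [Algebra F (AlgebraicClosure K)]
    (g : GeometricGL K V)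
    (p : MvPolynomial (Fin (Module.finrank K V) × Fin (Module.finrank K V)) F) :
    evalMatrix F (geometricGLEquiv K V g : Matrix _ _ (AlgebraicClosure K)) p =
      MvPolynomial.aeval (matrixEntry K V g) p := rfl

theorem continuous_mul_left_zariski (g : GeometricGL K V) :
    @Continuous _ _ (zariskiTopology K V (AlgebraicClosure K))
      (zariskiTopology K V (AlgebraicClosure K)) fun x => g * x := by
  let _ := zariskiTopology K V (AlgebraicClosure K)
  refine continuous_generateFrom_iff.2 ?_
  rintro _ ⟨p, rfl⟩
  refine isOpen_generateFrom_of_mem ⟨leftTranslate (geometricGLEquiv K V g :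
    Matrix _ _ (AlgebraicClosure K)) p, ?_⟩
  ext x
  simp only [Set.mem_preimage, Set.mem_ofPred_eq]
  rw [← evalMatrix_geometricGLEquiv, ← evalMatrix_geometricGLEquiv, evalMatrix_leftTranslate,
    map_mul, Units.val_mul]

namespace LinearAlgebraicSubgroup

variable [CharZero K] (𝔾 : LinearAlgebraicSubgroup K V)

/-- The matrices of the geometric points of a linear algebraic group. -/
def matrixGroup : Subgroup
    (Matrix (Fin (Module.finrank K V)) (Fin (Module.finrank K V)) (AlgebraicClosure K))ˣ :=
  𝔾.points.map (geometricGLEquiv K V).toMonoidHom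

theorem geometricGLEquiv_mem_matrixGroup {g : GeometricGL K V} :
    geometricGLEquiv K V g ∈ 𝔾.matrixGroup ↔ g ∈ 𝔾.points := by
  simp [matrixGroup]

theorem forall_mem_matrixGroup {p : (Matrix (Fin (Module.finrank K V)) (Fin (Module.finrank K V))
    (AlgebraicClosure K))ˣ → Prop} :
    (∀ g ∈ 𝔾.matrixGroup, p g) ↔ ∀ g ∈ 𝔾.points, p (geometricGLEquiv K V g) := by
  simp [matrixGroup]

theorem isClosedOver_matrixGroup : IsClosedOver K 𝔾.matrixGroup := by
  intro g hg
  obtain ⟨g, rfl⟩ := (geometricGLEquiv K V).surjective g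
  rw [geometricGLEquiv_mem_matrixGroup]
  by_contra hgS
  obtain ⟨p, hp, hpS⟩ := exists_polynomial_of_isClosed 𝔾.isClosed_points hgS
  exact hp (hg p ((𝔾.forall_mem_matrixGroup).2 hpS))

/-- The vanishing ideal of a connected group is prime. -/
theorem isPrime_groupIdeal (h𝔾 : 𝔾.IsConnected) : (groupIdeal 𝔾.matrixGroup).IsPrime := by
  let _ := zariskiTopology K V (AlgebraicClosure K)
  have : ConnectedSpace 𝔾.points := isConnected_iff_connectedSpace.1 h𝔾
  have : NoetherianSpace (GeometricGL K V) :=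
    (isInducing_vanishingPrime K V (AlgebraicClosure K)).noetherianSpace
  have : NoetherianSpace 𝔾.points := Topology.IsInducing.subtypeVal.noetherianSpace
  have hirr : IrreducibleSpace 𝔾.points := irreducibleSpace_of_connectedSpace fun g =>
    Continuous.subtype_mk ((continuous_mul_left_zariski (g : GeometricGL K V)).comp
      continuous_subtype_val) _
  have hpre : IsPreirreducible (𝔾.points : Set (GeometricGL K V)) :=
    isPreirreducible_iff_preirreducibleSpace.2 hirr.toPreirreducibleSpace
  have hopen : ∀ f : MvPolynomial _ (AlgebraicClosure K),
      IsOpen {g : GeometricGL K V | MvPolynomial.aeval (matrixEntry K V g) f ≠ 0} := fun f =>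
    isOpen_generateFrom_of_mem ⟨f, rfl⟩
  have hmem : ∀ f, f ∈ groupIdeal 𝔾.matrixGroup ↔
      ∀ g ∈ 𝔾.points, MvPolynomial.aeval (matrixEntry K V g) f = 0 := fun f => by
    rw [mem_groupIdeal, forall_mem_matrixGroup]
    rfl
  refine ⟨fun h => ?_, fun {f f'} hff => ?_⟩
  · have := (hmem 1).1 (h ▸ Submodule.mem_top) 1 (one_mem _)
    simp at this
  · by_contra! hcon
    simp only [hmem] at hcon
    push Not at hcon
    obtain ⟨⟨g, hg, hgf⟩, ⟨g', hg', hgf'⟩⟩ := hcon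
    obtain ⟨x, hx, hxf, hxf'⟩ := hpre _ _ (hopen f) (hopen f') ⟨g, hg, hgf⟩ ⟨g', hg', hgf'⟩
    have := (hmem _).1 hff x hx
    rw [map_mul] at this
    exact (mul_ne_zero hxf hxf') this

end LinearAlgebraicSubgroup

end Zariski

/-! ### Transport of the analytic results to `Module.End` along a normed model `E`. -/

section PadicModel

variable {p : ℕ} [Fact p.Prime] {V : Type*} [AddCommGroup V] [Module ℚ_[p] V]
  [FiniteDimensional ℚ_[p] V]
  {E : Type*} [NormedRing E] [NormedAlgebra ℚ_[p] E] [FiniteDimensional ℚ_[p] E] [CompleteSpace E]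
  (L : Module.End ℚ_[p] V ≃ₐ[ℚ_[p]] E)

/-- The topology of `Module.End ℚ_[p] V` is the one of the normed algebra. -/
def endModelHomeomorph : Module.End ℚ_[p] V ≃ₜ E where
  toEquiv := L.toEquiv
  continuous_toFun := by
    have : IsModuleTopology ℚ_[p] (Module.End ℚ_[p] V) := ⟨rfl⟩
    exact IsModuleTopology.continuous_of_linearMap L.toLinearMap
  continuous_invFun := by
    have : IsModuleTopology ℚ_[p] (Module.End ℚ_[p] V) := ⟨rfl⟩
    have : ContinuousAdd (Module.End ℚ_[p] V) := IsModuleTopology.toContinuousAdd ℚ_[p] _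
    have : IsTopologicalAddGroup (Module.End ℚ_[p] V) :=
      IsModuleTopology.topologicalAddGroup ℚ_[p] _
    exact LinearMap.continuous_of_finiteDimensional L.symm.toLinearMap

omit [FiniteDimensional ℚ_[p] V] [CompleteSpace E] in
theorem endModelHomeomorph_apply (f : Module.End ℚ_[p] V) :
    endModelHomeomorph L f = L f := rfl

omit [FiniteDimensional ℚ_[p] V] [FiniteDimensional ℚ_[p] E] [CompleteSpace E] in
theorem commute_endModel {f g : Module.End ℚ_[p] V} :
    Commute (L f) (L g) ↔ Commute f g :=
  ⟨fun h => by simpa using h.map L.symm, fun h => h.map L⟩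

/-- Coordinates on the normed algebra of endomorphisms. -/
def endModelMatrix :
    E ≃ₐ[ℚ_[p]] Matrix (Fin (Module.finrank ℚ_[p] V)) (Fin (Module.finrank ℚ_[p] V)) ℚ_[p] :=
  L.symm.trans (LinearMap.toMatrixAlgEquiv (Module.finBasis ℚ_[p] V))

theorem geometricMatrix_endModel (f : Module.End ℚ_[p] V) :
    geometricMatrix (AlgebraicClosure ℚ_[p]) (endModelMatrix L) (L f) =
      LinearMap.toMatrixAlgEquiv ((Module.finBasis ℚ_[p] V).baseChange (AlgebraicClosure ℚ_[p]))
        (Module.End.baseChangeHom ℚ_[p] (AlgebraicClosure ℚ_[p]) V f) := by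
  rw [geometricMatrix_apply, endModelMatrix, AlgEquiv.trans_apply, AlgEquiv.symm_apply_apply]
  ext i j
  change algebraMap _ _ (LinearMap.toMatrix _ _ f i j) =
    LinearMap.toMatrix _ _ (f.baseChange (AlgebraicClosure ℚ_[p])) i j
  rw [LinearMap.toMatrix_apply, LinearMap.toMatrix_apply, Module.Basis.baseChange_apply,
    LinearMap.baseChange_tmul, Module.Basis.baseChange_repr_tmul, Algebra.smul_def, mul_one]

omit [FiniteDimensional ℚ_[p] E] [CompleteSpace E] in
theorem exists_conj_endModel_eq_diagonal {u : Module.End ℚ_[p] V}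
    (hu : (LinearMap.charpoly u).Separable) :
    ∃ (Q : (Matrix (Fin (Module.finrank ℚ_[p] V)) (Fin (Module.finrank ℚ_[p] V))
      (AlgebraicClosure ℚ_[p]))ˣ) (d : Fin (Module.finrank ℚ_[p] V) → AlgebraicClosure ℚ_[p]),
      Function.Injective d ∧ (conjAlgHom (K := ℚ_[p]) Q).comp
        (geometricMatrix (AlgebraicClosure ℚ_[p]) (endModelMatrix L)) (L u) =
          Matrix.diagonal d := by
  have h : ((geometricMatrix (AlgebraicClosure ℚ_[p]) (endModelMatrix L)) (L u)).charpoly.Separable := by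
    rw [geometricMatrix_apply, Matrix.charpoly_map, endModelMatrix, AlgEquiv.trans_apply,
      AlgEquiv.symm_apply_apply]
    have := LinearMap.charpoly_toMatrix u (Module.finBasis ℚ_[p] V)
    change (LinearMap.toMatrixAlgEquiv (Module.finBasis ℚ_[p] V) u).charpoly = _ at this
    rw [this]
    exact hu.map
  exact Matrix.exists_conj_eq_diagonal _ h

include L in
theorem commute_of_separable_charpoly {u : Module.End ℚ_[p] V}
    (hu : (LinearMap.charpoly u).Separable) {a b : Module.End ℚ_[p] V} (ha : Commute a u)
    (hb : Commute b u) : Commute a b := by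
  obtain ⟨Q, d, hd, h⟩ := exists_conj_endModel_eq_diagonal L hu
  rw [← commute_endModel L] at ha hb ⊢
  exact commute_of_commute_of_commute conj_geometricMatrix_injective hd h ha hb

include L in
theorem eq_zero_of_separable_charpoly {u : Module.End ℚ_[p] V}
    (hu : (LinearMap.charpoly u).Separable) {a : Module.End ℚ_[p] V} (ha : Commute a u)
    (h0 : a * a = 0) : a = 0 := by
  obtain ⟨Q, d, hd, h⟩ := exists_conj_endModel_eq_diagonal L hu
  rw [← commute_endModel L] at ha
  refine L.injective ?_
  rw [map_zero]
  exact eq_zero_of_commute_of_sq_eq_zero conj_geometricMatrix_injective hd h ha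
    (by rw [← map_mul, h0, map_zero])

include L in
/-- A connected group has rational points close to the identity with the same centralizer as a
given regular rational point. -/
theorem LinearAlgebraicSubgroup.frequently_mem_rationalPoints
    {𝔾 : LinearAlgebraicSubgroup ℚ_[p] V} (h𝔾 : 𝔾.IsConnected)
    {u : LinearMap.GeneralLinearGroup ℚ_[p] V} (hu : u ∈ 𝔾.rationalPoints)
    (hsep : (LinearMap.charpoly (u : Module.End ℚ_[p] V)).Separable) :
    ∃ᶠ x in 𝓝 (1 : Module.End ℚ_[p] V), ∃ g ∈ 𝔾.rationalPoints, (g : Module.End ℚ_[p] V) = x ∧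
      ∀ a, Commute a x ↔ Commute a (u : Module.End ℚ_[p] V) := by
  obtain ⟨Q, d, hd, h⟩ := exists_conj_endModel_eq_diagonal L hsep
  have huΓ : geometricMatrix (AlgebraicClosure ℚ_[p]) (endModelMatrix L) (L u) ∈
      matricesOf 𝔾.matrixGroup := by
    refine ⟨geometricGLEquiv ℚ_[p] V (toGeometricGL ℚ_[p] V u),
      𝔾.geometricGLEquiv_mem_matrixGroup.2 hu, ?_⟩
    rw [geometricMatrix_endModel]
    rfl
  have key := frequently_commute_iff (Padic.expSeries_radius_pos p _) (𝔾.isPrime_groupIdeal h𝔾)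
    𝔾.isClosedOver_matrixGroup hd h huΓ
  have hone : endModelHomeomorph L 1 = 1 := map_one L
  rw [← hone, ← (endModelHomeomorph L).map_nhds_eq, Filter.frequently_map] at key
  refine key.mono ?_
  rintro f ⟨hf, hcomm⟩
  rw [endModelHomeomorph_apply] at hf hcomm
  have hunit : IsUnit f := by
    simpa using (isUnit_of_isUnit_geometricMatrix _ (isUnit_of_mem_matricesOf hf)).map
      L.symm
  refine ⟨hunit.unit, ?_, rfl, fun a => ?_⟩
  · obtain ⟨γ, hγ, hγf⟩ := hf
    change toGeometricGL ℚ_[p] V hunit.unit ∈ 𝔾.points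
    rw [← 𝔾.geometricGLEquiv_mem_matrixGroup]
    convert! hγ using 1
    refine Units.ext ?_
    rw [hγf, geometricMatrix_endModel]
    rfl
  · rw [← commute_endModel L, hcomm, commute_endModel L]

include L in
/-- An endomorphism close to one with commutative and reduced centralizer is conjugate, by an
automorphism close to the identity, to one with the same centralizer. -/
theorem eventually_exists_conj_end {x : Module.End ℚ_[p] V}
    (hcomm : ∀ a b : Module.End ℚ_[p] V, Commute a x → Commute b x → Commute a b)
    (hred : ∀ a : Module.End ℚ_[p] V, Commute a x → a * a = 0 → a = 0)
    {U : Set (Module.End ℚ_[p] V)} (hU : U ∈ 𝓝 (1 : Module.End ℚ_[p] V)) :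
    ∀ᶠ y in 𝓝 x, ∃ g : (Module.End ℚ_[p] V)ˣ, (g : Module.End ℚ_[p] V) ∈ U ∧
      (↑g⁻¹ : Module.End ℚ_[p] V) ∈ U ∧ ∃ b : Module.End ℚ_[p] V, y = g * b * ↑g⁻¹ ∧
      ∀ a, Commute a b ↔ Commute a x := by
  have hone : endModelHomeomorph L 1 = 1 := map_one L
  have hU' : (endModelHomeomorph L).symm ⁻¹' U ∈ 𝓝 1 := by
    refine (endModelHomeomorph L).symm.continuous.continuousAt.preimage_mem_nhds ?_
    rwa [← hone, Homeomorph.symm_apply_apply]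
  have key := eventually_exists_conj ℚ_[p] (x := L x)
    (fun a b ha hb => by
      obtain ⟨a, rfl⟩ := L.surjective a
      obtain ⟨b, rfl⟩ := L.surjective b
      rw [commute_endModel L] at *
      exact hcomm a b ha hb)
    (fun a ha h0 => by
      obtain ⟨a, rfl⟩ := L.surjective a
      rw [commute_endModel L] at ha
      rw [hred a ha (L.injective (by rw [map_mul, h0, map_zero])), map_zero]) hU'
  rw [← endModelHomeomorph_apply, ← (endModelHomeomorph L).map_nhds_eq, Filter.eventually_map] at key
  filter_upwards [key] with y hy
  obtain ⟨g, hg, hg', b, hb, hcb⟩ := hy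
  refine ⟨Units.mapEquiv L.symm.toMulEquiv g, hg, hg', L.symm b,
    ?_, fun a => ?_⟩
  · refine L.injective ?_
    rw [← endModelHomeomorph_apply, hb, map_mul, map_mul, AlgEquiv.apply_symm_apply]
    change _ = L (L.symm g) * b * L (L.symm ↑g⁻¹)
    rw [AlgEquiv.apply_symm_apply, AlgEquiv.apply_symm_apply]
  · rw [← commute_endModel L, AlgEquiv.apply_symm_apply, hcb, endModelHomeomorph_apply,
      commute_endModel L]

end PadicModel

section PadicModel

variable {p : ℕ} [Fact p.Prime] (V : Type*) [AddCommGroup V] [Module ℚ_[p] V]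
  [FiniteDimensional ℚ_[p] V]

/-- The algebra of endomorphisms of `V` as a normed algebra. -/
def endModel : Module.End ℚ_[p] V ≃ₐ[ℚ_[p]]
    ((Fin (Module.finrank ℚ_[p] V) → ℚ_[p]) →L[ℚ_[p]] (Fin (Module.finrank ℚ_[p] V) → ℚ_[p])) :=
  (LinearMap.toMatrixAlgEquiv (Module.finBasis ℚ_[p] V)).trans
    (Matrix.toLinAlgEquiv'.trans (Module.End.toContinuousLinearMap _))

instance : FiniteDimensional ℚ_[p]
    ((Fin (Module.finrank ℚ_[p] V) → ℚ_[p]) →L[ℚ_[p]] (Fin (Module.finrank ℚ_[p] V) → ℚ_[p])) :=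
  Module.Finite.equiv (endModel (p := p) V).toLinearEquiv

/-- The algebra of endomorphisms of `V` can be normed. -/
theorem exists_normedAlgebra_equiv_end : ∃ (E : Type) (_ : NormedRing E) (_ : NormedAlgebra ℚ_[p] E)
    (_ : FiniteDimensional ℚ_[p] E) (_ : CompleteSpace E),
    Nonempty (Module.End ℚ_[p] V ≃ₐ[ℚ_[p]] E) :=
  ⟨_, _, _, inferInstance, inferInstance, ⟨endModel V⟩⟩

end PadicModel

/-! ### The `p`-adic topology on endomorphisms and automorphisms. -/

section EndTopology

variable {p : ℕ} [Fact p.Prime] {V : Type*} [AddCommGroup V] [Module ℚ_[p] V]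

instance : IsModuleTopology ℚ_[p] (Module.End ℚ_[p] V) := ⟨rfl⟩

instance : ContinuousAdd (Module.End ℚ_[p] V) := IsModuleTopology.toContinuousAdd ℚ_[p] _

instance : IsTopologicalAddGroup (Module.End ℚ_[p] V) :=
  IsModuleTopology.topologicalAddGroup ℚ_[p] _

variable [FiniteDimensional ℚ_[p] V]

instance : IsTopologicalRing (Module.End ℚ_[p] V) := IsModuleTopology.isTopologicalRing ℚ_[p] _

instance : T2Space (Module.End ℚ_[p] V) := by
  obtain ⟨E, _, _, _, _, ⟨L⟩⟩ := exists_normedAlgebra_equiv_end (p := p) V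
  exact (endModelHomeomorph L).symm.t2Space

/-- Inversion is continuous at units of the normed model, so the unit topology, which also records
inverses, is the subspace topology. -/
theorem isEmbedding_val_generalLinearGroup : Topology.IsEmbedding
    (Units.val : LinearMap.GeneralLinearGroup ℚ_[p] V → Module.End ℚ_[p] V) := by
  obtain ⟨E, _, _, _, _, ⟨L⟩⟩ := exists_normedAlgebra_equiv_end (p := p) V
  let h := endModelHomeomorph L
  refine Units.isEmbedding_val_mk' (f := fun f => h.symm (Ring.inverse (h f))) ?_ fun u => ?_
  · intro f hf
    have hf' : IsUnit (h f) := IsUnit.map L hf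
    refine ContinuousAt.continuousWithinAt (h.symm.continuous.continuousAt.comp ?_)
    obtain ⟨v, hv⟩ := hf'
    refine ContinuousAt.comp (f := h) (g := Ring.inverse) ?_ h.continuous.continuousAt
    rw [← hv]
    exact NormedRing.inverse_continuousAt v
  · have : h u = ((Units.mapEquiv L.toMulEquiv u : Eˣ) : E) := rfl
    rw [this, Ring.inverse_unit, Homeomorph.symm_apply_eq]
    rfl

end EndTopology

/-! ### Lattices as unit balls, and powers of endomorphisms congruent to 1. -/

section Lattice

variable {p : ℕ} [Fact p.Prime] {V : Type*} [AddCommGroup V] [Module ℚ_[p] V]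
  [Module ℤ_[p] V] [IsScalarTower ℤ_[p] ℚ_[p] V]
  (T : Submodule ℤ_[p] V) [Submodule.IsLattice ℚ_[p] T]

/-- A lattice is the unit ball of a suitable basis. -/
theorem exists_basis_mem_iff_norm_le :
    ∃ (ι : Type) (_ : Fintype ι) (b : Module.Basis ι ℚ_[p] V),
      ∀ x : V, x ∈ T ↔ ∀ i, ‖b.repr x i‖ ≤ 1 := by
  obtain ⟨m, b₀⟩ := Module.basisOfFiniteTypeTorsionFree' (R := ℤ_[p]) (M := T)
  refine ⟨Fin m, inferInstance, b₀.extendOfIsLattice ℚ_[p], fun x => ⟨fun hx i => ?_, fun hx => ?_⟩⟩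
  · have h1 : x = ∑ j, algebraMap ℤ_[p] ℚ_[p] (b₀.repr ⟨x, hx⟩ j) • b₀.extendOfIsLattice ℚ_[p] j := by
      have h2 := congrArg (Submodule.subtype T) (b₀.sum_repr ⟨x, hx⟩)
      rw [map_sum] at h2
      change _ = x at h2
      conv_lhs => rw [← h2]
      refine Finset.sum_congr rfl fun j _ => ?_
      rw [Module.Basis.extendOfIsLattice_apply, map_smul, Submodule.subtype_apply]
      exact (algebraMap_smul ℚ_[p] (b₀.repr ⟨x, hx⟩ j) (b₀ j : V)).symm
    rw [h1, Module.Basis.repr_sum_self]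
    exact PadicInt.norm_le_one _
  · rw [← (b₀.extendOfIsLattice ℚ_[p]).sum_repr x]
    refine Submodule.sum_mem _ fun j _ => ?_
    rw [Module.Basis.extendOfIsLattice_apply]
    let r : ℤ_[p] := ⟨(b₀.extendOfIsLattice ℚ_[p]).repr x j, hx j⟩
    change algebraMap ℤ_[p] ℚ_[p] r • (b₀ j : V) ∈ T
    rw [algebraMap_smul]
    exact Submodule.smul_mem _ _ (b₀ j).2

end Lattice

section LatticeEnd

variable {p : ℕ} [Fact p.Prime] {V : Type*} [AddCommGroup V] [Module ℚ_[p] V]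
  [Module ℤ_[p] V] [IsScalarTower ℤ_[p] ℚ_[p] V]
  (T : Submodule ℤ_[p] V)

theorem mem_latticeEnd {f : Module.End ℚ_[p] V} : f ∈ latticeEnd T ↔ ∀ x ∈ T, f x ∈ T := Iff.rfl

theorem smul_mem_of_norm_le {T : Submodule ℤ_[p] V} {c : ℚ_[p]} (hc : ‖c‖ ≤ 1) {x : V}
    (hx : x ∈ T) : c • x ∈ T := by
  let r : ℤ_[p] := ⟨c, hc⟩
  change algebraMap ℤ_[p] ℚ_[p] r • x ∈ T
  rw [algebraMap_smul]
  exact T.smul_mem _ hx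

variable [Submodule.IsLattice ℚ_[p] T]

/-- The endomorphisms of a lattice are the unit ball in suitable coordinates. -/
theorem exists_linearEquiv_mem_latticeEnd_iff :
    ∃ (ι : Type) (_ : Fintype ι) (φ : Module.End ℚ_[p] V ≃ₗ[ℚ_[p]] (ι → ι → ℚ_[p])),
      ∀ f, f ∈ latticeEnd T ↔ ∀ i j, ‖φ f i j‖ ≤ 1 := by
  classical
  obtain ⟨ι, _, b, hb⟩ := exists_basis_mem_iff_norm_le T
  refine ⟨ι, inferInstance, (LinearMap.toMatrix b b).trans (Matrix.ofLinearEquiv ℚ_[p]).symm,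
    fun f => ?_⟩
  have hφ : ∀ i j, ((LinearMap.toMatrix b b).trans (Matrix.ofLinearEquiv ℚ_[p]).symm) f i j =
      b.repr (f (b j)) i := fun i j => LinearMap.toMatrix_apply b b f i j
  simp only [hφ]
  rw [mem_latticeEnd]
  refine ⟨fun h i j => (hb _).1 (h (b j) ((hb _).2 fun i => ?_)) i, fun h x hx => ?_⟩
  · rw [b.repr_self, Finsupp.single_apply]
    split_ifs <;> simp
  · rw [← b.sum_repr x, map_sum]
    refine Submodule.sum_mem _ fun j _ => ?_
    rw [map_smul]
    exact smul_mem_of_norm_le ((hb x).1 hx j) ((hb _).2 fun i => h i j)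

theorem latticeEnd_mem_nhds_zero : (latticeEnd T : Set (Module.End ℚ_[p] V)) ∈ 𝓝 0 := by
  obtain ⟨ι, _, φ, hφ⟩ := exists_linearEquiv_mem_latticeEnd_iff T
  have hc : Continuous φ := IsModuleTopology.continuous_of_linearMap φ.toLinearMap
  have h1 : ∀ᶠ f in 𝓝 (0 : Module.End ℚ_[p] V), ∀ i j, ‖φ f i j‖ < 1 := by
    refine Filter.eventually_all.2 fun i => Filter.eventually_all.2 fun j => ?_
    have h2 : Continuous fun f => ‖φ f i j‖ :=
      continuous_norm.comp ((continuous_apply j).comp ((continuous_apply i).comp hc))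
    exact h2.continuousAt.eventually_lt continuousAt_const (by simp)
  filter_upwards [h1] with f hf using (hφ f).2 fun i j => (hf i j).le

theorem setOf_smul_sub_one_mem_latticeEnd_mem_nhds (c : ℚ_[p]) :
    {f | c • (f - 1) ∈ latticeEnd T} ∈ 𝓝 (1 : Module.End ℚ_[p] V) := by
  have h : Continuous fun f : Module.End ℚ_[p] V => c • (f - 1) := by fun_prop
  refine h.continuousAt.preimage_mem_nhds ?_
  simpa using latticeEnd_mem_nhds_zero T

theorem latticeEnd_mem_nhds_one : (latticeEnd T : Set (Module.End ℚ_[p] V)) ∈ 𝓝 1 := by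
  filter_upwards [setOf_smul_sub_one_mem_latticeEnd_mem_nhds T 1] with f hf
  have : (1 : ℚ_[p]) • (f - 1) ∈ latticeEnd T := hf
  rw [one_smul] at this
  simpa using add_mem this (one_mem (latticeEnd T))

theorem exists_pow_smul_mem_latticeEnd (f : Module.End ℚ_[p] V) :
    ∃ N : ℕ, (p : ℚ_[p]) ^ N • f ∈ latticeEnd T := by
  have h : Filter.Tendsto (fun N : ℕ => (p : ℚ_[p]) ^ N • f) Filter.atTop (𝓝 0) := by
    have := (tendsto_pow_atTop_nhds_zero_of_norm_lt_one (Padic.norm_p_lt_one (p := p))).smul_const f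
    rwa [zero_smul] at this
  exact (h.eventually (latticeEnd_mem_nhds_zero T)).exists

theorem tendsto_pow_smul_of_mem_latticeEnd {a : ℕ → Module.End ℚ_[p] V}
    (ha : ∀ j, a j ∈ latticeEnd T) :
    Filter.Tendsto (fun j => (p : ℚ_[p]) ^ j • a j) Filter.atTop (𝓝 0) := by
  obtain ⟨ι, _, φ, hφ⟩ := exists_linearEquiv_mem_latticeEnd_iff T
  have hc : Continuous φ.symm := IsModuleTopology.continuous_of_linearMap φ.symm.toLinearMap
  have h1 : Filter.Tendsto (fun j => φ ((p : ℚ_[p]) ^ j • a j)) Filter.atTop (𝓝 0) := by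
    rw [tendsto_pi_nhds]
    intro i
    rw [tendsto_pi_nhds]
    intro l
    have h2 := (tendsto_pow_atTop_nhds_zero_of_norm_lt_one (Padic.norm_p_lt_one (p := p))).norm
    rw [norm_zero] at h2
    refine squeeze_zero_norm (fun j => ?_) h2
    rw [map_smul, Pi.smul_apply, Pi.smul_apply, smul_eq_mul, norm_mul]
    exact mul_le_of_le_one_right (norm_nonneg _) ((hφ _).1 (ha j) i l)
  have h3 := (hc.tendsto 0).comp h1
  rw [map_zero] at h3
  exact h3.congr fun j => φ.symm_apply_apply _

variable {T}

omit [Submodule.IsLattice ℚ_[p] T] in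
/-- High powers of an element congruent to the identity are close to the identity. -/
theorem exists_pow_pow_eq_one_add {x : Module.End ℚ_[p] V}
    (hx : (p : ℚ_[p])⁻¹ • (x - 1) ∈ latticeEnd T) (j : ℕ) :
    ∃ a ∈ latticeEnd T, x ^ p ^ j = 1 + (p : ℚ_[p]) ^ j • a := by
  have hp : (p : ℚ_[p]) ≠ 0 := by exact_mod_cast (Fact.out : p.Prime).ne_zero
  set t := (p : ℚ_[p])⁻¹ • (x - 1) with ht
  have hx1 : x = 1 + (p : ℚ_[p]) • t := by rw [ht, smul_inv_smul₀ hp]; abel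
  -- In `ℤ[X]`, the congruence `1 + p X ≡ 1` modulo `p` raises to `(1 + p X) ^ p ^ j ≡ 1` modulo `p
  -- ^ (j + 1)`. Evaluation at `t` keeps the quotient in the order, and the spare factor `p` is
  -- absorbed into `a`.
  have h1 : ((p : Polynomial ℤ)) ∣ (1 + (p : Polynomial ℤ) * Polynomial.X) - 1 :=
    ⟨Polynomial.X, by ring⟩
  obtain ⟨q, hq⟩ := dvd_sub_pow_of_dvd_sub h1 j
  have h2 := congrArg (Polynomial.aeval t) hq
  simp only [map_sub, map_pow, map_add, map_mul, map_one, map_natCast, Polynomial.aeval_X,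
    one_pow] at h2
  have hq' : Polynomial.aeval t q ∈ latticeEnd T := by
    rw [Polynomial.aeval_eq_sum_range]
    exact sum_mem fun i _ => zsmul_mem (pow_mem hx i) _
  have hcast : ∀ (m : ℕ) (f : Module.End ℚ_[p] V), (m : Module.End ℚ_[p] V) * f = (m : ℚ_[p]) • f :=
    fun m f => by rw [← nsmul_eq_mul, Nat.cast_smul_eq_nsmul]
  refine ⟨(p : ℚ_[p]) • Polynomial.aeval t q, ?_, ?_⟩
  · rw [Nat.cast_smul_eq_nsmul]
    exact nsmul_mem hq' _
  · rw [smul_smul, ← pow_succ, ← Nat.cast_pow, ← hcast, Nat.cast_pow, ← h2, hcast, ← hx1]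
    abel

/-- If `x` is congruent to the identity, then `x ^ m` tends to the identity as `m` becomes more
and more divisible by `p`. -/
theorem tendsto_pow_one {x : Module.End ℚ_[p] V}
    (hx : (p : ℚ_[p])⁻¹ • (x - 1) ∈ latticeEnd T) {m : ℕ → ℕ} (hm : ∀ j, p ^ j ∣ m j) :
    Filter.Tendsto (fun j => x ^ m j) Filter.atTop (𝓝 1) := by
  have h : ∀ j, ∃ a ∈ latticeEnd T, x ^ m j = 1 + (p : ℚ_[p]) ^ j • a := fun j => by
    obtain ⟨q, hq⟩ := hm j
    obtain ⟨a, ha, hxa⟩ := exists_pow_pow_eq_one_add hx j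
    rw [hq, pow_mul, hxa]
    clear hq
    induction q with
    | zero => exact ⟨0, zero_mem _, by simp⟩
    | succ q ih =>
      obtain ⟨b, hb, hxb⟩ := ih
      have hpa : (p : ℚ_[p]) ^ j • a ∈ latticeEnd T := by
        rw [← Nat.cast_pow, Nat.cast_smul_eq_nsmul]
        exact nsmul_mem ha _
      refine ⟨b + a + b * ((p : ℚ_[p]) ^ j • a), add_mem (add_mem hb ha) (mul_mem hb hpa), ?_⟩
      rw [pow_succ, hxb, add_mul, one_mul, mul_add, mul_one, smul_add, smul_add, smul_mul_assoc]
      abel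
  choose a ha hxa using h
  have := (tendsto_pow_smul_of_mem_latticeEnd T ha).const_add (1 : Module.End ℚ_[p] V)
  rw [add_zero] at this
  exact this.congr fun j => (hxa j).symm

end LatticeEnd

/-! ### Integral centralizers: conjugation, comparison and local constancy. -/

section CentralizerOrder

variable {p : ℕ} [Fact p.Prime] {V : Type*} [AddCommGroup V] [Module ℚ_[p] V]
  [Module ℤ_[p] V] [IsScalarTower ℤ_[p] ℚ_[p] V]
  {T : Submodule ℤ_[p] V}

theorem mem_centralizerOrder {u f : Module.End ℚ_[p] V} :
    f ∈ centralizerOrder T u ↔ f ∈ latticeEnd T ∧ Commute f u := by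
  rw [centralizerOrder, Algebra.mem_inf, Subalgebra.mem_centralizer_iff]
  simp only [Set.mem_singleton_iff, forall_eq]
  rw [eq_comm]
  rfl

theorem centralizerOrder_congr {x y : Module.End ℚ_[p] V}
    (h : ∀ a, Commute a x ↔ Commute a y) : centralizerOrder T x = centralizerOrder T y := by
  ext f
  rw [mem_centralizerOrder, mem_centralizerOrder, h]

theorem conj_mem_centralizerOrder {g : (Module.End ℚ_[p] V)ˣ}
    (hg : (g : Module.End ℚ_[p] V) ∈ latticeEnd T)
    (hg' : (↑g⁻¹ : Module.End ℚ_[p] V) ∈ latticeEnd T) {b f : Module.End ℚ_[p] V}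
    (hf : f ∈ centralizerOrder T b) : ↑g * f * ↑g⁻¹ ∈ centralizerOrder T (↑g * b * ↑g⁻¹) := by
  rw [mem_centralizerOrder] at hf ⊢
  refine ⟨mul_mem (mul_mem hg hf.1) hg', ?_⟩
  have := hf.2.eq
  change ↑g * f * ↑g⁻¹ * (↑g * b * ↑g⁻¹) = ↑g * b * ↑g⁻¹ * (↑g * f * ↑g⁻¹)
  simp only [mul_assoc, Units.inv_mul_cancel_left]
  rw [← mul_assoc f, this, mul_assoc]

/-- Conjugation by an automorphism of the lattice. -/
def centralizerOrderConj (g : (Module.End ℚ_[p] V)ˣ)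
    (hg : (g : Module.End ℚ_[p] V) ∈ latticeEnd T)
    (hg' : (↑g⁻¹ : Module.End ℚ_[p] V) ∈ latticeEnd T) (b : Module.End ℚ_[p] V) :
    centralizerOrder T b ≃ₐ[ℤ_[p]] centralizerOrder T (↑g * b * ↑g⁻¹) where
  toFun f := ⟨↑g * f * ↑g⁻¹, conj_mem_centralizerOrder hg hg' f.2⟩
  invFun f := ⟨↑g⁻¹ * f * ↑g, by
    have := conj_mem_centralizerOrder (g := g⁻¹) hg' (by simpa using hg) f.2
    simpa [mul_assoc] using this⟩
  left_inv f := Subtype.ext (by simp [mul_assoc])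
  right_inv f := Subtype.ext (by simp [mul_assoc])
  map_mul' f f' := Subtype.ext (by simp [mul_assoc])
  map_add' f f' := Subtype.ext (by simp [mul_add, add_mul])
  commutes' c := Subtype.ext (by
    change ↑g * algebraMap ℤ_[p] (Module.End ℚ_[p] V) c * ↑g⁻¹ = algebraMap ℤ_[p] _ c
    rw [← Algebra.commutes, mul_assoc, Units.mul_inv, mul_one])

variable [Submodule.IsLattice ℚ_[p] T]

theorem exists_pow_smul_mem_centralizerOrder {x f : Module.End ℚ_[p] V} (hf : Commute f x) :
    ∃ N : ℕ, (p : ℚ_[p]) ^ N • f ∈ centralizerOrder T x := by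
  obtain ⟨N, hN⟩ := exists_pow_smul_mem_latticeEnd T f
  exact ⟨N, mem_centralizerOrder.2 ⟨hN, hf.smul_left _⟩⟩

/-- Every element of the full centralizer enters the integral one after scaling by a power of `p`,
so commutativity passes through the isomorphism of orders. Reducedness is transferred the same way
below. -/
theorem commute_of_centralizerOrder_equiv {x u : Module.End ℚ_[p] V}
    (e : centralizerOrder T x ≃ₐ[ℤ_[p]] centralizerOrder T u)
    (hu : ∀ a b : Module.End ℚ_[p] V, Commute a u → Commute b u → Commute a b)
    {a b : Module.End ℚ_[p] V} (ha : Commute a x) (hb : Commute b x) : Commute a b := by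
  have hp : (p : ℚ_[p]) ≠ 0 := by exact_mod_cast (Fact.out : p.Prime).ne_zero
  obtain ⟨N, hN⟩ := exists_pow_smul_mem_centralizerOrder (T := T) ha
  obtain ⟨M, hM⟩ := exists_pow_smul_mem_centralizerOrder (T := T) hb
  have h1 : (⟨_, hN⟩ : centralizerOrder T x) * ⟨_, hM⟩ = ⟨_, hM⟩ * ⟨_, hN⟩ := by
    apply e.injective
    rw [map_mul, map_mul]
    exact Subtype.ext (hu _ _ (mem_centralizerOrder.1 (e ⟨_, hN⟩).2).2
      (mem_centralizerOrder.1 (e ⟨_, hM⟩).2).2)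
  have h2 : Commute ((p : ℚ_[p]) ^ N • a) ((p : ℚ_[p]) ^ M • b) := congrArg Subtype.val h1
  have h3 := (h2.smul_left ((p : ℚ_[p]) ^ N)⁻¹).smul_right ((p : ℚ_[p]) ^ M)⁻¹
  rwa [inv_smul_smul₀ (pow_ne_zero _ hp), inv_smul_smul₀ (pow_ne_zero _ hp)] at h3

theorem eq_zero_of_centralizerOrder_equiv {x u : Module.End ℚ_[p] V}
    (e : centralizerOrder T x ≃ₐ[ℤ_[p]] centralizerOrder T u)
    (hu : ∀ a : Module.End ℚ_[p] V, Commute a u → a * a = 0 → a = 0)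
    {a : Module.End ℚ_[p] V} (ha : Commute a x) (h0 : a * a = 0) : a = 0 := by
  have hp : (p : ℚ_[p]) ≠ 0 := by exact_mod_cast (Fact.out : p.Prime).ne_zero
  obtain ⟨N, hN⟩ := exists_pow_smul_mem_centralizerOrder (T := T) ha
  have h1 : (⟨_, hN⟩ : centralizerOrder T x) * ⟨_, hN⟩ = 0 :=
    Subtype.ext (by simp [h0])
  have h2 : e ⟨_, hN⟩ = 0 := by
    refine Subtype.ext (hu _ (mem_centralizerOrder.1 (e ⟨_, hN⟩).2).2 ?_)
    have h2 : e ⟨_, hN⟩ * e ⟨_, hN⟩ = 0 := by rw [← map_mul, h1, map_zero]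
    exact congrArg Subtype.val h2
  have h3 : (⟨_, hN⟩ : centralizerOrder T x) = 0 := e.injective (h2.trans (map_zero e).symm)
  have h4 : (p : ℚ_[p]) ^ N • a = 0 := congrArg Subtype.val h3
  exact (smul_eq_zero.1 h4).resolve_left (pow_ne_zero _ hp)

variable [FiniteDimensional ℚ_[p] V]

/-- Near an endomorphism whose integral centralizer is that of an endomorphism with commutative
and reduced centralizer, all integral centralizers are isomorphic. -/
theorem eventually_centralizerOrder_equiv {x u : Module.End ℚ_[p] V}
    (hsep : (LinearMap.charpoly u).Separable)
    (h : Nonempty (centralizerOrder T x ≃ₐ[ℤ_[p]] centralizerOrder T u)) :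
    ∀ᶠ y in 𝓝 x, Nonempty (centralizerOrder T y ≃ₐ[ℤ_[p]] centralizerOrder T u) := by
  obtain ⟨E, _, _, _, _, ⟨L⟩⟩ := exists_normedAlgebra_equiv_end (p := p) V
  obtain ⟨e⟩ := h
  have hcomm : ∀ a b : Module.End ℚ_[p] V, Commute a x → Commute b x → Commute a b :=
    fun a b => commute_of_centralizerOrder_equiv e fun a b =>
      commute_of_separable_charpoly L hsep
  have hred : ∀ a : Module.End ℚ_[p] V, Commute a x → a * a = 0 → a = 0 :=
    fun a => eq_zero_of_centralizerOrder_equiv e fun a => eq_zero_of_separable_charpoly L hsep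
  -- Taking `latticeEnd T` as the neighbourhood of 1 places both `g` and `g⁻¹` in it, so conjugation
  -- by `g` preserves integrality.
  filter_upwards [eventually_exists_conj_end L hcomm hred (latticeEnd_mem_nhds_one T)] with y hy
  obtain ⟨g, hg, hg', b, rfl, hb⟩ := hy
  exact ⟨(centralizerOrderConj g hg hg' b).symm.trans
    ((Subalgebra.equivOfEq _ _ (centralizerOrder_congr hb)).trans e)⟩

end CentralizerOrder

/-! ### Regular elements near 1 in an open subgroup. -/

section OpenImage

variable {p : ℕ} [Fact p.Prime] {V : Type*} [AddCommGroup V] [Module ℚ_[p] V]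
  [FiniteDimensional ℚ_[p] V]

/-- An open subgroup of the rational points of a connected group contains elements arbitrarily
close to the identity with the same centralizer as a given regular rational point. -/
theorem exists_mem_commute_iff {𝔾 : LinearAlgebraicSubgroup ℚ_[p] V} (h𝔾 : 𝔾.IsConnected)
    {u : LinearMap.GeneralLinearGroup ℚ_[p] V} (hu : u ∈ 𝔾.rationalPoints)
    (hsep : (LinearMap.charpoly (u : Module.End ℚ_[p] V)).Separable)
    {H : Subgroup (LinearMap.GeneralLinearGroup ℚ_[p] V)}
    (hH : IsOpen ((H.subgroupOf 𝔾.rationalPoints : Subgroup 𝔾.rationalPoints) :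
      Set 𝔾.rationalPoints)) {U : Set H} (hU : U ∈ 𝓝 1) :
    ∃ g ∈ U, ∀ a, Commute a ((g : LinearMap.GeneralLinearGroup ℚ_[p] V) : Module.End ℚ_[p] V) ↔
      Commute a (u : Module.End ℚ_[p] V) := by
  obtain ⟨E, _, _, _, _, ⟨L⟩⟩ := exists_normedAlgebra_equiv_end (p := p) V
  have hHn := hH.mem_nhds (one_mem (H.subgroupOf 𝔾.rationalPoints))
  rw [nhds_subtype_eq_comap, Filter.mem_comap] at hU hHn
  obtain ⟨U₁, hU₁, hU₁U⟩ := hU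
  obtain ⟨U₂, hU₂, hU₂H⟩ := hHn
  -- One neighbourhood of 1 in `End(V)` must force both membership in `H`, for rational points of
  -- `𝔾`, and membership in `U`.
  have h12 := Filter.inter_mem hU₁ hU₂
  simp only [OneMemClass.coe_one] at h12
  rw [isEmbedding_val_generalLinearGroup.isInducing.nhds_eq_comap, Filter.mem_comap] at h12
  obtain ⟨O, hO, hO12⟩ := h12
  rw [Units.val_one] at hO
  obtain ⟨x, ⟨g, hg, rfl, hcomm⟩, hx⟩ :=
    ((𝔾.frequently_mem_rationalPoints L h𝔾 hu hsep).and_eventually hO).exists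
  have hg12 := hO12 hx
  have hgH : g ∈ H := hU₂H (show (⟨g, hg⟩ : 𝔾.rationalPoints) ∈ _ from hg12.2)
  exact ⟨⟨g, hgH⟩, hU₁U hg12.1, hcomm⟩

end OpenImage

/-! ### Openness of the image in the product. -/

section ProductImage

variable {𝒢 : Type*} [Group 𝒢] [TopologicalSpace 𝒢] [IsTopologicalGroup 𝒢] [CompactSpace 𝒢]

omit [IsTopologicalGroup 𝒢] [CompactSpace 𝒢] in
theorem MonoidHom.continuous_rangeRestrict {H : Type*} [Group H] [TopologicalSpace H] {f : 𝒢 →* H}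
    (hf : Continuous f) : Continuous f.rangeRestrict :=
  Continuous.subtype_mk hf _

/-- A continuous homomorphism from a compact group is open onto its image. -/
theorem MonoidHom.isOpenMap_rangeRestrict {H : Type*} [Group H] [TopologicalSpace H] [T2Space H]
    {f : 𝒢 →* H} (hf : Continuous f) : IsOpenMap f.rangeRestrict := by
  have h := continuous_rangeRestrict hf
  have hq : Topology.IsQuotientMap f.rangeRestrict :=
    h.isClosedMap.isQuotientMap h f.rangeRestrict_surjective
  exact (MonoidHom.isOpenQuotientMap_of_isQuotientMap hq).isOpenMap

/-- Euler's theorem: a power of the product of the other primes, with exponent a multiple of `φ(ℓ ^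
j)`, is 1 modulo `ℓ ^ j`. -/
theorem exists_exponents (P : Finset ℕ) (hP : ∀ ℓ ∈ P, ℓ.Prime) {ℓ : ℕ} (hℓ : ℓ ∈ P) :
    ∃ m : ℕ → ℕ, (∀ j, m j ≡ 1 [MOD ℓ ^ j]) ∧ ∀ q ∈ P, q ≠ ℓ → ∀ j, q ^ j ∣ m j := by
  let N := ∏ q ∈ P.erase ℓ, q
  have hN : N.Coprime ℓ := Nat.Coprime.prod_left fun q hq => by
    rw [Finset.mem_erase] at hq
    exact (Nat.coprime_primes (hP q hq.2) (hP ℓ hℓ)).2 hq.1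
  refine ⟨fun j => (N ^ j) ^ (ℓ ^ j).totient, fun j => Nat.ModEq.pow_totient (hN.pow j j),
    fun q hq hqℓ j => ?_⟩
  have h1 : q ^ j ∣ N ^ j := pow_dvd_pow_of_dvd
    (Finset.dvd_prod_of_mem _ (Finset.mem_erase.2 ⟨hqℓ, hq⟩)) j
  refine h1.trans (dvd_pow_self _ ?_)
  exact (Nat.totient_pos.2 (pow_pos (hP ℓ hℓ).pos j)).ne'

variable {P : Finset ℕ} [∀ ℓ : P, Fact (Nat.Prime (ℓ : ℕ))]
  {V : P → Type*} [∀ ℓ, AddCommGroup (V ℓ)]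
  [∀ ℓ : P, Module ℚ_[(ℓ : ℕ)] (V ℓ)] [∀ ℓ : P, FiniteDimensional ℚ_[(ℓ : ℕ)] (V ℓ)]
  [∀ ℓ : P, Module ℤ_[(ℓ : ℕ)] (V ℓ)]
  [∀ ℓ : P, IsScalarTower ℤ_[(ℓ : ℕ)] ℚ_[(ℓ : ℕ)] (V ℓ)]
  {T : ∀ ℓ : P, Submodule ℤ_[(ℓ : ℕ)] (V ℓ)}
  (hT : ∀ ℓ : P, Submodule.IsLattice ℚ_[(ℓ : ℕ)] (T ℓ))
  {ρ : ∀ ℓ : P, 𝒢 →* LinearMap.GeneralLinearGroup ℚ_[(ℓ : ℕ)] (V ℓ)}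
  (hρ : ∀ ℓ, Continuous (ρ ℓ))

include hT hρ in
/-- The image of an element close to the identity can be modified to be trivial at all primes but
one. -/
theorem exists_eq_of_eq_and_eq_one {σ : 𝒢}
    (hσ : ∀ ℓ : P, ((ℓ : ℕ) : ℚ_[(ℓ : ℕ)])⁻¹ • ((ρ ℓ σ : Module.End ℚ_[(ℓ : ℕ)] (V ℓ)) - 1) ∈
      latticeEnd (T ℓ)) (ℓ : P) :
    ∃ τ : 𝒢, ρ ℓ τ = ρ ℓ σ ∧ ∀ q, q ≠ ℓ → ρ q τ = 1 := by
  obtain ⟨m, hm1, hm0⟩ := exists_exponents P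
    (fun q hq => (inferInstance : Fact (Nat.Prime ((⟨q, hq⟩ : P) : ℕ))).out) ℓ.2
  -- The powers `σ ^ m j` need not converge in `𝒢`; compactness supplies a limit along an
  -- ultrafilter, and its images are forced by the convergence of the matrix powers.
  let F : Ultrafilter ℕ := Ultrafilter.of Filter.atTop
  have hF : (F : Filter ℕ) ≤ Filter.atTop := Ultrafilter.of_le _
  obtain ⟨τ, -, hτ⟩ := isCompact_univ.ultrafilter_le_nhds (F.map fun j => σ ^ m j) (by simp)
  have hτ' : Filter.Tendsto (fun j => σ ^ m j) F (𝓝 τ) := hτ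
  have hlim : ∀ q : P, Filter.Tendsto (fun j => (ρ q σ : Module.End ℚ_[(q : ℕ)] (V q)) ^ m j) F
      (𝓝 (ρ q τ : Module.End ℚ_[(q : ℕ)] (V q))) := fun q => by
    have := ((Units.continuous_val.comp (hρ q)).tendsto τ).comp hτ'
    refine this.congr fun j => ?_
    simp
  refine ⟨τ, Units.ext ?_, fun q hq => Units.ext ?_⟩
  · have : Submodule.IsLattice ℚ_[(ℓ : ℕ)] (T ℓ) := hT ℓ
    -- The natural number `m j - 1` is a genuine predecessor unless `m j = 0`, which can only happen
    -- for `j = 0`, where the congruence is vacuous.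
    have h1 : ∀ j, ∃ r, m j = 1 + r ∧ (ℓ : ℕ) ^ j ∣ r ∨ m j = 0 ∧ r = 0 ∧ j = 0 := fun j => by
      by_cases h0 : m j = 0
      · refine ⟨0, Or.inr ⟨h0, rfl, ?_⟩⟩
        have := hm1 j
        rw [h0] at this
        by_contra hj
        have h2 := (Nat.modEq_zero_iff_dvd.1 this.symm)
        have h3 : (ℓ : ℕ) ^ j = 1 := Nat.dvd_one.1 h2
        rw [Nat.pow_eq_one] at h3
        exact h3.elim (Fact.out : Nat.Prime (ℓ : ℕ)).ne_one hj
      · refine ⟨m j - 1, Or.inl ⟨by omega, ?_⟩⟩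
        exact (Nat.modEq_iff_dvd' (by omega)).1 (hm1 j).symm
    choose r hr using h1
    have hr' : ∀ j, (ℓ : ℕ) ^ j ∣ r j := fun j => by
      rcases hr j with h | h
      · exact h.2
      · rw [h.2.1]; exact dvd_zero _
    have h2 := (tendsto_pow_one (hσ ℓ) hr').const_mul (ρ ℓ σ : Module.End ℚ_[(ℓ : ℕ)] (V ℓ))
    rw [mul_one] at h2
    refine tendsto_nhds_unique (hlim ℓ) ((h2.congr' ?_).mono_left hF)
    filter_upwards [Filter.eventually_ge_atTop 1] with j hj
    rcases hr j with h | h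
    · rw [h.1, pow_add, pow_one]
    · omega
  · have : Submodule.IsLattice ℚ_[(q : ℕ)] (T q) := hT q
    refine tendsto_nhds_unique (hlim q) ((tendsto_pow_one (hσ q) fun j => ?_).mono_left hF)
    exact hm0 q q.2 (fun h => hq (Subtype.ext h)) j

include hT hρ in
/-- Families of elements close to the identity have a common lift. -/
theorem exists_forall_eq {σ : P → 𝒢}
    (hσ : ∀ i ℓ : P, ((ℓ : ℕ) : ℚ_[(ℓ : ℕ)])⁻¹ •
      ((ρ ℓ (σ i) : Module.End ℚ_[(ℓ : ℕ)] (V ℓ)) - 1) ∈ latticeEnd (T ℓ)) :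
    ∃ τ : 𝒢, ∀ ℓ, ρ ℓ τ = ρ ℓ (σ ℓ) := by
  classical
  choose t ht ht1 using fun i => exists_eq_of_eq_and_eq_one hT hρ (hσ i) i
  have h : ∀ S : Finset P, ∃ τ : 𝒢, ∀ ℓ, ρ ℓ τ = if ℓ ∈ S then ρ ℓ (σ ℓ) else 1 := fun S => by
    induction S using Finset.induction_on with
    | empty => exact ⟨1, fun ℓ => by simp⟩
    | insert i S hi ih =>
      obtain ⟨τ, hτ⟩ := ih
      refine ⟨t i * τ, fun ℓ => ?_⟩
      rw [map_mul, hτ]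
      by_cases hℓ : ℓ = i
      · subst hℓ
        simp [ht, hi]
      · rw [ht1 i ℓ hℓ, one_mul]
        simp [hℓ]
  obtain ⟨τ, hτ⟩ := h Finset.univ
  exact ⟨τ, fun ℓ => by simpa using hτ ℓ⟩

include hT hρ in
/-- The image of a compact group in a product of `ℓ`-adic groups is open in the product of its
projections. -/
theorem isOpen_range_pi :
    IsOpen ((MonoidHom.pi fun ℓ => (ρ ℓ).rangeRestrict).range : Set (∀ ℓ : P, (ρ ℓ).range)) := by
  let W : Set 𝒢 := ⋂ ℓ : P, {σ | ((ℓ : ℕ) : ℚ_[(ℓ : ℕ)])⁻¹ •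
    ((ρ ℓ σ : Module.End ℚ_[(ℓ : ℕ)] (V ℓ)) - 1) ∈ latticeEnd (T ℓ)}
  have hW : W ∈ 𝓝 1 := by
    refine Filter.iInter_mem.2 fun ℓ => ?_
    have : Submodule.IsLattice ℚ_[(ℓ : ℕ)] (T ℓ) := hT ℓ
    have h : Filter.Tendsto (fun σ => (ρ ℓ σ : Module.End ℚ_[(ℓ : ℕ)] (V ℓ))) (𝓝 1) (𝓝 1) := by
      have h := (Units.continuous_val.comp (hρ ℓ)).tendsto 1
      rw [Function.comp_apply, map_one, Units.val_one] at h
      exact h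
    exact h (setOf_smul_sub_one_mem_latticeEnd_mem_nhds (T ℓ) ((ℓ : ℕ) : ℚ_[(ℓ : ℕ)])⁻¹)
  refine Subgroup.isOpen_of_mem_nhds _ (g := 1) ?_
  -- Each `ρ ℓ` is open onto its image, so the images of `W` form a box around 1; by
  -- `exists_forall_eq` every point of the box has a common lift.
  have h1 : Set.univ.pi (fun ℓ => (ρ ℓ).rangeRestrict '' W) ∈ 𝓝 (1 : ∀ ℓ : P, (ρ ℓ).range) := by
    refine set_pi_mem_nhds Set.finite_univ fun ℓ _ => ?_
    have := ((ρ ℓ).isOpenMap_rangeRestrict (hρ ℓ)).image_mem_nhds hW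
    rwa [map_one] at this
  refine Filter.mem_of_superset h1 fun g hg => ?_
  choose σ hσW hσ using fun ℓ => hg ℓ trivial
  obtain ⟨τ, hτ⟩ := exists_forall_eq hT hρ (σ := σ) fun i ℓ => Set.mem_iInter.1 (hσW i) ℓ
  exact ⟨τ, funext fun ℓ => by rw [← hσ ℓ]; exact Subtype.ext (hτ ℓ)⟩

end ProductImage

end

/-! ### Assembly of the theorem. -/

theorem mainTheorem8
    {𝒢 : Type*} [Group 𝒢] [TopologicalSpace 𝒢] [IsTopologicalGroup 𝒢]
    [CompactSpace 𝒢] [T2Space 𝒢] [TotallyDisconnectedSpace 𝒢]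
    (P : Finset ℕ) (hP : P.Nonempty) [∀ ℓ : P, Fact (Nat.Prime (ℓ : ℕ))]
    (V : P → Type*) [∀ ℓ, AddCommGroup (V ℓ)]
    [∀ ℓ : P, Module ℚ_[(ℓ : ℕ)] (V ℓ)] [∀ ℓ : P, FiniteDimensional ℚ_[(ℓ : ℕ)] (V ℓ)]
    [∀ ℓ, Nontrivial (V ℓ)]
    [∀ ℓ : P, Module ℤ_[(ℓ : ℕ)] (V ℓ)]
    [∀ ℓ : P, IsScalarTower ℤ_[(ℓ : ℕ)] ℚ_[(ℓ : ℕ)] (V ℓ)]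
    (T : ∀ ℓ : P, Submodule ℤ_[(ℓ : ℕ)] (V ℓ))
    (hT : ∀ ℓ : P, Submodule.IsLattice ℚ_[(ℓ : ℕ)] (T ℓ))
    (𝔾 : ∀ ℓ : P, LinearAlgebraicSubgroup ℚ_[(ℓ : ℕ)] (V ℓ))
    (h𝔾 : ∀ ℓ, (𝔾 ℓ).IsConnectedReductive)
    (hdim : ∀ ℓ, 0 < (𝔾 ℓ).dim)
    (u : ∀ ℓ : P, LinearMap.GeneralLinearGroup ℚ_[(ℓ : ℕ)] (V ℓ))
    (hu : ∀ ℓ, u ℓ ∈ (𝔾 ℓ).rationalPoints)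
    (hsep : ∀ ℓ : P,
      (LinearMap.charpoly (u ℓ : Module.End ℚ_[(ℓ : ℕ)] (V ℓ))).Separable)
    (ρ : ∀ ℓ : P, 𝒢 →* LinearMap.GeneralLinearGroup ℚ_[(ℓ : ℕ)] (V ℓ))
    (hρ_cont : ∀ ℓ, Continuous (ρ ℓ))
    (hρ_lattice : ∀ ℓ, (ρ ℓ).range ≤ latticeAut (T ℓ))
    (hρ_le : ∀ ℓ, (ρ ℓ).range ≤ (𝔾 ℓ).rationalPoints)
    (hρ_open : ∀ ℓ, IsOpen
      (((ρ ℓ).range.subgroupOf (𝔾 ℓ).rationalPoints : Subgroup (𝔾 ℓ).rationalPoints) :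
        Set (𝔾 ℓ).rationalPoints))
    (Y : Set 𝒢)
    (hY : Y = ⋂ ℓ : P, {σ : 𝒢 | Nonempty
      (centralizerOrder (T ℓ) (ρ ℓ σ : Module.End ℚ_[(ℓ : ℕ)] (V ℓ)) ≃ₐ[ℤ_[(ℓ : ℕ)]]
        centralizerOrder (T ℓ) (u ℓ : Module.End ℚ_[(ℓ : ℕ)] (V ℓ)))})
    (ρP : 𝒢 →* ∀ ℓ : P, (ρ ℓ).range)
    (hρP : ρP = MonoidHom.pi fun ℓ => (ρ ℓ).rangeRestrict) :
    (IsOpen (ρP.range : Set (∀ ℓ : P, (ρ ℓ).range)) ∧ ρP.range.FiniteIndex) ∧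
      IsOpen Y ∧ Y.Nonempty ∧ (∀ σ ∈ Y, ∀ τ : 𝒢, τ * σ * τ⁻¹ ∈ Y) ∧ 1 ∈ closure Y := by
  have hproj := isOpen_range_pi hT hρ_cont
  rw [← hρP] at hproj
  have hcompact : ∀ ℓ : P, CompactSpace (ρ ℓ).range := fun ℓ =>
    isCompact_iff_compactSpace.1 (isCompact_range (hρ_cont ℓ))
  have hcont : Continuous ρP := by
    rw [hρP]
    exact continuous_pi fun ℓ => MonoidHom.continuous_rangeRestrict (hρ_cont ℓ)
  have hρP_apply : ∀ (σ : 𝒢) (ℓ : P), ((ρP σ ℓ : (ρ ℓ).range) :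
      LinearMap.GeneralLinearGroup ℚ_[(ℓ : ℕ)] (V ℓ)) = ρ ℓ σ := fun σ ℓ => by rw [hρP]; rfl
  -- Compactness makes `ρP` open onto its image, which is itself open. Hence regular elements chosen
  -- near 1 independently at each prime lift together into any given neighbourhood of 1.
  have hopenMap : IsOpenMap ρP :=
    hproj.isOpenMap_subtype_val.comp (ρP.isOpenMap_rangeRestrict hcont)
  have hclosure : 1 ∈ closure Y := by
    rw [mem_closure_iff_nhds]
    intro W hW
    have h1 := hopenMap.image_mem_nhds hW
    rw [map_one, nhds_pi, Filter.mem_pi] at h1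
    obtain ⟨I, -, U, hU, hUW⟩ := h1
    choose g hgU hg using fun ℓ => exists_mem_commute_iff (h𝔾 ℓ).connected (hu ℓ) (hsep ℓ)
      (hρ_open ℓ) (hU ℓ)
    obtain ⟨σ, hσW, hσ⟩ := hUW (fun ℓ _ => hgU ℓ)
    refine ⟨σ, hσW, ?_⟩
    rw [hY, Set.mem_iInter]
    intro ℓ
    have h2 : ρ ℓ σ = g ℓ := by rw [← hρP_apply, hσ]
    refine ⟨Subalgebra.equivOfEq _ _ (centralizerOrder_congr fun a => ?_)⟩
    rw [h2, hg]
  refine ⟨⟨hproj, ?_⟩, ?_, ?_, ?_, hclosure⟩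
  · have := ρP.range.quotient_finite_of_isOpen hproj
    exact Subgroup.finiteIndex_of_finite_quotient
  · rw [hY]
    refine isOpen_iInter_of_finite fun ℓ => isOpen_iff_mem_nhds.2 fun σ hσ => ?_
    have := hT ℓ
    exact (Units.continuous_val.comp (hρ_cont ℓ)).continuousAt.eventually
      (eventually_centralizerOrder_equiv (hsep ℓ) hσ)
  · exact closure_nonempty_iff.1 ⟨1, hclosure⟩
  · intro σ hσ τ
    rw [hY, Set.mem_iInter] at hσ ⊢
    intro ℓ
    obtain ⟨e⟩ := hσ ℓ
    have hτ : ∀ τ, (ρ ℓ τ : Module.End ℚ_[(ℓ : ℕ)] (V ℓ)) ∈ latticeEnd (T ℓ) := fun τ =>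
      ((Submonoid.mem_units_iff _ _).1 (hρ_lattice ℓ ⟨τ, rfl⟩)).1
    have hconj : (ρ ℓ (τ * σ * τ⁻¹) : Module.End ℚ_[(ℓ : ℕ)] (V ℓ)) =
        (ρ ℓ τ : Module.End ℚ_[(ℓ : ℕ)] (V ℓ)) * ρ ℓ σ * ↑(ρ ℓ τ)⁻¹ := by simp
    have h3 := (centralizerOrderConj (ρ ℓ τ) (hτ τ) (by simpa using hτ τ⁻¹)
      (ρ ℓ σ : Module.End ℚ_[(ℓ : ℕ)] (V ℓ))).symm.trans e
    exact ⟨(Subalgebra.equivOfEq _ _ (by rw [hconj])).trans h3⟩
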